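/- Let $M$ be a smooth (Hausdorff, second countable) manifold of dimension $2n+1$ with an anti-quasi-Sasakian structure $(\varphi,\xi,\eta,g)$. That is, $\varphi$ is a smooth $(1,1)$-tensor field, $\xi$ a smooth vector field, $\eta$ a smooth $1$-form and $g$ a Riemannian metric with $$\varphi^2=-I+\eta\otimes\xi,\quad \eta(\xi)=1,\quad g(\varphi X,\varphi Y)=g(X,Y)-\eta(X)\eta(Y),$$ such that the form $\Phi(X,Y)=g(X,\varphi Y)$ is closed and $N_\varphi=2\,d\eta\otimes\xi$, where $N_\varphi=[\varphi,\varphi]+d\eta\otimes\xi$, $[\varphi,\varphi]$ is the Nijenhuis torsion of $\varphi$, and $d\eta(X,Y)=X(\eta(Y))-Y(\eta(X))-\eta([X,Y])$. Assume that $\xi$ is regular (every point is the centre of a cubical coordinate neighbourhood in which $\xi$ is the first coordinate field and which each orbit of $\xi$ meets in at most one slice) and that all orbits of $\xi$ are compact. Let $\pi:M\to M/\xi$ be the projection onto the space of orbits, with the quotient topology. Then there are a locally constant function $c>0$ on $M$ (a constant if $M$ is connected), a smooth manifold structure of dimension $2n$ (Hausdorff, second countable) on $M/\xi$, a Kähler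 structure $(J,k)$ on $M/\xi$, and a real $2$-form $\omega$ on $M/\xi$ such that: 1. $c\,\xi$ generates a free smooth action of $\mathbb S^1$ on $M$, that is, $t\mapsto e^{it}\cdot x$ is the integral curve of $c\,\xi$ through $x$ for every $x\in M$; 2. with this action, $\pi:M\to M/\xi$ is a smooth principal $\mathbb S^1$-bundle (locally trivial, with the orbits of the action as fibres); 3. $(J,k)$ is induced by $(\varphi,g)$: $\pi_*\circ\varphi=J\circ\pi_*$, and $\pi$ is a Riemannian submersion, i.e. $k(\pi_*X,\pi_*Y)=g(X,Y)$ for $X,Y\in\ker\eta$; 4. $\omega$ is closed and of type $(2,0)$, in the sense that it is $J$-anti-invariant: $\omega(JX,JY)=-\omega(X,Y)$; 5. $\eta$ is a connection form on this bundle, that is, $\eta$ is $\mathbb S^1$-invariant and takes the value $c$ on the fundamental vector field $c\,\xi$ of the action (the Lie algebra of $\mathbb S^1$ being identified with $\mathbb R$ so that the generator of $t\mapsto e^{it}$ corresponds to $c$; equivalently, $c^{-1}\eta$ is a connection form in the usual normalization). Its curvature form $(X,Y)\mapsto d\eta(hX,hY)$, where $hX=X-\eta(X)\xi$, is $d\eta=\pi^*\omega$.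 Here a Kähler structure $(J,k)$ consists of an almost complex structure $J$ with vanishing Nijenhuis tensor and a Riemannian metric $k$ with $k(JX,JY)=k(X,Y)$ for which $\Omega(X,Y)=k(X,JY)$ is closed. -/

import Mathlib

open scoped Manifold ContDiff Bundle

noncomputable section

namespace AQS

/-! Manifolds without boundary of dimension `m` are modelled on `EuclideanSpace ℝ (Fin m)`.
Tensor fields are families of (multi)linear maps on the tangent spaces, smooth as sections of the
corresponding vector bundles. -/

section Fields

variable {m : ℕ} {M : Type*} [TopologicalSpace M] [ChartedSpace (EuclideanSpace ℝ (Fin m)) M]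

/-- Not necessarily smooth vector fields on `M`. -/
abbrev VField (m : ℕ) (M : Type*) [TopologicalSpace M]
    [ChartedSpace (EuclideanSpace ℝ (Fin m)) M] : Type _ :=
  (x : M) → TangentSpace (𝓡 m) x

/-- Not necessarily smooth fields of linear forms. -/
abbrev Form1 (m : ℕ) (M : Type*) [TopologicalSpace M]
    [ChartedSpace (EuclideanSpace ℝ (Fin m)) M] : Type _ :=
  (x : M) → TangentSpace (𝓡 m) x →L[ℝ] ℝ

/-- Not necessarily smooth fields of bilinear forms. -/
abbrev Form2 (m : ℕ) (M : Type*) [TopologicalSpace M]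
    [ChartedSpace (EuclideanSpace ℝ (Fin m)) M] : Type _ :=
  (x : M) → TangentSpace (𝓡 m) x →L[ℝ] TangentSpace (𝓡 m) x →L[ℝ] ℝ

/-- Not necessarily smooth fields of endomorphisms of the tangent spaces. -/
abbrev EndoField (m : ℕ) (M : Type*) [TopologicalSpace M]
    [ChartedSpace (EuclideanSpace ℝ (Fin m)) M] : Type _ :=
  (x : M) → TangentSpace (𝓡 m) x →L[ℝ] TangentSpace (𝓡 m) x

/-- The derivative `X(f)` of a real function along a vector field. -/
def dirDeriv (X : VField m M) (f : M → ℝ) (x : M) : ℝ :=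
  mfderiv (𝓡 m) 𝓘(ℝ, ℝ) f x (X x)

/-- The Lie bracket `[X, Y]`. -/
def bracket (X Y : VField m M) : VField m M :=
  VectorField.mlieBracket (𝓡 m) X Y

/-- A field of endomorphisms applied to a vector field. -/
def EndoField.app (φ : EndoField m M) (X : VField m M) : VField m M := fun x => φ x (X x)

/-- `dη(X, Y) = X(η(Y)) - Y(η(X)) - η([X, Y])`. -/
def d1 (η : Form1 m M) (X Y : VField m M) (x : M) : ℝ :=
  dirDeriv X (fun y => η y (Y y)) x - dirDeriv Y (fun y => η y (X y)) x - η x (bracket X Y x)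

/-- `dσ(X, Y, Z) = X(σ(Y, Z)) + Y(σ(Z, X)) + Z(σ(X, Y))
  - σ([X, Y], Z) - σ([Y, Z], X) - σ([Z, X], Y)`. -/
def d2 (σ : (x : M) → TangentSpace (𝓡 m) x → TangentSpace (𝓡 m) x → ℝ)
    (X Y Z : VField m M) (x : M) : ℝ :=
  dirDeriv X (fun y => σ y (Y y) (Z y)) x + dirDeriv Y (fun y => σ y (Z y) (X y)) x
    + dirDeriv Z (fun y => σ y (X y) (Y y)) x
    - σ x (bracket X Y x) (Z x) - σ x (bracket Y Z x) (X x) - σ x (bracket Z X x) (Y x)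

/-- The Nijenhuis torsion
`[φ, φ](X, Y) = [φX, φY] + φ²[X, Y] - φ[X, φY] - φ[φX, Y]`. -/
def nijenhuis (φ : EndoField m M) (X Y : VField m M) : VField m M := fun x =>
  bracket (φ.app X) (φ.app Y) x + φ x (φ x (bracket X Y x))
    - φ x (bracket X (φ.app Y) x) - φ x (bracket (φ.app X) Y x)

/-- `x` and `y` lie on a common integral curve of `ξ` (defined on some open interval). -/
def SameOrbit (ξ : VField m M) (x y : M) : Prop :=
  ∃ (γ : ℝ → M) (s : Set ℝ), IsOpen s ∧ s.OrdConnected ∧ IsMIntegralCurveOn γ ξ s ∧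
    ∃ a ∈ s, ∃ b ∈ s, γ a = x ∧ γ b = y

/-- The orbit of `ξ` through `x`: the union of the integral curves of `ξ` through `x`. -/
def orbit (ξ : VField m M) (x : M) : Set M := {y | SameOrbit ξ x y}

/-- The space of orbits `M/ξ`, with the quotient topology. -/
abbrev OrbitSpace (ξ : VField m M) : Type _ := Quot (SameOrbit ξ)

/-- The projection `M → M/ξ`. -/
def orbitProj (ξ : VField m M) : M → OrbitSpace ξ := Quot.mk (SameOrbit ξ)

end Fields

/-- `ξ` is regular: each point is the centre of a cubical coordinate neighbourhood in which `ξ` is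
the first coordinate field and which every orbit of `ξ` meets in at most one
slice `{x_i = const, i ≠ 0}`, that is, every orbit passes through it at most once. -/
def IsRegularField {m : ℕ} {M : Type*} [TopologicalSpace M]
    [ChartedSpace (EuclideanSpace ℝ (Fin (m + 1))) M] (ξ : VField (m + 1) M) : Prop :=
  ∀ p : M, ∃ e ∈ IsManifold.maximalAtlas (𝓡 (m + 1)) ∞ M, ∃ a : ℝ, 0 < a ∧
    p ∈ e.source ∧ e p = 0 ∧ e.target = {v | ∀ i, |v i| < a} ∧
    (∀ x ∈ e.source, (mfderiv (𝓡 (m + 1)) (𝓡 (m + 1)) e x (ξ x) : EuclideanSpace ℝ (Fin (m + 1)))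
      = EuclideanSpace.single 0 1) ∧
    ∀ x ∈ e.source, ∀ y ∈ e.source, SameOrbit ξ x y → ∀ i, i ≠ 0 → e x i = e y i

section Smooth

variable {m : ℕ} {M : Type*} [TopologicalSpace M] [ChartedSpace (EuclideanSpace ℝ (Fin m)) M]
  [IsManifold (𝓡 m) ∞ M]

def SmoothVField (X : VField m M) : Prop :=
  ContMDiff (𝓡 m) (𝓡 m).tangent ∞ (fun x => (⟨x, X x⟩ : TangentBundle (𝓡 m) M))

def SmoothForm1 (η : Form1 m M) : Prop :=
  ContMDiff (𝓡 m) ((𝓡 m).prod 𝓘(ℝ, EuclideanSpace ℝ (Fin m) →L[ℝ] ℝ)) ∞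
    (fun x => Bundle.TotalSpace.mk' (EuclideanSpace ℝ (Fin m) →L[ℝ] ℝ)
      (E := fun x : M => TangentSpace (𝓡 m) x →L[ℝ] Bundle.Trivial M ℝ x) x (η x))

def SmoothForm2 (σ : Form2 m M) : Prop :=
  ContMDiff (𝓡 m)
    ((𝓡 m).prod 𝓘(ℝ, EuclideanSpace ℝ (Fin m) →L[ℝ] EuclideanSpace ℝ (Fin m) →L[ℝ] ℝ)) ∞
    (fun x => Bundle.TotalSpace.mk'
      (EuclideanSpace ℝ (Fin m) →L[ℝ] EuclideanSpace ℝ (Fin m) →L[ℝ] ℝ)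
      (E := fun x : M => TangentSpace (𝓡 m) x →L[ℝ] TangentSpace (𝓡 m) x →L[ℝ]
        Bundle.Trivial M ℝ x) x (σ x))

def SmoothEndo (φ : EndoField m M) : Prop :=
  ContMDiff (𝓡 m)
    ((𝓡 m).prod 𝓘(ℝ, EuclideanSpace ℝ (Fin m) →L[ℝ] EuclideanSpace ℝ (Fin m))) ∞
    (fun x => Bundle.TotalSpace.mk' (EuclideanSpace ℝ (Fin m) →L[ℝ] EuclideanSpace ℝ (Fin m))
      (E := fun x : M => TangentSpace (𝓡 m) x →L[ℝ] TangentSpace (𝓡 m) x) x (φ x))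

/-- `dσ = 0`. -/
def IsClosed2 (σ : (x : M) → TangentSpace (𝓡 m) x → TangentSpace (𝓡 m) x → ℝ) : Prop :=
  ∀ X Y Z : VField m M, SmoothVField X → SmoothVField Y → SmoothVField Z →
    ∀ x, d2 σ X Y Z x = 0

variable (m M) in
/-- Smooth Riemannian metrics on `M`. -/
abbrev Metric : Type _ :=
  Bundle.ContMDiffRiemannianMetric (IB := 𝓡 m) (n := ∞) (F := EuclideanSpace ℝ (Fin m))
    (E := fun x : M => TangentSpace (𝓡 m) x)

/-- The form `(v, w) ↦ g(v, φ w)`. -/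
def fundamentalForm (g : Metric m M) (φ : EndoField m M) (x : M)
    (v w : TangentSpace (𝓡 m) x) : ℝ :=
  g.inner x v (φ x w)

variable (m M) in
/-- Almost contact metric structures `(φ, ξ, η, g)`. -/
structure AlmostContactMetric where
  φ : EndoField m M
  ξ : VField m M
  η : Form1 m M
  g : Metric m M
  smooth_φ : SmoothEndo φ
  smooth_ξ : SmoothVField ξ
  smooth_η : SmoothForm1 η
  φ_sq : ∀ x v, φ x (φ x v) = -v + η x v • ξ x
  η_ξ : ∀ x, η x (ξ x) = 1
  compatible : ∀ x v w, g.inner x (φ x v) (φ x w) = g.inner x v w - η x v * η x w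

/-- Anti-quasi-Sasakian structures: `dΦ = 0` and `N_φ = 2 dη ⊗ ξ`, where `Φ(X, Y) = g(X, φY)` and
`N_φ = [φ, φ] + dη ⊗ ξ`. -/
structure AlmostContactMetric.IsAntiQuasiSasakian (S : AlmostContactMetric m M) : Prop where
  closed : IsClosed2 (fundamentalForm S.g S.φ)
  antiNormal : ∀ X Y : VField m M, SmoothVField X → SmoothVField Y → ∀ x,
    nijenhuis S.φ X Y x + d1 S.η X Y x • S.ξ x = (2 * d1 S.η X Y x) • S.ξ x

variable (m M) in
/-- Kähler structures `(J, k)`: `J` is an integrable almost complex structure, `k` is a Hermitian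
metric, and the fundamental form `Ω(X, Y) = k(X, JY)` is closed. -/
structure KahlerStructure where
  J : EndoField m M
  k : Metric m M
  smooth_J : SmoothEndo J
  J_sq : ∀ x v, J x (J x v) = -v
  hermitian : ∀ x v w, k.inner x (J x v) (J x w) = k.inner x v w
  integrable : ∀ X Y : VField m M, SmoothVField X → SmoothVField Y → ∀ x, nijenhuis J X Y x = 0
  closed : IsClosed2 (fundamentalForm k J)

/-- `σ` is a closed (real, smooth) 2-form of type `(2,0)` with respect to `J`,
that is, `J`-anti-invariant. -/
structure IsClosedForm20 (J : EndoField m M) (σ : Form2 m M) : Prop where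
  smooth : SmoothForm2 σ
  skew : ∀ x v w, σ x v w = -σ x w v
  closed : IsClosed2 (fun x v w => σ x v w)
  antiInvariant : ∀ x v w, σ x (J x v) (J x w) = -σ x v w

end Smooth

section Bundle

variable {m : ℕ} {M : Type*} [TopologicalSpace M] [ChartedSpace (EuclideanSpace ℝ (Fin m)) M]

/-- The given action is a smooth free action of `S¹` on `M`. -/
structure IsSmoothFreeAction (m : ℕ) (M : Type*) [TopologicalSpace M]
    [ChartedSpace (EuclideanSpace ℝ (Fin m)) M] [MulAction Circle M] : Prop where
  smooth : ContMDiff ((𝓡 1).prod (𝓡 m)) (𝓡 m) ∞ (fun p : Circle × M => p.1 • p.2)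
  free : ∀ (z : Circle) (x : M), z • x = x → z = 1

/-- The vector field `V` generates the action: `t ↦ e^{it} • x` is the integral curve
of `V` through `x`; in other words, `V` is the fundamental field of the action. -/
def Generates [MulAction Circle M] (V : VField m M) : Prop :=
  ∀ x : M, IsMIntegralCurve (fun t : ℝ => Circle.exp t • x) V

/-- `p : M → B` is a smooth principal circle bundle with respect to the given action of `S¹`:
it is smooth, surjective, the action is smooth and free with the fibres of `p` as its orbits, and
`p` is locally trivial by equivariant diffeomorphisms `p⁻¹(U) ≅ U × S¹` over `U`. -/
structure IsPrincipalCircleBundle [MulAction Circle M] {d : ℕ} {B : Type*} [TopologicalSpace B]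
    [ChartedSpace (EuclideanSpace ℝ (Fin d)) B] (p : M → B) : Prop where
  smooth : ContMDiff (𝓡 m) (𝓡 d) ∞ p
  surjective : Function.Surjective p
  action : IsSmoothFreeAction m M
  fibres : ∀ x y : M, p x = p y ↔ ∃ z : Circle, z • x = y
  locallyTrivial : ∀ b : B, ∃ (U : Set B) (e : OpenPartialHomeomorph M (B × Circle)),
    IsOpen U ∧ b ∈ U ∧ e.source = p ⁻¹' U ∧ e.target = U ×ˢ Set.univ ∧
    ContMDiffOn (𝓡 m) ((𝓡 d).prod (𝓡 1)) ∞ e e.source ∧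
    ContMDiffOn ((𝓡 d).prod (𝓡 1)) (𝓡 m) ∞ e.symm e.target ∧
    ∀ x ∈ e.source, (e x).1 = p x ∧ ∀ z : Circle, e (z • x) = (p x, z * (e x).2)

/-- `η` is a connection form for the circle action, with values in `ℝ`. Here the Lie algebra `iℝ`
of `S¹` is identified with `ℝ` by `i ↦ c`, where `c ≠ 0` is locally constant (hence one number on
each component of `M`); `c = 1` is the usual normalization. Thus `η` takes the value `c` on the
fundamental field `d/dt (e^{it} • x)` at `t = 0`, and it is invariant under the action. -/
structure IsConnectionForm [IsManifold (𝓡 m) ∞ M] [MulAction Circle M] (c : M → ℝ)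
    (η : Form1 m M) : Prop where
  smooth : SmoothForm1 η
  locallyConstant : IsLocallyConstant c
  ne_zero : ∀ x, c x ≠ 0
  fundamental : ∀ x : M, η (Circle.exp 0 • x)
    (mfderiv 𝓘(ℝ, ℝ) (𝓡 m) (fun t : ℝ => Circle.exp t • x) 0 (1 : ℝ)) = c x
  invariant : ∀ (z : Circle) (x : M) (v : TangentSpace (𝓡 m) x),
    η (z • x) (mfderiv (𝓡 m) (𝓡 m) (fun y : M => z • y) x v) = η x v

/-- The curvature form `(X, Y) ↦ dη(hX, hY)`, where `hX = X - η(X) ξ` is the horizontal part of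
`X`, for a connection form `η` and a vertical field `ξ` with `η(ξ) = 1`. -/
def curvature (η : Form1 m M) (ξ : VField m M) (X Y : VField m M) (x : M) : ℝ :=
  d1 η (fun y => X y - η y (X y) • ξ y) (fun y => Y y - η y (Y y) • ξ y) x

end Bundle

end AQS

end

open scoped Manifold ContDiff Bundle

namespace AQS

open Set Filter Topology VectorField

noncomputable section

/-! The hypothesis on `N_φ` says that the torsion of `φ` is `dη ⊗ ξ`. Evaluating this on `(X, ξ)`
and applying `η` shows that `η`, and then `φ`, are invariant along `ξ`; the `η`-component for
general arguments is `dη(φX, φY) = -dη(X, Y)` (`flat_antiNormal`). The closed form `Φ` is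
annihilated by `ξ`, so Cartan's formula makes it invariant too. Consequently `φ`, `Φ`, `dη` and the
transverse metric `g - η ⊗ η = Φ(φ·, ·)` all vanish on `ξ` and are invariant: they are basic
tensors.

The circle action is obtained as in the Boothby-Wang theorem. Around each point of a compact orbit
the field has integral curves of a uniform length, so `ξ` is complete (`exists_isMIntegralCurve`).
Regularity bounds the times at which an orbit crosses one box, so a compact orbit returns to its
starting point (`exists_return`). The decisive point is that the period is locally constant. Suppose
the flow at time `T` fixes `p`. By regularity it moves each nearby point inside a box along its own
orbit, by a time shift `s`. It preserves `η`, and `η(ξ) = 1`, so `ds = 0`; since `s` vanishes at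
`p`, it vanishes nearby (`eventually_period`). A compactness argument excludes shorter periods
(`eventually_isMinPeriod`). With `c` the minimal period divided by `2π`, the flow of `c ξ` is a free
circle action.

The transverse coordinates of flow boxes are charts of the orbit space, which is Hausdorff because
the circle is compact. The hyperplane of a box where the first coordinate vanishes is a local
section of the projection and gives the local trivializations. In a box `ξ` is the constant field
`e₀ m`, the flow is translation, and the coefficients of a basic tensor do not depend on the first
coordinate; so basic tensors descend, and their exterior derivative or torsion downstairs is
computed on that hyperplane. Thus `g - η ⊗ η` gives the metric, `φ` gives `J`, whose torsion is the
projection of the vertical field `dη(X, Y) ξ` and hence zero, `Φ` gives the closed Kähler form, and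
`dη` gives the curvature form on the base. -/

/-- The model space of `m`-dimensional manifolds. -/
abbrev Euc (m : ℕ) : Type := EuclideanSpace ℝ (Fin m)

/-! ### Brackets, exterior derivatives and torsion in a chart -/

section ChartCalculus

variable {m : ℕ} {M : Type*} [TopologicalSpace M] [ChartedSpace (Euc m) M]

/-- The derivative of the inverse of a chart. -/
def dsymm (e : OpenPartialHomeomorph M (Euc m)) (v : Euc m) :
    Euc m →L[ℝ] TangentSpace (𝓡 m) (e.symm v) :=
  mfderiv (𝓡 m) (𝓡 m) e.symm v

/-- The derivative of a chart. -/
def dchart (e : OpenPartialHomeomorph M (Euc m)) (x : M) :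
    TangentSpace (𝓡 m) x →L[ℝ] Euc m :=
  mfderiv (𝓡 m) (𝓡 m) e x

/-- A vector field read in a chart. -/
def pullField (e : OpenPartialHomeomorph M (Euc m)) (X : VField m M) (v : Euc m) : Euc m :=
  dchart e (e.symm v) (X (e.symm v))

/-- A field of linear forms read in a chart. -/
def pullForm1 (e : OpenPartialHomeomorph M (Euc m)) (η : Form1 m M) (v : Euc m) :
    Euc m →L[ℝ] ℝ :=
  (η (e.symm v)).comp (dsymm e v)

/-- A field of bilinear forms read in a chart. -/
def pullForm2 (e : OpenPartialHomeomorph M (Euc m)) (σ : Form2 m M) (v : Euc m) :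
    Euc m →L[ℝ] Euc m →L[ℝ] ℝ :=
  ((ContinuousLinearMap.precomp ℝ (dsymm e v)).comp (σ (e.symm v))).comp (dsymm e v)

/-- A field of endomorphisms read in a chart. -/
def pullEndo (e : OpenPartialHomeomorph M (Euc m)) (φ : EndoField m M) (v : Euc m) :
    Euc m →L[ℝ] Euc m :=
  (dchart e (e.symm v)).comp ((φ (e.symm v)).comp (dsymm e v))

variable {e : OpenPartialHomeomorph M (Euc m)}

theorem mdifferentiable_of_mem_maximalAtlas (he : e ∈ IsManifold.maximalAtlas (𝓡 m) ∞ M) :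
    e.MDifferentiable (𝓡 m) (𝓡 m) :=
  ⟨(contMDiffOn_of_mem_maximalAtlas he).mdifferentiableOn (by simp),
    (contMDiffOn_symm_of_mem_maximalAtlas he).mdifferentiableOn (by simp)⟩

theorem dchart_dsymm (he : e ∈ IsManifold.maximalAtlas (𝓡 m) ∞ M) {v : Euc m}
    (hv : v ∈ e.target) (x : Euc m) : dchart e (e.symm v) (dsymm e v x) = x :=
  DFunLike.congr_fun ((mdifferentiable_of_mem_maximalAtlas he).comp_symm_deriv hv) x

theorem dsymm_dchart (he : e ∈ IsManifold.maximalAtlas (𝓡 m) ∞ M) {v : Euc m}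
    (hv : v ∈ e.target) (w : TangentSpace (𝓡 m) (e.symm v)) :
    dsymm e v (dchart e (e.symm v) w) = w := by
  have := (mdifferentiable_of_mem_maximalAtlas he).symm_comp_deriv (e.map_target hv)
  rw [e.right_inv hv] at this
  exact DFunLike.congr_fun this w

/-- `mpullback` applies the inverse of the derivative of `e.symm`, which is the derivative of `e`.
This makes the naturality of the Lie bracket available for `pullField`. -/
theorem pullField_eq_mpullback (he : e ∈ IsManifold.maximalAtlas (𝓡 m) ∞ M) {v : Euc m}
    (hv : v ∈ e.target) (X : VField m M) :
    pullField e X v = mpullback (𝓡 m) (𝓡 m) e.symm X v := by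
  have h1 := (mdifferentiable_of_mem_maximalAtlas he).comp_symm_deriv hv
  have h2 := (mdifferentiable_of_mem_maximalAtlas he).symm_comp_deriv (e.map_target hv)
  rw [e.right_inv hv] at h2
  rw [mpullback_apply, ContinuousLinearMap.inverse_eq h2 h1]
  rfl

theorem isInvertible_mfderiv_symm (he : e ∈ IsManifold.maximalAtlas (𝓡 m) ∞ M) {v : Euc m}
    (hv : v ∈ e.target) : (mfderiv (𝓡 m) (𝓡 m) e.symm v).IsInvertible := by
  have h1 := (mdifferentiable_of_mem_maximalAtlas he).comp_symm_deriv hv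
  have h2 := (mdifferentiable_of_mem_maximalAtlas he).symm_comp_deriv (e.map_target hv)
  rw [e.right_inv hv] at h2
  exact ContinuousLinearMap.IsInvertible.of_inverse h2 h1

theorem minSmoothness_two_le : minSmoothness ℝ 2 ≤ ∞ := by
  rw [minSmoothness_of_isRCLikeNormedField]
  exact WithTop.coe_le_coe.2 (le_top : (2 : ℕ∞) ≤ ⊤)

theorem mlieBracket_euc (V W : (v : Euc m) → TangentSpace (𝓡 m) v) (v : Euc m) :
    mlieBracket (𝓡 m) V W v = lieBracket ℝ (V : Euc m → Euc m) (W : Euc m → Euc m) v := by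
  rw [← mlieBracketWithin_univ]
  exact (congrFun mlieBracketWithin_eq_lieBracketWithin v).trans
    (congrFun (lieBracketWithin_univ (𝕜 := ℝ) (E := Euc m)) v)

variable [IsManifold (𝓡 m) ∞ M]

theorem contDiffAt_pullField (he : e ∈ IsManifold.maximalAtlas (𝓡 m) ∞ M) {v : Euc m}
    (hv : v ∈ e.target) {X : VField m M}
    (hX : ContMDiffAt (𝓡 m) (𝓡 m).tangent ∞
      (fun x => (⟨x, X x⟩ : TangentBundle (𝓡 m) M)) (e.symm v)) :
    ContDiffAt ℝ ∞ (pullField e X) v := by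
  have h := ContMDiffAt.mpullback_vectorField_preimage (m := ∞) (n := ∞) (I := 𝓡 m) (I' := 𝓡 m)
    (f := e.symm) (V := X) (x₀ := v) hX
    (contMDiffAt_symm_of_mem_maximalAtlas he hv) (isInvertible_mfderiv_symm he hv) (by simp)
  have h2 : ContDiffAt ℝ ∞ (mpullback (𝓡 m) (𝓡 m) e.symm X : Euc m → Euc m) v :=
    contMDiffAt_vectorSpace_iff_contDiffAt.1 h
  refine h2.congr_of_eventuallyEq ?_
  filter_upwards [e.open_target.mem_nhds hv] with w hw using pullField_eq_mpullback he hw X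

theorem pullField_bracket (he : e ∈ IsManifold.maximalAtlas (𝓡 m) ∞ M) {v : Euc m}
    (hv : v ∈ e.target) {X Y : VField m M} (hX : SmoothVField X) (hY : SmoothVField Y) :
    pullField e (bracket X Y) v = lieBracket ℝ (pullField e X) (pullField e Y) v := by
  have : IsManifold (𝓡 m) (minSmoothness ℝ 2) M :=
    IsManifold.of_le (n := ∞) minSmoothness_two_le
  rw [pullField_eq_mpullback he hv, bracket, mpullback_mlieBracket (n := ∞)
    ((hX _).mdifferentiableAt (by simp)) ((hY _).mdifferentiableAt (by simp))
    (contMDiffAt_symm_of_mem_maximalAtlas he hv) minSmoothness_two_le]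
  refine (mlieBracket_euc _ _ v).trans ?_
  have h : ∀ Z : VField m M, (mpullback (𝓡 m) (𝓡 m) e.symm Z : Euc m → Euc m) =ᶠ[𝓝 v]
      pullField e Z := fun Z => by
    filter_upwards [e.open_target.mem_nhds hv] with w hw using (pullField_eq_mpullback he hw _).symm
  exact Filter.EventuallyEq.lieBracket_vectorField_eq (E := Euc m) (h X) (h Y)

omit [IsManifold (𝓡 m) ∞ M] in
theorem dirDeriv_eq (he : e ∈ IsManifold.maximalAtlas (𝓡 m) ∞ M) {v : Euc m}
    (hv : v ∈ e.target) {f : M → ℝ} {f' : Euc m → ℝ} (hf : DifferentiableAt ℝ f' v)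
    (hff : ∀ w ∈ e.target, f (e.symm w) = f' w) (X : VField m M) :
    dirDeriv X f (e.symm v) = fderiv ℝ f' v (pullField e X v) := by
  have h1 : HasMFDerivAt (𝓡 m) 𝓘(ℝ, ℝ) (f' ∘ e) (e.symm v)
      ((fderiv ℝ f' v).comp (mfderiv (𝓡 m) (𝓡 m) e (e.symm v))) := by
    refine HasMFDerivAt.comp (I' := 𝓡 m) _ ?_
      ((mdifferentiable_of_mem_maximalAtlas he).mdifferentiableAt (e.map_target hv)).hasMFDerivAt
    rw [e.right_inv hv]
    exact hf.hasFDerivAt.hasMFDerivAt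
  have h2 : f =ᶠ[𝓝 (e.symm v)] f' ∘ e := by
    filter_upwards [e.open_source.mem_nhds (e.map_target hv)] with x hx
    rw [Function.comp_apply, ← hff _ (e.map_source hx), e.left_inv hx]
  rw [dirDeriv, (h1.congr_of_eventuallyEq h2).mfderiv]
  rfl

omit [IsManifold (𝓡 m) ∞ M] in
theorem pullForm1_apply (η : Form1 m M) (v x : Euc m) :
    pullForm1 e η v x = η (e.symm v) (dsymm e v x) := rfl

omit [IsManifold (𝓡 m) ∞ M] in
theorem pullForm2_apply (σ : Form2 m M) (v x y : Euc m) :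
    pullForm2 e σ v x y = σ (e.symm v) (dsymm e v x) (dsymm e v y) := rfl

omit [IsManifold (𝓡 m) ∞ M] in
theorem pullEndo_apply (φ : EndoField m M) (v x : Euc m) :
    pullEndo e φ v x = dchart e (e.symm v) (φ (e.symm v) (dsymm e v x)) := rfl

omit [IsManifold (𝓡 m) ∞ M] in
theorem pullForm1_pullField (he : e ∈ IsManifold.maximalAtlas (𝓡 m) ∞ M) {v : Euc m}
    (hv : v ∈ e.target) (η : Form1 m M) (X : VField m M) :
    pullForm1 e η v (pullField e X v) = η (e.symm v) (X (e.symm v)) := by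
  rw [pullForm1_apply, pullField, dsymm_dchart he hv]

omit [IsManifold (𝓡 m) ∞ M] in
theorem pullForm2_pullField (he : e ∈ IsManifold.maximalAtlas (𝓡 m) ∞ M) {v : Euc m}
    (hv : v ∈ e.target) (σ : Form2 m M) (X Y : VField m M) :
    pullForm2 e σ v (pullField e X v) (pullField e Y v) =
      σ (e.symm v) (X (e.symm v)) (Y (e.symm v)) := by
  rw [pullForm2_apply, pullField, pullField, dsymm_dchart he hv, dsymm_dchart he hv]

omit [IsManifold (𝓡 m) ∞ M] in
theorem pullEndo_pullField (he : e ∈ IsManifold.maximalAtlas (𝓡 m) ∞ M) {v : Euc m}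
    (hv : v ∈ e.target) (φ : EndoField m M) (X : VField m M) :
    pullEndo e φ v (pullField e X v) = pullField e (φ.app X) v := by
  rw [pullEndo_apply, pullField, dsymm_dchart he hv]
  rfl

/-- The exterior derivative of a `1`-form on a vector space. -/
def flatD1 (η : Euc m → Euc m →L[ℝ] ℝ) (v x y : Euc m) : ℝ :=
  fderiv ℝ η v x y - fderiv ℝ η v y x

/-- The exterior derivative of a `2`-form on a vector space. -/
def flatD2 (σ : Euc m → Euc m →L[ℝ] Euc m →L[ℝ] ℝ) (v x y z : Euc m) : ℝ :=
  fderiv ℝ σ v x y z + fderiv ℝ σ v y z x + fderiv ℝ σ v z x y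

/-- The Nijenhuis torsion of a field of endomorphisms of a vector space. -/
def flatNij (φ : Euc m → Euc m →L[ℝ] Euc m) (v x y : Euc m) : Euc m :=
  fderiv ℝ φ v (φ v x) y - fderiv ℝ φ v (φ v y) x - φ v (fderiv ℝ φ v x y)
    + φ v (fderiv ℝ φ v y x)

/-- By the product rule, the terms in which `X` or `Y` is differentiated cancel against the bracket.
Only the values of the fields at the point remain. -/
theorem d1_eq (he : e ∈ IsManifold.maximalAtlas (𝓡 m) ∞ M) {v : Euc m}
    (hv : v ∈ e.target) {η : Form1 m M} (hη : DifferentiableAt ℝ (pullForm1 e η) v)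
    {X Y : VField m M} (hX : SmoothVField X) (hY : SmoothVField Y) :
    d1 η X Y (e.symm v) = flatD1 (pullForm1 e η) v (pullField e X v) (pullField e Y v) := by
  have dX := (contDiffAt_pullField he hv (hX _)).differentiableAt (by simp)
  have dY := (contDiffAt_pullField he hv (hY _)).differentiableAt (by simp)
  rw [d1, dirDeriv_eq he hv (hη.clm_apply dY) fun w hw => (pullForm1_pullField he hw η Y).symm,
    dirDeriv_eq he hv (hη.clm_apply dX) fun w hw => (pullForm1_pullField he hw η X).symm,
    ← pullForm1_pullField he hv, pullField_bracket he hv hX hY, lieBracket,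
    fderiv_clm_apply hη dX, fderiv_clm_apply hη dY, flatD1]
  simp
  ring

/-- The same cancellation as for 1-forms; skewness is needed because a differentiated field and a
bracket occupy different slots of the form. -/
theorem d2_eq (he : e ∈ IsManifold.maximalAtlas (𝓡 m) ∞ M) {v : Euc m}
    (hv : v ∈ e.target) {σ : Form2 m M} (hσ : DifferentiableAt ℝ (pullForm2 e σ) v)
    (hskew : ∀ x v w, σ x v w = -σ x w v)
    {X Y Z : VField m M} (hX : SmoothVField X) (hY : SmoothVField Y) (hZ : SmoothVField Z) :
    d2 (fun x v w => σ x v w) X Y Z (e.symm v) =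
      flatD2 (pullForm2 e σ) v (pullField e X v) (pullField e Y v) (pullField e Z v) := by
  have dX := (contDiffAt_pullField he hv (hX _)).differentiableAt (by simp)
  have dY := (contDiffAt_pullField he hv (hY _)).differentiableAt (by simp)
  have dZ := (contDiffAt_pullField he hv (hZ _)).differentiableAt (by simp)
  have hs : ∀ x y, pullForm2 e σ v x y = - pullForm2 e σ v y x := fun x y => hskew _ _ _
  rw [d2, dirDeriv_eq he hv ((hσ.clm_apply dY).clm_apply dZ)
      fun w hw => (pullForm2_pullField he hw σ Y Z).symm,
    dirDeriv_eq he hv ((hσ.clm_apply dZ).clm_apply dX)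
      fun w hw => (pullForm2_pullField he hw σ Z X).symm,
    dirDeriv_eq he hv ((hσ.clm_apply dX).clm_apply dY)
      fun w hw => (pullForm2_pullField he hw σ X Y).symm,
    ← pullForm2_pullField he hv, ← pullForm2_pullField he hv, ← pullForm2_pullField he hv,
    pullField_bracket he hv hX hY, pullField_bracket he hv hY hZ, pullField_bracket he hv hZ hX,
    lieBracket, lieBracket, lieBracket,
    fderiv_clm_apply (hσ.clm_apply dX) dY, fderiv_clm_apply (hσ.clm_apply dY) dZ,
    fderiv_clm_apply (hσ.clm_apply dZ) dX, fderiv_clm_apply hσ dX,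
    fderiv_clm_apply hσ dY, fderiv_clm_apply hσ dZ, flatD2]
  simp
  rw [hs (pullField e X v), hs (pullField e Y v), hs (pullField e Z v)]
  ring

/-- The torsion is tensorial: expanding the four brackets, all derivatives of `X` and `Y` cancel and
only those of `φ` survive. -/
theorem pullField_nijenhuis (he : e ∈ IsManifold.maximalAtlas (𝓡 m) ∞ M) {v : Euc m}
    (hv : v ∈ e.target) {φ : EndoField m M} (hφ : DifferentiableAt ℝ (pullEndo e φ) v)
    {X Y : VField m M} (hX : SmoothVField X) (hY : SmoothVField Y)
    (hX' : SmoothVField (φ.app X)) (hY' : SmoothVField (φ.app Y)) :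
    pullField e (nijenhuis φ X Y) v =
      flatNij (pullEndo e φ) v (pullField e X v) (pullField e Y v) := by
  have dX := (contDiffAt_pullField he hv (hX _)).differentiableAt (by simp)
  have dY := (contDiffAt_pullField he hv (hY _)).differentiableAt (by simp)
  have key : pullField e (nijenhuis φ X Y) v = pullField e (bracket (φ.app X) (φ.app Y)) v
      + pullField e (φ.app (φ.app (bracket X Y))) v - pullField e (φ.app (bracket X (φ.app Y))) v
      - pullField e (φ.app (bracket (φ.app X) Y)) v := by
    simp only [pullField, nijenhuis, EndoField.app, map_add, map_sub]
  have eX : pullField e (φ.app X) =ᶠ[𝓝 v] fun w => pullEndo e φ w (pullField e X w) := by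
    filter_upwards [e.open_target.mem_nhds hv] with w hw using (pullEndo_pullField he hw φ X).symm
  have eY : pullField e (φ.app Y) =ᶠ[𝓝 v] fun w => pullEndo e φ w (pullField e Y w) := by
    filter_upwards [e.open_target.mem_nhds hv] with w hw using (pullEndo_pullField he hw φ Y).symm
  rw [key]
  simp only [← pullEndo_pullField he hv]
  rw [pullField_bracket he hv hX' hY', pullField_bracket he hv hX hY,
    pullField_bracket he hv hX hY', pullField_bracket he hv hX' hY]
  simp only [lieBracket, eX.fderiv_eq, eY.fderiv_eq, eX.eq_of_nhds, eY.eq_of_nhds,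
    fderiv_clm_apply hφ dX, fderiv_clm_apply hφ dY, flatNij]
  simp
  abel

/-- Every tangent vector at a point of a chart domain is the value of a smooth vector field which
is constant near this point in the chart. -/
theorem exists_smoothVField [T2Space M] (he : e ∈ IsManifold.maximalAtlas (𝓡 m) ∞ M) {v : Euc m}
    (hv : v ∈ e.target) (x : Euc m) :
    ∃ X : VField m M, SmoothVField X ∧ ∀ᶠ w in 𝓝 v, pullField e X w = x := by
  have hs := e.open_source.mem_nhds (e.map_target hv)
  -- A bump function supported in the chart domain extends the locally defined constant field by
  -- zero.
  obtain ⟨f, -, hf⟩ := (SmoothBumpFunction.nhds_basis_tsupport (I := 𝓡 m) (e.symm v)).mem_iff.1 hs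
  let V₀ : (y : Euc m) → TangentSpace (𝓡 m) y := fun _ => x
  let V : VField m M := mpullback (𝓡 m) (𝓡 m) e V₀
  have hVe : ∀ w ∈ e.target, V (e.symm w) = dsymm e w x := by
    intro w hw
    have h1 := (mdifferentiable_of_mem_maximalAtlas he).comp_symm_deriv hw
    have h2 := (mdifferentiable_of_mem_maximalAtlas he).symm_comp_deriv (e.map_target hw)
    rw [e.right_inv hw] at h2
    exact DFunLike.congr_fun (ContinuousLinearMap.inverse_eq h1 h2) x
  have hV : ContMDiffOn (𝓡 m) (𝓡 m).tangent ∞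
      (fun y => (⟨y, V y⟩ : TangentBundle (𝓡 m) M)) e.source := by
    intro y hy
    refine (ContMDiffAt.mpullback_vectorField_preimage (m := ∞) (n := ∞) (I := 𝓡 m) (I' := 𝓡 m)
      (f := e) (V := V₀) (x₀ := y) ?_ (contMDiffAt_of_mem_maximalAtlas he hy) ?_
      (by simp)).contMDiffWithinAt
    · exact contMDiffAt_vectorSpace_iff_contDiffAt.2 contDiffAt_const
    · have h1 := (mdifferentiable_of_mem_maximalAtlas he).comp_symm_deriv (e.map_source hy)
      have h2 := (mdifferentiable_of_mem_maximalAtlas he).symm_comp_deriv hy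
      rw [e.left_inv hy] at h1
      exact ContinuousLinearMap.IsInvertible.of_inverse h1 h2
  refine ⟨fun y => f y • V y, ContMDiffOn.smul_section_of_tsupport f.contMDiff.contMDiffOn
    e.open_source hf hV, ?_⟩
  have h1 : ∀ᶠ w in 𝓝 v, f (e.symm w) = 1 :=
    (e.continuousAt_symm hv).eventually f.eventuallyEq_one
  filter_upwards [h1, e.open_target.mem_nhds hv] with w hw hw'
  rw [pullField, hw, one_smul, hVe w hw', dchart_dsymm he hw']

end ChartCalculus

/-- A linear map out of a finite-dimensional space is the tuple of its values on a basis, so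
smoothness can be tested on fixed vectors. -/
theorem contDiffAt_of_forall_apply {D F : Type*} [NormedAddCommGroup D] [NormedSpace ℝ D]
    [NormedAddCommGroup F] [NormedSpace ℝ F] {m : ℕ} {f : D → Euc m →L[ℝ] F} {x : D}
    (h : ∀ y, ContDiffAt ℝ ∞ (fun x => f x y) x) : ContDiffAt ℝ ∞ f x := by
  let e₁ : Euc m ≃L[ℝ] (Fin m → ℝ) := ContinuousLinearEquiv.ofFinrankEq (by simp)
  let e₂ := (e₁.arrowCongr (1 : F ≃L[ℝ] F)).trans (ContinuousLinearEquiv.piRing (Fin m))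
  rw [← Function.id_comp f, ← e₂.symm_comp_self]
  exact e₂.symm.contDiff.contDiffAt.comp x (contDiffAt_pi.2 fun i => h _)

/-! ### Smooth sections versus smooth coefficients in charts -/

section SmoothTensors

variable {m : ℕ} {M : Type*} [TopologicalSpace M] [ChartedSpace (Euc m) M]
  [IsManifold (𝓡 m) ∞ M] {e : OpenPartialHomeomorph M (Euc m)}

theorem SmoothEndo.app {φ : EndoField m M} (hφ : SmoothEndo φ) {X : VField m M}
    (hX : SmoothVField X) : SmoothVField (φ.app X) :=
  ContMDiff.clm_bundle_apply (F₁ := Euc m) (F₂ := Euc m) hφ hX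

theorem SmoothForm1.apply {η : Form1 m M} (hη : SmoothForm1 η) {X : VField m M}
    (hX : SmoothVField X) : ContMDiff (𝓡 m) 𝓘(ℝ, ℝ) ∞ fun x => η x (X x) := by
  have h := ContMDiff.clm_bundle_apply (F₁ := Euc m) (F₂ := ℝ) (E₂ := Bundle.Trivial M ℝ) hη hX
  intro x
  exact (Bundle.contMDiffAt_totalSpace.1 (h x)).2

theorem SmoothForm2.apply {σ : Form2 m M} (hσ : SmoothForm2 σ) {X Y : VField m M}
    (hX : SmoothVField X) (hY : SmoothVField Y) :
    ContMDiff (𝓡 m) 𝓘(ℝ, ℝ) ∞ fun x => σ x (X x) (Y x) := by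
  have h := ContMDiff.clm_bundle_apply₂ (F₁ := Euc m) (F₂ := Euc m) (F₃ := ℝ)
    (E₃ := Bundle.Trivial M ℝ) hσ hX hY
  intro x
  exact (Bundle.contMDiffAt_totalSpace.1 (h x)).2

omit [IsManifold (𝓡 m) ∞ M] in
theorem ContMDiff.contDiffAt_comp_symm (he : e ∈ IsManifold.maximalAtlas (𝓡 m) ∞ M) {v : Euc m}
    (hv : v ∈ e.target) {f : M → ℝ} (hf : ContMDiff (𝓡 m) 𝓘(ℝ, ℝ) ∞ f) :
    ContDiffAt ℝ ∞ (fun w => f (e.symm w)) v :=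
  (ContMDiffAt.comp v (hf _) (contMDiffAt_symm_of_mem_maximalAtlas he hv)).contDiffAt

/-- Near the point, the coefficient on a fixed vector is the form evaluated on a global smooth field
that is constant in the chart. -/
theorem SmoothForm1.contDiffAt_pullForm1 [T2Space M]
    (he : e ∈ IsManifold.maximalAtlas (𝓡 m) ∞ M) {v : Euc m} (hv : v ∈ e.target)
    {η : Form1 m M} (hη : SmoothForm1 η) : ContDiffAt ℝ ∞ (pullForm1 e η) v := by
  refine contDiffAt_of_forall_apply fun x => ?_
  obtain ⟨X, hX, hXx⟩ := exists_smoothVField he hv x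
  refine (ContMDiff.contDiffAt_comp_symm he hv (hη.apply hX)).congr_of_eventuallyEq ?_
  filter_upwards [hXx, e.open_target.mem_nhds hv] with w h1 hw
  rw [← pullForm1_pullField he hw, h1]

theorem SmoothForm2.contDiffAt_pullForm2 [T2Space M]
    (he : e ∈ IsManifold.maximalAtlas (𝓡 m) ∞ M) {v : Euc m} (hv : v ∈ e.target)
    {σ : Form2 m M} (hσ : SmoothForm2 σ) : ContDiffAt ℝ ∞ (pullForm2 e σ) v := by
  refine contDiffAt_of_forall_apply fun x => contDiffAt_of_forall_apply fun y => ?_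
  obtain ⟨X, hX, hXx⟩ := exists_smoothVField he hv x
  obtain ⟨Y, hY, hYy⟩ := exists_smoothVField he hv y
  refine (ContMDiff.contDiffAt_comp_symm he hv (hσ.apply hX hY)).congr_of_eventuallyEq ?_
  filter_upwards [hXx, hYy, e.open_target.mem_nhds hv] with w h1 h2 hw
  rw [← pullForm2_pullField he hw, h1, h2]

theorem SmoothEndo.contDiffAt_pullEndo [T2Space M]
    (he : e ∈ IsManifold.maximalAtlas (𝓡 m) ∞ M) {v : Euc m} (hv : v ∈ e.target)
    {φ : EndoField m M} (hφ : SmoothEndo φ) : ContDiffAt ℝ ∞ (pullEndo e φ) v := by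
  refine contDiffAt_of_forall_apply fun x => ?_
  obtain ⟨X, hX, hXx⟩ := exists_smoothVField he hv x
  refine (contDiffAt_pullField he hv (hφ.app hX _)).congr_of_eventuallyEq ?_
  filter_upwards [hXx, e.open_target.mem_nhds hv] with w h1 hw
  rw [← pullEndo_pullField he hw, h1]

theorem continuousLinearMapAt_eq_dchart {x₀ x : M} (hx : x ∈ (chartAt (Euc m) x₀).source)
    (w : TangentSpace (𝓡 m) x) :
    (trivializationAt (Euc m) (TangentSpace (𝓡 m)) x₀).continuousLinearMapAt ℝ x w =
      dchart (chartAt (Euc m) x₀) x w :=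
  DFunLike.congr_fun (TangentBundle.continuousLinearMapAt_trivializationAt (I := 𝓡 m) hx) w

theorem trivializationAt_symm_eq_dsymm {x₀ : M} {w : Euc m}
    (hw : w ∈ (chartAt (Euc m) x₀).target) (v : Euc m) :
    (trivializationAt (Euc m) (TangentSpace (𝓡 m)) x₀).symm ((chartAt (Euc m) x₀).symm w) v =
      dsymm (chartAt (Euc m) x₀) w v := by
  have hx := (chartAt (Euc m) x₀).map_target hw
  have hb : (chartAt (Euc m) x₀).symm w ∈
      (trivializationAt (Euc m) (TangentSpace (𝓡 m)) x₀).baseSet := by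
    rwa [TangentBundle.trivializationAt_baseSet]
  have he := IsManifold.subset_maximalAtlas (n := ∞) (chart_mem_atlas (Euc m) x₀) (I := 𝓡 m)
  rw [← dsymm_dchart he hw ((trivializationAt (Euc m) (TangentSpace (𝓡 m)) x₀).symm _ v),
    ← continuousLinearMapAt_eq_dchart hx]
  congr 1
  have := (trivializationAt (Euc m) (TangentSpace (𝓡 m)) x₀).continuousLinearMapAt_symmL
    (R := ℝ) hb v
  rwa [Bundle.Trivialization.symmL_apply _ hb] at this

theorem contMDiffAt_of_eq_comp_chart {G : Type*} [NormedAddCommGroup G] [NormedSpace ℝ G]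
    {x₀ : M} {f : M → G} {f' : Euc m → G}
    (hf : ContDiffAt ℝ ∞ f' (chartAt (Euc m) x₀ x₀))
    (h : ∀ w ∈ (chartAt (Euc m) x₀).target, f ((chartAt (Euc m) x₀).symm w) = f' w) :
    ContMDiffAt (𝓡 m) 𝓘(ℝ, G) ∞ f x₀ := by
  have he := IsManifold.subset_maximalAtlas (n := ∞) (chart_mem_atlas (Euc m) x₀) (I := 𝓡 m)
  have h1 : ContMDiffAt (𝓡 m) 𝓘(ℝ, G) ∞ (f' ∘ chartAt (Euc m) x₀) x₀ :=
    ContMDiffAt.comp (I' := 𝓡 m) x₀ hf.contMDiffAt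
      (contMDiffAt_of_mem_maximalAtlas he (mem_chart_source _ _))
  refine h1.congr_of_eventuallyEq ?_
  filter_upwards [(chartAt (Euc m) x₀).open_source.mem_nhds (mem_chart_source _ _)] with x hx
  rw [Function.comp_apply, ← h _ ((chartAt (Euc m) x₀).map_source hx),
    (chartAt (Euc m) x₀).left_inv hx]

/-- The trivialization of the tangent bundle at `x₀` is the derivative of the preferred chart, so
the coordinate expression of the section is the chart coefficient. -/
theorem smoothForm2_of_contDiffAt {σ : Form2 m M}
    (h : ∀ x₀ : M, ContDiffAt ℝ ∞ (pullForm2 (chartAt (Euc m) x₀) σ) (chartAt (Euc m) x₀ x₀)) :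
    SmoothForm2 σ := by
  intro x₀
  rw [contMDiffAt_hom_bundle]
  refine ⟨contMDiffAt_id, contMDiffAt_of_eq_comp_chart (h x₀) fun w hw => ?_⟩
  have hb : (chartAt (Euc m) x₀).symm w ∈
      (trivializationAt (Euc m) (TangentSpace (𝓡 m)) x₀).baseSet := by
    rw [TangentBundle.trivializationAt_baseSet]
    exact (chartAt (Euc m) x₀).map_target hw
  ext x y
  refine (inCoordinates_apply_eq₂ (E₃ := Bundle.Trivial M ℝ) hb hb
    (mem_univ _)).trans ?_
  simp only [trivializationAt_symm_eq_dsymm hw, pullForm2_apply]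
  simp

theorem smoothEndo_of_contDiffAt {φ : EndoField m M}
    (h : ∀ x₀ : M, ContDiffAt ℝ ∞ (pullEndo (chartAt (Euc m) x₀) φ) (chartAt (Euc m) x₀ x₀)) :
    SmoothEndo φ := by
  intro x₀
  rw [contMDiffAt_hom_bundle]
  refine ⟨contMDiffAt_id, contMDiffAt_of_eq_comp_chart (h x₀) fun w hw => ?_⟩
  have hx := (chartAt (Euc m) x₀).map_target hw
  have hb : (chartAt (Euc m) x₀).symm w ∈
      (trivializationAt (Euc m) (TangentSpace (𝓡 m)) x₀).baseSet := by
    rwa [TangentBundle.trivializationAt_baseSet]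
  ext1 x
  rw [pullEndo_apply, ← trivializationAt_symm_eq_dsymm hw, ← continuousLinearMapAt_eq_dchart hx,
    ← Bundle.Trivialization.symmL_apply (R := ℝ) _ hb]
  rfl

end SmoothTensors

/-! ### Splitting off the first coordinate, and flow boxes -/

section Tail

variable {m : ℕ}

/-- The projection forgetting the first coordinate. -/
def tailL (m : ℕ) : Euc (m + 1) →L[ℝ] Euc m :=
  ((EuclideanSpace.equiv (Fin m) ℝ).symm : (Fin m → ℝ) →L[ℝ] Euc m).comp
    (ContinuousLinearMap.pi fun i => EuclideanSpace.proj i.succ)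

/-- The inclusion of the hyperplane where the first coordinate vanishes. -/
def zeroCons (m : ℕ) : Euc m →L[ℝ] Euc (m + 1) :=
  ((EuclideanSpace.equiv (Fin (m + 1)) ℝ).symm : (Fin (m + 1) → ℝ) →L[ℝ] Euc (m + 1)).comp
    (ContinuousLinearMap.pi (Fin.cases 0 fun i => EuclideanSpace.proj i))

/-- The first vector of the standard basis. -/
def e₀ (m : ℕ) : Euc (m + 1) := EuclideanSpace.single 0 1

@[simp] theorem tailL_apply (v : Euc (m + 1)) (i : Fin m) : tailL m v i = v i.succ := rfl

@[simp] theorem zeroCons_zero (w : Euc m) : zeroCons m w 0 = 0 := rfl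

@[simp] theorem zeroCons_succ (w : Euc m) (i : Fin m) : zeroCons m w i.succ = w i := rfl

@[simp] theorem e₀_zero : e₀ m 0 = 1 := by simp [e₀]

@[simp] theorem e₀_succ (i : Fin m) : e₀ m i.succ = 0 := by simp [e₀]

@[simp] theorem tailL_zeroCons (w : Euc m) : tailL m (zeroCons m w) = w := by
  ext i; simp

@[simp] theorem tailL_e₀ : tailL m (e₀ m) = 0 := by
  ext i; simp

theorem zeroCons_tailL (v : Euc (m + 1)) : zeroCons m (tailL m v) = v - v 0 • e₀ m := by
  ext i
  refine Fin.cases ?_ (fun i => ?_) i <;> simp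

theorem zeroCons_tailL_add (v : Euc (m + 1)) : zeroCons m (tailL m v) + v 0 • e₀ m = v := by
  rw [zeroCons_tailL, sub_add_cancel]

theorem eq_add_smul_of_tailL_eq {v w : Euc (m + 1)} (h : tailL m v = tailL m w) :
    w = v + (w 0 - v 0) • e₀ m := by
  rw [← zeroCons_tailL_add v, ← zeroCons_tailL_add w, h]
  simp [sub_smul]

end Tail

/-- A regular coordinate neighbourhood of the vector field `ξ`. -/
structure FlowBox {m : ℕ} {M : Type*} [TopologicalSpace M]
    [ChartedSpace (Euc (m + 1)) M] (ξ : VField (m + 1) M) where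
  /-- The chart. -/
  e : OpenPartialHomeomorph M (Euc (m + 1))
  mem : e ∈ IsManifold.maximalAtlas (𝓡 (m + 1)) ∞ M
  /-- The size of the cube. -/
  a : ℝ
  a_pos : 0 < a
  target_eq : e.target = {v | ∀ i, |v i| < a}
  dchart_ξ : ∀ x ∈ e.source, dchart e x (ξ x) = e₀ m
  slice : ∀ x ∈ e.source, ∀ y ∈ e.source, SameOrbit ξ x y → tailL m (e x) = tailL m (e y)

theorem IsRegularField.exists_flowBox {m : ℕ} {M : Type*} [TopologicalSpace M]
    [ChartedSpace (Euc (m + 1)) M] {ξ : VField (m + 1) M} (h : IsRegularField ξ) (p : M) :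
    ∃ f : FlowBox ξ, p ∈ f.e.source ∧ f.e p = 0 := by
  obtain ⟨e, he, a, ha, hp, hp0, ht, hd, hs⟩ := h p
  refine ⟨⟨e, he, a, ha, ht, hd, fun x hx y hy hxy => ?_⟩, hp, hp0⟩
  ext i
  exact hs x hx y hy hxy i.succ (Fin.succ_ne_zero i)

namespace FlowBox

variable {m : ℕ} {M : Type*} [TopologicalSpace M] [ChartedSpace (Euc (m + 1)) M]
  {ξ : VField (m + 1) M} (f : FlowBox ξ)

theorem mem_target {v : Euc (m + 1)} : v ∈ f.e.target ↔ ∀ i, |v i| < f.a := by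
  rw [f.target_eq]; rfl

theorem zeroCons_mem {w : Euc m} (h : ∀ i, |w i| < f.a) : zeroCons m w ∈ f.e.target := by
  rw [f.mem_target]
  exact Fin.cases (by simpa using f.a_pos) (fun i => by simpa using h i)

theorem add_smul_mem {v : Euc (m + 1)} (h : v ∈ f.e.target) {t : ℝ} (ht : |v 0 + t| < f.a) :
    v + t • e₀ m ∈ f.e.target := by
  rw [f.mem_target] at h ⊢
  exact Fin.cases (by simpa using ht) (fun i => by simpa using h i.succ)

theorem abs_zero_lt {v : Euc (m + 1)} (h : v ∈ f.e.target) : |v 0| < f.a := f.mem_target.1 h 0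

theorem pullField_ξ {v : Euc (m + 1)} (hv : v ∈ f.e.target) : pullField f.e ξ v = e₀ m :=
  f.dchart_ξ _ (f.e.map_target hv)

theorem dsymm_e₀ {v : Euc (m + 1)} (hv : v ∈ f.e.target) :
    dsymm f.e v (e₀ m) = ξ (f.e.symm v) := by
  rw [← f.dchart_ξ _ (f.e.map_target hv), dsymm_dchart f.mem hv]

/-- A function on the cube with vanishing derivative in the first direction
does not depend on the first coordinate. -/
theorem eq_of_fderiv_e₀ {G : Type*} [NormedAddCommGroup G] [NormedSpace ℝ G]
    {F : Euc (m + 1) → G} (hF : ∀ v ∈ f.e.target, DifferentiableAt ℝ F v)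
    (h0 : ∀ v ∈ f.e.target, fderiv ℝ F v (e₀ m) = 0) {v : Euc (m + 1)} (hv : v ∈ f.e.target)
    {t : ℝ} (ht : |v 0 + t| < f.a) : F (v + t • e₀ m) = F v := by
  -- The cube is convex, so the segment between the two points stays inside.
  have key : ∀ s ∈ Icc (0 : ℝ) 1, v + (s * t) • e₀ m ∈ f.e.target := by
    intro s hs
    refine f.add_smul_mem hv ?_
    have h1 := abs_lt.1 (f.abs_zero_lt hv)
    have h2 := abs_lt.1 ht
    rw [abs_lt]
    rcases le_total 0 t with h | h <;> constructor <;> nlinarith [hs.1, hs.2]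
  have hd : ∀ s ∈ Icc (0 : ℝ) 1, HasDerivAt (fun s => F (v + (s * t) • e₀ m)) 0 s := by
    intro s hs
    have h1 : HasDerivAt (fun s : ℝ => v + (s * t) • e₀ m) ((1 * t) • e₀ m) s :=
      (((hasDerivAt_id s).mul_const t).smul_const (e₀ m)).const_add v
    have h2 := (hF _ (key s hs)).hasFDerivAt.comp_hasDerivAt s h1
    rwa [map_smul, h0 _ (key s hs), smul_zero] at h2
  have := constant_of_has_deriv_right_zero (a := 0) (b := 1)
    (fun s hs => (hd s hs).continuousAt.continuousWithinAt)
    (fun s hs => (hd s ⟨hs.1, hs.2.le⟩).hasDerivWithinAt) 1 (by simp)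
  simpa using this

end FlowBox

/-- A `2`-form which vanishes on `ξ`, is invariant along `ξ` and smooth in regular charts. -/
structure IsBasicForm {m : ℕ} {M : Type*} [TopologicalSpace M]
    [ChartedSpace (Euc (m + 1)) M] (ξ : VField (m + 1) M) (β : Form2 (m + 1) M) : Prop where
  left : ∀ x v, β x (ξ x) v = 0
  right : ∀ x v, β x v (ξ x) = 0
  contDiffAt : ∀ f : FlowBox ξ, ∀ v ∈ f.e.target, ContDiffAt ℝ ∞ (pullForm2 f.e β) v
  fderiv_e₀ : ∀ f : FlowBox ξ, ∀ v ∈ f.e.target, fderiv ℝ (pullForm2 f.e β) v (e₀ m) = 0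

/-- A field of endomorphisms which vanishes on `ξ`, is invariant along `ξ` and smooth in
regular charts. -/
structure IsBasicEndo {m : ℕ} {M : Type*} [TopologicalSpace M]
    [ChartedSpace (Euc (m + 1)) M] (ξ : VField (m + 1) M) (φ : EndoField (m + 1) M) : Prop where
  apply_ξ : ∀ x, φ x (ξ x) = 0
  contDiffAt : ∀ f : FlowBox ξ, ∀ v ∈ f.e.target, ContDiffAt ℝ ∞ (pullEndo f.e φ) v
  fderiv_e₀ : ∀ f : FlowBox ξ, ∀ v ∈ f.e.target, fderiv ℝ (pullEndo f.e φ) v (e₀ m) = 0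

/-! ### Differential identities on a vector space -/

section FlatAlgebra

variable {m : ℕ}

theorem fderiv_apply_const {D E G : Type*} [NormedAddCommGroup D] [NormedSpace ℝ D]
    [NormedAddCommGroup E] [NormedSpace ℝ E] [NormedAddCommGroup G] [NormedSpace ℝ G]
    {F : D → E →L[ℝ] G} {v : D} (hF : DifferentiableAt ℝ F v) (x : D) (y : E) :
    fderiv ℝ (fun w => F w y) v x = fderiv ℝ F v x y := by
  rw [fderiv_clm_apply hF (differentiableAt_const y)]
  simp

theorem fderiv_apply_eq_zero {G : Type*} [NormedAddCommGroup G] [NormedSpace ℝ G]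
    {F : Euc m → Euc m →L[ℝ] G} {v : Euc m} (hF : DifferentiableAt ℝ F v) {x y : Euc m} {c : G}
    (h : ∀ᶠ w in 𝓝 v, F w y = c) : fderiv ℝ F v x y = 0 := by
  rw [← fderiv_apply_const hF]
  have : (fun w => F w y) =ᶠ[𝓝 v] fun _ => c := h
  rw [this.fderiv_eq]
  simp

/-- This is `d² = 0`, from the symmetry of the second derivative. -/
theorem flatD2_flatD1 {η : Euc m → Euc m →L[ℝ] ℝ} {v : Euc m} (hη : ContDiffAt ℝ ∞ η v)
    {dη : Euc m → Euc m →L[ℝ] Euc m →L[ℝ] ℝ} (hd : DifferentiableAt ℝ dη v)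
    (h : ∀ᶠ w in 𝓝 v, ∀ x y, dη w x y = flatD1 η w x y) (x y z : Euc m) :
    flatD2 dη v x y z = 0 := by
  have h2 : DifferentiableAt ℝ (fderiv ℝ η) v :=
    (hη.fderiv_right (m := 1) (by
      simpa [one_add_one_eq_two, minSmoothness_of_isRCLikeNormedField] using
        minSmoothness_two_le)).differentiableAt (by simp)
  have hsymm : ∀ a b, fderiv ℝ (fderiv ℝ η) v a b = fderiv ℝ (fderiv ℝ η) v b a := by
    intro a b
    have := (hη.of_le (m := 2) (by
      simpa [minSmoothness_of_isRCLikeNormedField] using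
        minSmoothness_two_le)).isSymmSndFDerivAt (by simp)
    exact this a b
  have key : ∀ a b c, fderiv ℝ dη v a b c =
      fderiv ℝ (fderiv ℝ η) v a b c - fderiv ℝ (fderiv ℝ η) v a c b := by
    intro a b c
    have e1 : fderiv ℝ dη v a b c = fderiv ℝ (fun w => dη w b c) v a := by
      rw [fderiv_apply_const (hd.clm_apply (differentiableAt_const b)), fderiv_apply_const hd]
    have e2 : (fun w => dη w b c) =ᶠ[𝓝 v] fun w => fderiv ℝ η w b c - fderiv ℝ η w c b := by
      filter_upwards [h] with w hw using hw b c
    have d1 : ∀ b c : Euc m, DifferentiableAt ℝ (fun w => fderiv ℝ η w b c) v := fun b c =>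
      (h2.clm_apply (differentiableAt_const b)).clm_apply (differentiableAt_const c)
    rw [e1, e2.fderiv_eq, fderiv_fun_sub (d1 b c) (d1 c b)]
    have e3 : ∀ b c : Euc m, fderiv ℝ (fun w => fderiv ℝ η w b c) v a =
        fderiv ℝ (fderiv ℝ η) v a b c := by
      intro b c
      rw [fderiv_apply_const (h2.clm_apply (differentiableAt_const b)), fderiv_apply_const h2]
    simp [e3]
  rw [flatD2, key, key, key, hsymm x y, hsymm y z, hsymm z x]
  ring

/-- If the torsion of `φ` is `dη ⊗ ξ` for a constant field `ξ` with `φ ξ = 0` and `η(ξ) = 1`, then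
`η` and `φ` are invariant along `ξ`, and `dη` is `φ`-anti-invariant. -/
theorem flat_antiNormal {φ : Euc m → Euc m →L[ℝ] Euc m} {η : Euc m → Euc m →L[ℝ] ℝ}
    {v ξ : Euc m} (hφ : DifferentiableAt ℝ φ v) (hη : DifferentiableAt ℝ η v)
    (h1 : ∀ᶠ w in 𝓝 v, η w ξ = 1) (h2 : ∀ᶠ w in 𝓝 v, φ w ξ = 0)
    (h3 : ∀ᶠ w in 𝓝 v, ∀ x, η w (φ w x) = 0) (h4 : ∀ x, φ v (φ v x) = -x + η v x • ξ)
    (hN : ∀ x y, flatNij φ v x y = flatD1 η v x y • ξ) :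
    fderiv ℝ η v ξ = 0 ∧ fderiv ℝ φ v ξ = 0 ∧
      ∀ x y, flatD1 η v (φ v x) (φ v y) = - flatD1 η v x y := by
  have a1 : ∀ x, fderiv ℝ η v x ξ = 0 := fun x => fderiv_apply_eq_zero hη h1
  have a2 : ∀ x, fderiv ℝ φ v x ξ = 0 := fun x => fderiv_apply_eq_zero hφ h2
  have a3 : ∀ x y, fderiv ℝ η v x (φ v y) + η v (fderiv ℝ φ v x y) = 0 := by
    intro x y
    have e1 : (fun w => η w (φ w y)) =ᶠ[𝓝 v] fun _ => 0 := by
      filter_upwards [h3] with w hw using hw y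
    have e2 := congrArg (fun L : Euc m →L[ℝ] ℝ => L x) e1.fderiv_eq
    rw [fderiv_clm_apply hη (hφ.clm_apply (differentiableAt_const y))] at e2
    simp [fderiv_apply_const hφ] at e2
    linarith
  have b1 := h1.self_of_nhds
  have b2 := h2.self_of_nhds
  have b3 := h3.self_of_nhds
  -- The torsion identity on `(x, ξ)`: since `φ ξ = 0` and `η(ξ) = 1` near `v`, only the derivatives
  -- along `ξ` survive.
  have c1 : ∀ x, φ v (fderiv ℝ φ v ξ x) = -(fderiv ℝ η v ξ x) • ξ := by
    intro x
    have := hN x ξ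
    simpa [flatNij, flatD1, a1, a2, b2] using this
  have c2 : ∀ x, fderiv ℝ η v ξ x = 0 := by
    intro x
    have := congrArg (η v) (c1 x)
    rw [b3, map_smul, b1] at this
    simpa using this
  refine ⟨ContinuousLinearMap.ext c2, ContinuousLinearMap.ext fun x => ?_, fun x y => ?_⟩
  -- Let `u` be the derivative of `φ` along `ξ` applied to `x`. Then `φ u = 0` by `c1` and `c2`, and
  -- `η(u) = 0` by differentiating `η ∘ φ = 0`. Hence `φ² u = -u + η(u) ξ` forces `u = 0`.
  · have h5 := h4 (fderiv ℝ φ v ξ x)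
    have h6 := a3 ξ x
    rw [c2, zero_add] at h6
    rw [c1, c2, h6] at h5
    simpa using h5
  -- The `η`-component of the torsion identity; `a3` turns `η` of a derivative of `φ` into a
  -- derivative of `η`.
  · have := congrArg (η v) (hN x y)
    simp only [flatNij, map_add, map_sub, b3, map_smul, b1, smul_eq_mul, mul_one] at this
    have h5 := a3 (φ v x) y
    have h6 := a3 (φ v y) x
    simp only [flatD1] at this ⊢
    linarith

end FlatAlgebra

/-! ### Algebra of almost contact metric structures -/

namespace AlmostContactMetric

variable {m : ℕ} {M : Type*} [TopologicalSpace M] [ChartedSpace (EuclideanSpace ℝ (Fin m)) M]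
  [IsManifold (𝓡 m) ∞ M] (S : AlmostContactMetric m M)

/-- Since `φ² ξ = 0`, applying `φ²` to `φ ξ` shows `φ ξ = λ ξ` with `λ = η(φ ξ)`; applying `φ` once
more gives `λ² = 0`. -/
theorem φ_ξ (x : M) : S.φ x (S.ξ x) = 0 := by
  have h1 : S.φ x (S.φ x (S.ξ x)) = 0 := by rw [S.φ_sq, S.η_ξ]; simp
  have h2 := S.φ_sq x (S.φ x (S.ξ x))
  rw [h1, map_zero] at h2
  have h3 : S.φ x (S.ξ x) = S.η x (S.φ x (S.ξ x)) • S.ξ x :=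
    neg_add_eq_zero.1 h2.symm
  have h4 := congrArg (S.φ x) h3
  rw [h1, map_smul, h3, smul_smul] at h4
  have h5 := congrArg (S.η x) h4
  rw [map_zero, map_smul, map_smul, S.η_ξ] at h5
  have h6 : S.η x (S.φ x (S.ξ x)) = 0 := by simpa using h5.symm
  rw [h3, h6, zero_smul]

/-- Compute `φ³ v` both as `φ²(φ v)` and as `φ(φ² v)`. -/
theorem η_φ (x : M) (v : TangentSpace (𝓡 m) x) : S.η x (S.φ x v) = 0 := by
  have h1 := S.φ_sq x (S.φ x v)
  rw [S.φ_sq x v, map_add, map_neg, map_smul, S.φ_ξ, smul_zero, add_zero] at h1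
  have h2 := congrArg (S.η x) h1
  simp only [map_add, map_neg, map_smul, S.η_ξ, smul_eq_mul, mul_one] at h2
  linarith

theorem g_ξ (x : M) (v : TangentSpace (𝓡 m) x) : S.g.inner x v (S.ξ x) = S.η x v := by
  have h := S.compatible x v (S.ξ x)
  rw [S.φ_ξ, map_zero, S.η_ξ] at h
  linarith

theorem g_φ_skew (x : M) (v w : TangentSpace (𝓡 m) x) :
    S.g.inner x v (S.φ x w) = - S.g.inner x w (S.φ x v) := by
  have h := S.compatible x v (S.φ x w)
  rw [S.η_φ, S.φ_sq, map_add, map_neg, map_smul, S.g_ξ, S.η_φ, S.g.symm x (S.φ x v)] at h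
  simp at h
  linarith

end AlmostContactMetric

/-! ### The exterior derivative as a tensor -/

section ExteriorDerivative

variable {m : ℕ} {M : Type*} [TopologicalSpace M] [ChartedSpace (Euc m) M]

/-- The exterior derivative of a `1`-form on a vector space, as a field of bilinear forms. -/
def flatD1L (η : Euc m → Euc m →L[ℝ] ℝ) (v : Euc m) : Euc m →L[ℝ] Euc m →L[ℝ] ℝ :=
  fderiv ℝ η v - (fderiv ℝ η v).flip

theorem flatD1L_apply (η : Euc m → Euc m →L[ℝ] ℝ) (v x y : Euc m) :
    flatD1L η v x y = flatD1 η v x y := rfl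

/-- The exterior derivative of a `1`-form as a field of bilinear forms. -/
def dForm (η : Form1 m M) : Form2 m M := fun x =>
  ((ContinuousLinearMap.precomp ℝ (dchart (chartAt (Euc m) x) x)).comp
    (flatD1L (pullForm1 (chartAt (Euc m) x) η) (chartAt (Euc m) x x))).comp
      (dchart (chartAt (Euc m) x) x)

theorem dForm_apply (η : Form1 m M) (x : M) (v w : TangentSpace (𝓡 m) x) :
    dForm η x v w = flatD1 (pullForm1 (chartAt (Euc m) x) η) (chartAt (Euc m) x x)
      (dchart (chartAt (Euc m) x) x v) (dchart (chartAt (Euc m) x) x w) := rfl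

theorem dForm_skew (η : Form1 m M) (x : M) (v w : TangentSpace (𝓡 m) x) :
    dForm η x v w = - dForm η x w v := by
  simp [dForm_apply, flatD1]

variable [IsManifold (𝓡 m) ∞ M]

theorem chartAt_mem_maximalAtlas (x : M) :
    chartAt (Euc m) x ∈ IsManifold.maximalAtlas (𝓡 m) ∞ M :=
  IsManifold.subset_maximalAtlas (chart_mem_atlas (Euc m) x)

variable [T2Space M]

theorem SmoothForm1.d1_eq_dForm {η : Form1 m M} (hη : SmoothForm1 η) {X Y : VField m M}
    (hX : SmoothVField X) (hY : SmoothVField Y) (x : M) :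
    d1 η X Y x = dForm η x (X x) (Y x) := by
  have hv := mem_chart_target (Euc m) x
  have h := d1_eq (chartAt_mem_maximalAtlas x) hv
    ((hη.contDiffAt_pullForm1 (chartAt_mem_maximalAtlas x) hv).differentiableAt (by simp)) hX hY
  rw [pullField, pullField, (chartAt (Euc m) x).left_inv (mem_chart_source _ x)] at h
  rw [h, dForm_apply]

/-- `dForm` is defined with the preferred chart at each point. Both it and the expression in an
arbitrary chart compute the intrinsic `d1` on fields extending the given vectors, so the choice is
immaterial. -/
theorem SmoothForm1.pullForm2_dForm {η : Form1 m M} (hη : SmoothForm1 η)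
    {e : OpenPartialHomeomorph M (Euc m)}
    (he : e ∈ IsManifold.maximalAtlas (𝓡 m) ∞ M) {v : Euc m} (hv : v ∈ e.target) :
    pullForm2 e (dForm η) v = flatD1L (pullForm1 e η) v := by
  ext x y
  obtain ⟨X, hX, hXx⟩ := exists_smoothVField he hv x
  obtain ⟨Y, hY, hYy⟩ := exists_smoothVField he hv y
  have h := d1_eq he hv ((hη.contDiffAt_pullForm1 he hv).differentiableAt (by simp)) hX hY
  rw [hη.d1_eq_dForm hX hY, ← pullForm2_pullField he hv, hXx.self_of_nhds, hYy.self_of_nhds] at h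
  exact h

end ExteriorDerivative

theorem contDiffAt_fderiv {m : ℕ} {G : Type*} [NormedAddCommGroup G] [NormedSpace ℝ G]
    {η : Euc m → G} {v : Euc m} (hη : ContDiffAt ℝ ∞ η v) : ContDiffAt ℝ ∞ (fderiv ℝ η) v :=
  hη.fderiv_right (m := ∞) (by simp)

/-! ### The basic tensors of an anti-quasi-Sasakian structure -/

namespace AlmostContactMetric

section Forms

variable {m : ℕ} {M : Type*} [TopologicalSpace M] [ChartedSpace (EuclideanSpace ℝ (Fin m)) M]
  [IsManifold (𝓡 m) ∞ M] (S : AlmostContactMetric m M)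

/-- The fundamental form as a field of continuous bilinear forms. -/
def fund : Form2 m M := fun x => (ContinuousLinearMap.precomp ℝ (S.φ x)).comp (S.g.inner x)

/-- The transverse metric `g - η ⊗ η`. -/
def transverse : Form2 m M := fun x => S.g.inner x - (S.η x).smulRight (S.η x)

theorem fund_apply (x : M) (v w : TangentSpace (𝓡 m) x) :
    S.fund x v w = S.g.inner x v (S.φ x w) := rfl

theorem transverse_apply (x : M) (v w : TangentSpace (𝓡 m) x) :
    S.transverse x v w = S.g.inner x v w - S.η x v * S.η x w := rfl

/-- Invariance of the transverse metric thus follows from that of `Φ` and `φ`, without a separate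
argument that the flow is isometric. -/
theorem transverse_eq_fund (x : M) (v w : TangentSpace (𝓡 m) x) :
    S.transverse x v w = S.fund x (S.φ x v) w := by
  rw [transverse_apply, fund_apply, S.compatible]

theorem smooth_g : SmoothForm2 S.g.inner := S.g.contMDiff

end Forms

section FlowBoxes

variable {m : ℕ} {M : Type*} [TopologicalSpace M] [T2Space M]
  [ChartedSpace (EuclideanSpace ℝ (Fin (m + 1))) M]
  [IsManifold (𝓡 (m + 1)) ∞ M] {S : AlmostContactMetric (m + 1) M}

theorem contDiffAt_η (f : FlowBox S.ξ) {v : Euc (m + 1)} (hv : v ∈ f.e.target) :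
    ContDiffAt ℝ ∞ (pullForm1 f.e S.η) v :=
  S.smooth_η.contDiffAt_pullForm1 f.mem hv

theorem contDiffAt_φ (f : FlowBox S.ξ) {v : Euc (m + 1)} (hv : v ∈ f.e.target) :
    ContDiffAt ℝ ∞ (pullEndo f.e S.φ) v :=
  S.smooth_φ.contDiffAt_pullEndo f.mem hv

omit [T2Space M] in
theorem pullForm1_e₀ (f : FlowBox S.ξ) {v : Euc (m + 1)} (hv : v ∈ f.e.target) :
    pullForm1 f.e S.η v (e₀ m) = 1 := by
  rw [pullForm1_apply, f.dsymm_e₀ hv, S.η_ξ]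

omit [T2Space M] in
theorem pullEndo_e₀ (f : FlowBox S.ξ) {v : Euc (m + 1)} (hv : v ∈ f.e.target) :
    pullEndo f.e S.φ v (e₀ m) = 0 := by
  rw [pullEndo_apply, f.dsymm_e₀ hv, S.φ_ξ, map_zero]

omit [T2Space M] in
theorem dsymm_pullEndo (f : FlowBox S.ξ) {v : Euc (m + 1)} (hv : v ∈ f.e.target)
    (x : Euc (m + 1)) :
    dsymm f.e v (pullEndo f.e S.φ v x) = S.φ (f.e.symm v) (dsymm f.e v x) := by
  rw [pullEndo_apply, dsymm_dchart f.mem hv]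

omit [T2Space M] in
theorem pullForm1_pullEndo (f : FlowBox S.ξ) {v : Euc (m + 1)} (hv : v ∈ f.e.target)
    (x : Euc (m + 1)) : pullForm1 f.e S.η v (pullEndo f.e S.φ v x) = 0 := by
  rw [pullForm1_apply, dsymm_pullEndo f hv, S.η_φ]

omit [T2Space M] in
theorem pullEndo_sq (f : FlowBox S.ξ) {v : Euc (m + 1)} (hv : v ∈ f.e.target)
    (x : Euc (m + 1)) :
    pullEndo f.e S.φ v (pullEndo f.e S.φ v x) = -x + pullForm1 f.e S.η v x • e₀ m := by
  rw [pullEndo_apply, dsymm_pullEndo f hv, S.φ_sq, map_add, map_neg, map_smul,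
    dchart_dsymm f.mem hv, pullForm1_apply, ← f.pullField_ξ hv]
  rfl

variable (hS : S.IsAntiQuasiSasakian)

include hS

theorem IsAntiQuasiSasakian.flatNij_eq (f : FlowBox S.ξ) {v : Euc (m + 1)} (hv : v ∈ f.e.target)
    (x y : Euc (m + 1)) :
    flatNij (pullEndo f.e S.φ) v x y = flatD1 (pullForm1 f.e S.η) v x y • e₀ m := by
  obtain ⟨X, hX, hXx⟩ := exists_smoothVField f.mem hv x
  obtain ⟨Y, hY, hYy⟩ := exists_smoothVField f.mem hv y
  have h := hS.antiNormal X Y hX hY (f.e.symm v)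
  -- One of the two copies of `dη ⊗ ξ` is already part of `N_φ`, so the torsion itself is a single
  -- copy.
  have h' : nijenhuis S.φ X Y (f.e.symm v) = d1 S.η X Y (f.e.symm v) • S.ξ (f.e.symm v) := by
    rw [two_mul, add_smul] at h
    exact add_right_cancel h
  have h2 := congrArg (dchart f.e (f.e.symm v)) h'
  rw [map_smul, d1_eq f.mem hv ((contDiffAt_η f hv).differentiableAt (by simp)) hX hY] at h2
  have h3 := pullField_nijenhuis f.mem hv ((contDiffAt_φ f hv).differentiableAt (by simp)) hX hY
    (S.smooth_φ.app hX) (S.smooth_φ.app hY)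
  rw [hXx.self_of_nhds, hYy.self_of_nhds] at h3 h2
  rw [← h3, ← f.pullField_ξ hv]
  exact h2

theorem IsAntiQuasiSasakian.flat (f : FlowBox S.ξ) {v : Euc (m + 1)} (hv : v ∈ f.e.target) :
    fderiv ℝ (pullForm1 f.e S.η) v (e₀ m) = 0 ∧ fderiv ℝ (pullEndo f.e S.φ) v (e₀ m) = 0 ∧
      ∀ x y, flatD1 (pullForm1 f.e S.η) v (pullEndo f.e S.φ v x) (pullEndo f.e S.φ v y) =
        - flatD1 (pullForm1 f.e S.η) v x y := by
  have ht := f.e.open_target.mem_nhds hv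
  refine flat_antiNormal ((contDiffAt_φ f hv).differentiableAt (by simp))
    ((contDiffAt_η f hv).differentiableAt (by simp)) ?_ ?_ ?_ (pullEndo_sq f hv)
    (hS.flatNij_eq f hv)
  · filter_upwards [ht] with w hw using pullForm1_e₀ f hw
  · filter_upwards [ht] with w hw using pullEndo_e₀ f hw
  · filter_upwards [ht] with w hw using pullForm1_pullEndo f hw

theorem IsAntiQuasiSasakian.isBasicEndo_φ : IsBasicEndo S.ξ S.φ :=
  ⟨S.φ_ξ, fun f _ hv => contDiffAt_φ f hv, fun f _ hv => (hS.flat f hv).2.1⟩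

omit hS [T2Space M] in
theorem pullForm2_fund (f : FlowBox S.ξ) {v : Euc (m + 1)} (hv : v ∈ f.e.target)
    (x y : Euc (m + 1)) :
    pullForm2 f.e S.fund v x y = pullForm2 f.e S.g.inner v x (pullEndo f.e S.φ v y) := by
  rw [pullForm2_apply, pullForm2_apply, dsymm_pullEndo f hv, fund_apply]

omit hS in
theorem contDiffAt_fund (f : FlowBox S.ξ) {v : Euc (m + 1)} (hv : v ∈ f.e.target) :
    ContDiffAt ℝ ∞ (pullForm2 f.e S.fund) v := by
  refine contDiffAt_of_forall_apply fun x => contDiffAt_of_forall_apply fun y => ?_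
  have h1 := S.smooth_g.contDiffAt_pullForm2 f.mem hv
  refine ((h1.clm_apply contDiffAt_const).clm_apply
    ((contDiffAt_φ f hv).clm_apply contDiffAt_const)).congr_of_eventuallyEq (f := fun w =>
      pullForm2 f.e S.g.inner w x (pullEndo f.e S.φ w y)) ?_
  filter_upwards [f.e.open_target.mem_nhds hv] with w hw using pullForm2_fund f hw x y

omit hS [T2Space M] in
theorem fund_skew (x : M) (v w : TangentSpace (𝓡 (m + 1)) x) :
    S.fund x v w = - S.fund x w v := S.g_φ_skew x v w

theorem IsAntiQuasiSasakian.flatD2_fund (f : FlowBox S.ξ) {v : Euc (m + 1)}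
    (hv : v ∈ f.e.target) (x y z : Euc (m + 1)) : flatD2 (pullForm2 f.e S.fund) v x y z = 0 := by
  obtain ⟨X, hX, hXx⟩ := exists_smoothVField f.mem hv x
  obtain ⟨Y, hY, hYy⟩ := exists_smoothVField f.mem hv y
  obtain ⟨Z, hZ, hZz⟩ := exists_smoothVField f.mem hv z
  have h := hS.closed X Y Z hX hY hZ (f.e.symm v)
  have h2 := d2_eq f.mem hv ((contDiffAt_fund f hv).differentiableAt (by simp)) fund_skew hX hY hZ
  rw [hXx.self_of_nhds, hYy.self_of_nhds, hZz.self_of_nhds] at h2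
  rw [← h2]
  exact h

/-- Cartan's formula: `Φ` is closed and `ξ` annihilates it. In a box the other two terms of `dΦ(ξ,
x, y)` are derivatives of coefficients that vanish identically. -/
theorem IsAntiQuasiSasakian.isBasicForm_fund : IsBasicForm S.ξ S.fund := by
  have hr : ∀ x v, S.fund x v (S.ξ x) = 0 := fun x v => by rw [fund_apply, S.φ_ξ, map_zero]
  have hl : ∀ x v, S.fund x (S.ξ x) v = 0 := fun x v => by rw [fund_skew, hr, neg_zero]
  refine ⟨hl, hr, fun f v hv => contDiffAt_fund f hv, fun f v hv => ?_⟩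
  have hd := (contDiffAt_fund f hv).differentiableAt (by simp)
  ext x y
  have h := hS.flatD2_fund f hv (e₀ m) x y
  have ht := f.e.open_target.mem_nhds hv
  have h1 : fderiv ℝ (pullForm2 f.e S.fund) v y (e₀ m) = 0 := by
    refine fderiv_apply_eq_zero (c := 0) hd ?_
    filter_upwards [ht] with w hw
    ext x
    rw [pullForm2_apply, f.dsymm_e₀ hw, hl]
    rfl
  have h2 : fderiv ℝ (pullForm2 f.e S.fund) v x y (e₀ m) = 0 := by
    rw [← fderiv_apply_const hd]
    refine fderiv_apply_eq_zero (c := 0) (hd.clm_apply (differentiableAt_const y)) ?_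
    filter_upwards [ht] with w hw
    rw [pullForm2_apply, f.dsymm_e₀ hw, hr]
  rw [flatD2, h1, h2] at h
  simpa using h

/-- It is a composite of the invariant tensors `Φ` and `φ`, so the product rule applies. -/
theorem IsAntiQuasiSasakian.isBasicForm_transverse : IsBasicForm S.ξ S.transverse := by
  have hb := hS.isBasicForm_fund
  have key : ∀ f : FlowBox S.ξ, ∀ w ∈ f.e.target, pullForm2 f.e S.transverse w =
      (pullForm2 f.e S.fund w).comp (pullEndo f.e S.φ w) := by
    intro f w hw
    ext x y
    rw [ContinuousLinearMap.comp_apply, pullForm2_apply, pullForm2_apply, dsymm_pullEndo f hw,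
      transverse_eq_fund]
  have ev : ∀ f : FlowBox S.ξ, ∀ v ∈ f.e.target, pullForm2 f.e S.transverse =ᶠ[𝓝 v] fun w =>
      (pullForm2 f.e S.fund w).comp (pullEndo f.e S.φ w) := by
    intro f v hv
    filter_upwards [f.e.open_target.mem_nhds hv] with w hw using key f w hw
  have hc : ∀ f : FlowBox S.ξ, ∀ v ∈ f.e.target,
      ContDiffAt ℝ ∞ (pullForm2 f.e S.transverse) v := fun f v hv =>
    ((contDiffAt_fund f hv).clm_comp (contDiffAt_φ f hv)).congr_of_eventuallyEq (ev f v hv)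
  refine ⟨fun x v => ?_, fun x v => ?_, hc, fun f v hv => ?_⟩
  · rw [transverse_eq_fund, S.φ_ξ, map_zero]
    rfl
  · rw [transverse_eq_fund, hb.right]
  · have d1 := (contDiffAt_fund f hv).differentiableAt (by simp)
    have d2 := (contDiffAt_φ f hv).differentiableAt (by simp)
    have ev' : ∀ x, (fun w => pullForm2 f.e S.transverse w x) =ᶠ[𝓝 v] fun w =>
        pullForm2 f.e S.fund w (pullEndo f.e S.φ w x) := by
      intro x
      filter_upwards [ev f v hv] with w hw
      rw [hw]
      rfl
    ext1 x
    rw [← fderiv_apply_const ((hc f v hv).differentiableAt (by simp)), (ev' x).fderiv_eq,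
      fderiv_clm_apply d1 (d2.clm_apply (differentiableAt_const x)), add_apply,
      ContinuousLinearMap.comp_apply, fderiv_apply_const d2, (hS.flat f hv).2.1,
      ContinuousLinearMap.flip_apply, hb.fderiv_e₀ f v hv]
    simp

/-- The contraction of `dη` with `ξ` vanishes because `η` is invariant and `η(ξ)` is constant.
Invariance of `dη` follows by commuting the derivative along `ξ` with the other derivatives of `η`.
-/
theorem IsAntiQuasiSasakian.isBasicForm_dForm (hreg : IsRegularField S.ξ) :
    IsBasicForm S.ξ (dForm S.η) := by
  have h1 : ∀ f : FlowBox S.ξ, ∀ w ∈ f.e.target, fderiv ℝ (pullForm1 f.e S.η) w (e₀ m) = 0 :=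
    fun f w hw => (hS.flat f hw).1
  have h2 : ∀ f : FlowBox S.ξ, ∀ w ∈ f.e.target, ∀ x,
      fderiv ℝ (pullForm1 f.e S.η) w x (e₀ m) = 0 := by
    intro f w hw x
    refine fderiv_apply_eq_zero (c := 1) ((contDiffAt_η f hw).differentiableAt (by simp)) ?_
    filter_upwards [f.e.open_target.mem_nhds hw] with u hu using pullForm1_e₀ f hu
  have hl : ∀ x v, dForm S.η x (S.ξ x) v = 0 := by
    intro x w
    obtain ⟨f, hx, -⟩ := hreg.exists_flowBox x
    obtain ⟨v, hv, rfl⟩ : ∃ u ∈ f.e.target, f.e.symm u = x :=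
      ⟨_, f.e.map_source hx, f.e.left_inv hx⟩
    rw [← f.dsymm_e₀ hv, ← dsymm_dchart f.mem hv w, ← pullForm2_apply,
      S.smooth_η.pullForm2_dForm f.mem hv, flatD1L_apply, flatD1, h1 f v hv, h2 f v hv]
    simp
  have ev : ∀ f : FlowBox S.ξ, ∀ v ∈ f.e.target,
      pullForm2 f.e (dForm S.η) =ᶠ[𝓝 v] flatD1L (pullForm1 f.e S.η) := by
    intro f v hv
    filter_upwards [f.e.open_target.mem_nhds hv] with w hw
      using S.smooth_η.pullForm2_dForm f.mem hw
  have hc : ∀ f : FlowBox S.ξ, ∀ v ∈ f.e.target,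
      ContDiffAt ℝ ∞ (fderiv ℝ (pullForm1 f.e S.η)) v :=
    fun f v hv => contDiffAt_fderiv (contDiffAt_η f hv)
  have hc' : ∀ f : FlowBox S.ξ, ∀ v ∈ f.e.target,
      ContDiffAt ℝ ∞ (pullForm2 f.e (dForm S.η)) v := by
    intro f v hv
    refine ContDiffAt.congr_of_eventuallyEq ?_ (ev f v hv)
    refine contDiffAt_of_forall_apply fun x => contDiffAt_of_forall_apply fun y => ?_
    exact (((hc f v hv).clm_apply contDiffAt_const).clm_apply contDiffAt_const).sub
      (((hc f v hv).clm_apply contDiffAt_const).clm_apply contDiffAt_const)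
  refine ⟨hl, fun x v => by rw [dForm_skew, hl, neg_zero], hc', fun f v hv => ?_⟩
  have hd := (hc f v hv).differentiableAt (by simp)
  have hd' := (hc' f v hv).differentiableAt (by simp)
  have hz : fderiv ℝ (fderiv ℝ (pullForm1 f.e S.η)) v (e₀ m) = 0 := by
    ext1 x
    have := ((contDiffAt_η f hv).of_le (m := 2) (by
      simpa [minSmoothness_of_isRCLikeNormedField] using
        minSmoothness_two_le)).isSymmSndFDerivAt (by simp)
    rw [this (e₀ m) x]
    refine fderiv_apply_eq_zero (c := 0) hd ?_
    filter_upwards [f.e.open_target.mem_nhds hv] with w hw using h1 f w hw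
  ext x y
  rw [← fderiv_apply_const hd', ← fderiv_apply_const (hd'.clm_apply (differentiableAt_const x))]
  have e1 : (fun w => pullForm2 f.e (dForm S.η) w x y) =ᶠ[𝓝 v] fun w =>
      fderiv ℝ (pullForm1 f.e S.η) w x y - fderiv ℝ (pullForm1 f.e S.η) w y x := by
    filter_upwards [ev f v hv] with w hw
    rw [hw]
    rfl
  have d1 : ∀ b c : Euc (m + 1),
      DifferentiableAt ℝ (fun w => fderiv ℝ (pullForm1 f.e S.η) w b c) v := fun b c =>
    (hd.clm_apply (differentiableAt_const b)).clm_apply (differentiableAt_const c)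
  have e3 : ∀ b c : Euc (m + 1),
      fderiv ℝ (fun w => fderiv ℝ (pullForm1 f.e S.η) w b c) v (e₀ m) = 0 := by
    intro b c
    rw [fderiv_apply_const (hd.clm_apply (differentiableAt_const b)), fderiv_apply_const hd, hz]
    rfl
  rw [e1.fderiv_eq, fderiv_fun_sub (d1 x y) (d1 y x), sub_apply, e3, e3]
  simp

/-- The exterior derivative of the contact form is anti-invariant. -/
theorem IsAntiQuasiSasakian.dForm_φ (hreg : IsRegularField S.ξ) (x : M)
    (v w : TangentSpace (𝓡 (m + 1)) x) :
    dForm S.η x (S.φ x v) (S.φ x w) = - dForm S.η x v w := by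
  obtain ⟨f, hx, -⟩ := hreg.exists_flowBox x
  obtain ⟨u, hu, rfl⟩ : ∃ u ∈ f.e.target, f.e.symm u = x :=
    ⟨_, f.e.map_source hx, f.e.left_inv hx⟩
  rw [← dsymm_dchart f.mem hu v, ← dsymm_dchart f.mem hu w, ← dsymm_pullEndo f hu,
    ← dsymm_pullEndo f hu, ← pullForm2_apply, ← pullForm2_apply,
    S.smooth_η.pullForm2_dForm f.mem hu]
  exact (hS.flat f hu).2.2 _ _

end FlowBoxes

end AlmostContactMetric

/-! ### Completeness, and the flow of the field -/

section Lines

variable {m : ℕ} {M : Type*} [TopologicalSpace M] [ChartedSpace (Euc (m + 1)) M]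
  {ξ : VField (m + 1) M}

theorem FlowBox.hasMFDerivAt_line (f : FlowBox ξ) {v : Euc (m + 1)} {t : ℝ}
    (ht : v + t • e₀ m ∈ f.e.target) :
    HasMFDerivAt 𝓘(ℝ, ℝ) (𝓡 (m + 1)) (fun t : ℝ => f.e.symm (v + t • e₀ m)) t
      ((1 : ℝ →L[ℝ] ℝ).smulRight (ξ (f.e.symm (v + t • e₀ m)))) := by
  have h1 : HasMFDerivAt 𝓘(ℝ, ℝ) (𝓡 (m + 1)) (fun t : ℝ => v + t • e₀ m) t
      ((1 : ℝ →L[ℝ] ℝ).smulRight (e₀ m)) :=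
    (((hasFDerivAt_id t).smul_const (e₀ m)).const_add v).hasMFDerivAt
  have h2 := ((mdifferentiable_of_mem_maximalAtlas f.mem).mdifferentiableAt_symm ht).hasMFDerivAt
  have h3 := h2.comp t h1
  refine HasMFDerivAt.congr_mfderiv h3 ?_
  rw [← f.dsymm_e₀ ht]
  refine ContinuousLinearMap.ext fun s => ?_
  exact (dsymm f.e (v + t • e₀ m)).map_smul s (e₀ m)

theorem FlowBox.isMIntegralCurveOn_line (f : FlowBox ξ) {v : Euc (m + 1)} {s : Set ℝ}
    (hs : ∀ t ∈ s, v + t • e₀ m ∈ f.e.target) :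
    IsMIntegralCurveOn (fun t : ℝ => f.e.symm (v + t • e₀ m)) ξ s :=
  fun t ht => (f.hasMFDerivAt_line (hs t ht)).hasMFDerivWithinAt

end Lines

/-- Both orders of the two nearby times are covered by the hypothesis, so the set of times is open
and closed, and the line is connected. -/
theorem forall_of_eventually_imp {A : ℝ → Prop} (h0 : A 0)
    (h : ∀ t₀, ∀ᶠ p : ℝ × ℝ in 𝓝 (t₀, t₀), A p.1 → A p.2) (t : ℝ) : A t := by
  have hclopen : IsClopen {t | A t} := by
    constructor
    · rw [← isOpen_compl_iff, isOpen_iff_mem_nhds]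
      intro t₀ ht₀
      have := (h t₀)
      rw [nhds_prod_eq] at this
      filter_upwards [this.curry] with t ht hA
      exact ht₀ (ht.self_of_nhds hA)
    · rw [isOpen_iff_mem_nhds]
      intro t₀ ht₀
      have := (h t₀)
      rw [nhds_prod_eq] at this
      exact this.curry.self_of_nhds.mono fun t ht => ht ht₀
  have : t ∈ {t | A t} := by
    rw [hclopen.eq_univ ⟨0, h0⟩]
    exact mem_univ t
  exact this

section Completeness

variable {m : ℕ} {M : Type*} [TopologicalSpace M] [T2Space M] [ChartedSpace (Euc (m + 1)) M]
  [IsManifold (𝓡 (m + 1)) ∞ M] {ξ : VField (m + 1) M}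

omit [T2Space M] in
theorem SmoothVField.one (hξ : SmoothVField ξ) :
    ContMDiff (𝓡 (m + 1)) (𝓡 (m + 1)).tangent 1
      (fun x => (⟨x, ξ x⟩ : TangentBundle (𝓡 (m + 1)) M)) :=
  ContMDiff.of_le hξ (by simp)

omit [T2Space M] [IsManifold (𝓡 (m + 1)) ∞ M] in
-- Points whose first coordinate is less than half the size of a box stay in the box for half that
-- size in either direction; compactness leaves finitely many boxes.
theorem exists_uniform_time (hreg : IsRegularField ξ) {K : Set M} (hK : IsCompact K) :
    ∃ ε > 0, ∀ y ∈ K, ∃ γ : ℝ → M, γ 0 = y ∧ IsMIntegralCurveOn γ ξ (Ioo (-ε) ε) := by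
  refine hK.induction_on (p := fun K => ∃ ε > 0, ∀ y ∈ K, ∃ γ : ℝ → M, γ 0 = y ∧
    IsMIntegralCurveOn γ ξ (Ioo (-ε) ε)) ⟨1, one_pos, by simp⟩ ?_ ?_ ?_
  · rintro s t hst ⟨ε, hε, h⟩
    exact ⟨ε, hε, fun y hy => h y (hst hy)⟩
  · rintro s t ⟨ε, hε, h⟩ ⟨ε', hε', h'⟩
    refine ⟨min ε ε', lt_min hε hε', ?_⟩
    rintro y (hy | hy)
    · obtain ⟨γ, h0, hγ⟩ := h y hy
      exact ⟨γ, h0, hγ.mono (Ioo_subset_Ioo (neg_le_neg (min_le_left _ _)) (min_le_left _ _))⟩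
    · obtain ⟨γ, h0, hγ⟩ := h' y hy
      exact ⟨γ, h0, hγ.mono (Ioo_subset_Ioo (neg_le_neg (min_le_right _ _)) (min_le_right _ _))⟩
  · intro q _
    obtain ⟨f, hq, hq0⟩ := hreg.exists_flowBox q
    have h1 : ∀ᶠ y in 𝓝 q, y ∈ f.e.source := f.e.open_source.mem_nhds hq
    have hcont : ContinuousAt (fun y => |f.e y 0|) q :=
      ((EuclideanSpace.proj (𝕜 := ℝ) (0 : Fin (m + 1))).continuous.continuousAt.comp
        (f.e.continuousAt hq)).abs
    have h2 : ∀ᶠ y in 𝓝 q, |f.e y 0| < f.a / 2 := by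
      refine hcont.eventually_lt_const ?_
      change |f.e q 0| < f.a / 2
      rw [hq0]
      simpa using f.a_pos
    refine ⟨_, mem_nhdsWithin_of_mem_nhds (h1.and h2), f.a / 2, half_pos f.a_pos, ?_⟩
    rintro y ⟨hy1, hy2⟩
    refine ⟨fun t => f.e.symm (f.e y + t • e₀ m), by simp [f.e.left_inv hy1],
      f.isMIntegralCurveOn_line fun t ht => f.add_smul_mem (f.e.map_source hy1) ?_⟩
    rw [abs_lt] at hy2 ⊢
    constructor <;> linarith [ht.1, ht.2]

omit [T2Space M] [IsManifold (𝓡 (m + 1)) ∞ M] in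
theorem mem_orbit_of_isMIntegralCurveOn {γ : ℝ → M} {a : ℝ} {x : M} (h0 : γ 0 = x)
    (hγ : IsMIntegralCurveOn γ ξ (Ioo (-a) a)) {t : ℝ} (ht : t ∈ Ioo (-a) a) :
    γ t ∈ orbit ξ x :=
  ⟨γ, Ioo (-a) a, isOpen_Ioo, ordConnected_Ioo, hγ, 0, ⟨by linarith [ht.1, ht.2],
    by linarith [ht.1, ht.2]⟩, t, ht, h0, rfl⟩

theorem exists_isMIntegralCurve (hξ : SmoothVField ξ) (hreg : IsRegularField ξ) (x : M)
    (hcpt : IsCompact (orbit ξ x)) : ∃ γ : ℝ → M, γ 0 = x ∧ IsMIntegralCurve γ ξ := by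
  have : IsManifold (𝓡 (m + 1)) 1 M := IsManifold.of_le (n := ∞) (by simp)
  obtain ⟨ε, hε, h⟩ := exists_uniform_time hreg hcpt
  have key : ∀ n : ℕ, ∃ γ : ℝ → M, γ 0 = x ∧
      IsMIntegralCurveOn γ ξ (Ioo (-(ε + n * (ε / 2))) (ε + n * (ε / 2))) := by
    intro n
    induction n with
    | zero =>
      obtain ⟨f, hq, hq0⟩ := hreg.exists_flowBox x
      have hx : x ∈ orbit ξ x := by
        refine ⟨fun t => f.e.symm (f.e x + t • e₀ m), Ioo (-f.a) f.a, isOpen_Ioo,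
          ordConnected_Ioo, f.isMIntegralCurveOn_line fun t ht => ?_, 0, ⟨by linarith [f.a_pos],
            f.a_pos⟩, 0, ⟨by linarith [f.a_pos], f.a_pos⟩, ?_, ?_⟩
        · refine f.add_smul_mem (f.e.map_source hq) ?_
          simpa [hq0] using abs_lt.2 ht
        all_goals simp [f.e.left_inv hq]
      simpa using h x hx
    | succ n ih =>
      obtain ⟨γ, h0, hγ⟩ := ih
      set a := ε + n * (ε / 2) with ha
      have hεa : ε ≤ a := by
        rw [ha]
        have : 0 ≤ n * (ε / 2) := by positivity
        linarith
      have ha' : ε + ((n + 1 : ℕ) : ℝ) * (ε / 2) = a + ε / 2 := by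
        rw [ha]; push_cast; ring
      rw [ha']
      -- The curve is restarted at the points reached at times `±t₀`, which lie on the orbit. The
      -- new pieces last for time `ε`, so the glued curve extends by `ε / 2` at both ends.
      set t₀ := a - ε / 2 with ht₀
      have mem1 : -t₀ ∈ Ioo (-a) a := ⟨by linarith, by linarith⟩
      have mem2 : t₀ ∈ Ioo (-a) a := ⟨by linarith, by linarith⟩
      obtain ⟨γ₁, h1, hγ₁⟩ := h _ (mem_orbit_of_isMIntegralCurveOn h0 hγ mem1)
      obtain ⟨γ₂, h2, hγ₂⟩ := h _ (mem_orbit_of_isMIntegralCurveOn h0 hγ mem2)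
      have c1 : IsMIntegralCurveOn (γ₁ ∘ (· + t₀)) ξ (Ioo (-t₀ - ε) (-t₀ + ε)) :=
        (hγ₁.comp_add t₀).mono fun t ht => ⟨by linarith [ht.1], by linarith [ht.2]⟩
      have c2 : IsMIntegralCurveOn (γ₂ ∘ (· + -t₀)) ξ (Ioo (t₀ - ε) (t₀ + ε)) :=
        (hγ₂.comp_add (-t₀)).mono fun t ht => ⟨by linarith [ht.1], by linarith [ht.2]⟩
      have d1 := (isMIntegralCurveOn_piecewise (t₀ := -t₀) hξ.one hγ c1
        ⟨mem1, by linarith, by linarith⟩ (by simp [h1])).mono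
        (s' := Ioo (-(a + ε / 2)) a) (by
          rw [union_comm]
          exact Ioo_subset_Ioo_union_Ioo (by linarith) (by linarith) le_rfl)
      have d2 := (isMIntegralCurveOn_piecewise (t₀ := t₀) hξ.one d1 c2
        ⟨⟨by linarith, by linarith⟩, by linarith, by linarith⟩ (by
          rw [piecewise, if_pos mem2]; simp [h2])).mono
        (s' := Ioo (-(a + ε / 2)) (a + ε / 2))
        (Ioo_subset_Ioo_union_Ioo le_rfl (by linarith) (by linarith))
      refine ⟨_, ?_, d2⟩
      rw [piecewise, if_pos ⟨by linarith, by linarith⟩, piecewise,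
        if_pos ⟨by linarith, by linarith⟩, h0]
  rw [exists_isMIntegralCurve_iff_exists_isMIntegralCurveOn_Ioo hξ.one]
  intro a
  obtain ⟨n, hn⟩ := exists_nat_gt (a / (ε / 2))
  obtain ⟨γ, h0, hγ⟩ := key n
  rw [div_lt_iff₀ (by positivity)] at hn
  exact ⟨γ, h0, hγ.mono (Ioo_subset_Ioo (by linarith) (by linarith))⟩

end Completeness

/-- `Φ` is the flow of the complete vector field `ξ`. -/
structure IsFlow {m : ℕ} {M : Type*} [TopologicalSpace M]
    [ChartedSpace (Euc m) M] (ξ : VField m M) (Φ : ℝ → M → M) : Prop where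
  zero : ∀ x, Φ 0 x = x
  curve : ∀ x, IsMIntegralCurve (fun t => Φ t x) ξ

section Flow

variable {m : ℕ} {M : Type*} [TopologicalSpace M] [T2Space M] [ChartedSpace (Euc (m + 1)) M]
  [IsManifold (𝓡 (m + 1)) ∞ M] {ξ : VField (m + 1) M}

theorem exists_isFlow (hξ : SmoothVField ξ) (hreg : IsRegularField ξ)
    (hcpt : ∀ x, IsCompact (orbit ξ x)) : ∃ Φ, IsFlow ξ Φ := by
  choose γ h0 hγ using fun x => exists_isMIntegralCurve hξ hreg x (hcpt x)
  exact ⟨fun t x => γ x t, h0, hγ⟩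

variable {Φ : ℝ → M → M} (hΦ : IsFlow ξ Φ)

include hΦ

omit [T2Space M] [IsManifold (𝓡 (m + 1)) ∞ M] in
theorem IsFlow.continuous_curve (x : M) : Continuous fun t => Φ t x := (hΦ.curve x).continuous

variable (hξ : SmoothVField ξ)

include hξ

theorem IsFlow.add (s t : ℝ) (x : M) : Φ (s + t) x = Φ s (Φ t x) := by
  have : IsManifold (𝓡 (m + 1)) 1 M := IsManifold.of_le (n := ∞) (by simp)
  have h := isMIntegralCurve_Ioo_eq_of_contMDiff_boundaryless (t₀ := 0) hξ.one
    ((hΦ.curve x).comp_add t) (hΦ.curve (Φ t x)) (by simp [hΦ.zero])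
  exact congrFun h s

theorem IsFlow.neg_apply (t : ℝ) (x : M) : Φ (-t) (Φ t x) = x := by
  rw [← hΦ.add hξ, neg_add_cancel, hΦ.zero]

theorem IsFlow.eq_of_curve {γ : ℝ → M} {a b : ℝ} (hγ : IsMIntegralCurveOn γ ξ (Ioo a b))
    {s t : ℝ} (hs : s ∈ Ioo a b) (ht : t ∈ Ioo a b) : Φ (t - s) (γ s) = γ t := by
  have : IsManifold (𝓡 (m + 1)) 1 M := IsManifold.of_le (n := ∞) (by simp)
  have h := isMIntegralCurveOn_Ioo_eqOn_of_contMDiff_boundaryless (t₀ := s) hs hξ.one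
    (((hΦ.curve (γ s)).comp_add (-s)).isMIntegralCurveOn (Ioo a b)) hγ (by simp [hΦ.zero]) ht
  exact h

theorem IsFlow.sameOrbit_iff {x y : M} : SameOrbit ξ x y ↔ ∃ t, Φ t x = y := by
  constructor
  · rintro ⟨γ, s, hs, hs', hγ, a, ha, b, hb, rfl, rfl⟩
    obtain ⟨ε, hε, h1⟩ := Metric.isOpen_iff.1 hs (min a b)
      (by rcases min_choice a b with h | h <;> rwa [h])
    obtain ⟨δ, hδ, h2⟩ := Metric.isOpen_iff.1 hs (max a b)
      (by rcases max_choice a b with h | h <;> rwa [h])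
    -- Uniqueness of integral curves is used on open intervals, so the closed interval between the
    -- two times is enlarged inside `s`.
    have hsub : Ioo (min a b - ε) (max a b + δ) ⊆ s := by
      intro t ht
      by_cases c1 : t < min a b
      · exact h1 (by rw [Real.ball_eq_Ioo]; exact ⟨ht.1, by linarith⟩)
      by_cases c2 : max a b < t
      · exact h2 (by rw [Real.ball_eq_Ioo]; exact ⟨by linarith, ht.2⟩)
      exact hs'.out (h1 (Metric.mem_ball_self hε)) (h2 (Metric.mem_ball_self hδ))
        ⟨not_lt.1 c1, not_lt.1 c2⟩
    refine ⟨b - a, hΦ.eq_of_curve hξ (hγ.mono hsub) ⟨?_, ?_⟩ ⟨?_, ?_⟩⟩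
    · linarith [min_le_left a b]
    · linarith [le_max_left a b]
    · linarith [min_le_right a b]
    · linarith [le_max_right a b]
  · rintro ⟨t, rfl⟩
    exact ⟨fun t => Φ t x, univ, isOpen_univ, ordConnected_univ, (hΦ.curve x).isMIntegralCurveOn _,
      0, mem_univ _, t, mem_univ _, hΦ.zero x, rfl⟩

/-- Inside a box the flow is translation in the first coordinate, by uniqueness of integral curves.
-/
theorem IsFlow.apply_symm (f : FlowBox ξ) {v : Euc (m + 1)} (hv : v ∈ f.e.target) {t : ℝ}
    (ht : |v 0 + t| < f.a) : Φ t (f.e.symm v) = f.e.symm (v + t • e₀ m) := by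
  have h1 : IsMIntegralCurveOn (fun t : ℝ => f.e.symm (v + t • e₀ m)) ξ
      (Ioo (-f.a - v 0) (f.a - v 0)) :=
    f.isMIntegralCurveOn_line fun t ht => f.add_smul_mem hv
      (abs_lt.2 ⟨by linarith [ht.1], by linarith [ht.2]⟩)
  have h2 := abs_lt.1 ht
  have h3 := abs_lt.1 (f.abs_zero_lt hv)
  have h := hΦ.eq_of_curve hξ h1 (s := 0) (t := t) ⟨by linarith, by linarith⟩
    ⟨by linarith, by linarith⟩
  simpa using h

theorem IsFlow.apply_of_mem (f : FlowBox ξ) {x : M} (hx : x ∈ f.e.source) {t : ℝ}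
    (ht : |f.e x 0 + t| < f.a) : Φ t x = f.e.symm (f.e x + t • e₀ m) := by
  rw [← hΦ.apply_symm hξ f (f.e.map_source hx) ht, f.e.left_inv hx]

theorem IsFlow.mem_source (f : FlowBox ξ) {x : M} (hx : x ∈ f.e.source) {t : ℝ}
    (ht : |f.e x 0 + t| < f.a) : Φ t x ∈ f.e.source := by
  rw [hΦ.apply_of_mem hξ f hx ht]
  exact f.e.map_target (f.add_smul_mem (f.e.map_source hx) ht)

theorem IsFlow.chart_apply (f : FlowBox ξ) {x : M} (hx : x ∈ f.e.source) {t : ℝ}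
    (ht : |f.e x 0 + t| < f.a) : f.e (Φ t x) = f.e x + t • e₀ m := by
  rw [hΦ.apply_of_mem hξ f hx ht]
  exact f.e.right_inv (f.add_smul_mem (f.e.map_source hx) ht)

/-- Two points of a flow box on the same orbit differ by the difference of their first
coordinates. -/
theorem IsFlow.eq_of_sameOrbit (f : FlowBox ξ) {x y : M} (hx : x ∈ f.e.source)
    (hy : y ∈ f.e.source) (h : SameOrbit ξ x y) : Φ (f.e y 0 - f.e x 0) x = y := by
  have h1 := eq_add_smul_of_tailL_eq (f.slice x hx y hy h)
  rw [hΦ.apply_of_mem hξ f hx (by simpa using f.abs_zero_lt (f.e.map_source hy)), ← h1,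
    f.e.left_inv hy]

omit [T2Space M] [IsManifold (𝓡 (m + 1)) ∞ M] hΦ hξ in
theorem FlowBox.isOpen_times (f : FlowBox ξ) :
    IsOpen {p : ℝ × M | p.2 ∈ f.e.source ∧ |f.e p.2 0 + p.1| < f.a} := by
  rw [isOpen_iff_mem_nhds]
  rintro ⟨t, x⟩ ⟨hx, ht⟩
  have hc : ContinuousAt (fun p : ℝ × M => |f.e p.2 0 + p.1|) (t, x) := by
    refine (ContinuousAt.add ?_ continuousAt_fst).abs
    exact ((EuclideanSpace.proj (𝕜 := ℝ) (0 : Fin (m + 1))).continuous.continuousAt.comp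
        (f.e.continuousAt hx)).comp continuousAt_snd
  have h1 : ∀ᶠ p : ℝ × M in 𝓝 (t, x), p.2 ∈ f.e.source :=
    continuousAt_snd.eventually (f.e.open_source.mem_nhds hx)
  exact h1.and (hc.eventually_lt_const ht)

theorem IsFlow.contMDiffAt_of_mem (f : FlowBox ξ) {x : M} (hx : x ∈ f.e.source) {t : ℝ}
    (ht : |f.e x 0 + t| < f.a) :
    ContMDiffAt (𝓘(ℝ, ℝ).prod (𝓡 (m + 1))) (𝓡 (m + 1)) ∞ (fun p : ℝ × M => Φ p.1 p.2) (t, x) := by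
  have h1 : ContMDiffAt (𝓘(ℝ, ℝ).prod (𝓡 (m + 1))) (𝓡 (m + 1)) ∞
      (fun p : ℝ × M => f.e p.2 + p.1 • e₀ m) (t, x) := by
    have h2 : ContMDiffAt (𝓘(ℝ, ℝ).prod (𝓡 (m + 1))) (𝓡 (m + 1)) ∞
      (fun p : ℝ × M => f.e p.2) (t, x) :=
      ContMDiffAt.comp (I' := 𝓡 (m + 1)) (t, x) (contMDiffAt_of_mem_maximalAtlas f.mem hx)
        contMDiffAt_snd
    exact h2.add (contMDiffAt_fst.smul contMDiffAt_const)
  have h3 : ContMDiffAt (𝓘(ℝ, ℝ).prod (𝓡 (m + 1))) (𝓡 (m + 1)) ∞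
      (fun p : ℝ × M => f.e.symm (f.e p.2 + p.1 • e₀ m)) (t, x) :=
    ContMDiffAt.comp (I' := 𝓡 (m + 1)) (t, x)
      (contMDiffAt_symm_of_mem_maximalAtlas f.mem (f.add_smul_mem (f.e.map_source hx) ht)) h1
  refine h3.congr_of_eventuallyEq ?_
  filter_upwards [f.isOpen_times.mem_nhds ⟨hx, ht⟩] with p hp
    using hΦ.apply_of_mem hξ f hp.1 hp.2

variable (hreg : IsRegularField ξ)

include hreg

omit [T2Space M] [IsManifold (𝓡 (m + 1)) ∞ M] hξ in
/-- An induction principle along the orbits: it suffices to move inside the flow boxes. -/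
theorem IsFlow.induction_orbit {A : ℝ → M → Prop} (x : M) (h0 : A 0 x)
    (h : ∀ (f : FlowBox ξ) (s t : ℝ), Φ t x ∈ f.e.source → |f.e (Φ t x) 0 + s| < f.a →
      A t x → A (s + t) x) (t : ℝ) : A t x := by
  refine forall_of_eventually_imp (A := fun t => A t x) h0 (fun t₀ => ?_) t
  obtain ⟨f, hq, hq0⟩ := hreg.exists_flowBox (Φ t₀ x)
  have hc : ContinuousAt (fun p : ℝ × ℝ => (p.2 - p.1, Φ p.1 x)) (t₀, t₀) :=
    ContinuousAt.prodMk (by fun_prop)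
      ((hΦ.continuous_curve x).continuousAt.comp (x := (t₀, t₀)) continuousAt_fst)
  have hmem : (t₀ - t₀, Φ t₀ x) ∈ {p : ℝ × M | p.2 ∈ f.e.source ∧ |f.e p.2 0 + p.1| < f.a} := by
    refine ⟨hq, ?_⟩
    simpa [hq0] using f.a_pos
  filter_upwards [hc.eventually (f.isOpen_times.mem_nhds hmem)] with p hp hA
  simpa using h f (p.2 - p.1) p.1 hp.1 hp.2 hA

/-- In a box the flow is a translation, hence smooth for short times; the group law propagates this
along the whole orbit. -/
theorem IsFlow.contMDiff :
    ContMDiff (𝓘(ℝ, ℝ).prod (𝓡 (m + 1))) (𝓡 (m + 1)) ∞ (fun p : ℝ × M => Φ p.1 p.2) := by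
  rintro ⟨t, x⟩
  refine hΦ.induction_orbit hreg (A := fun t x => ContMDiffAt (𝓘(ℝ, ℝ).prod (𝓡 (m + 1)))
    (𝓡 (m + 1)) ∞ (fun p : ℝ × M => Φ p.1 p.2) (t, x)) x ?_ ?_ t
  · obtain ⟨f, hq, hq0⟩ := hreg.exists_flowBox x
    exact hΦ.contMDiffAt_of_mem hξ f hq (by simpa [hq0] using f.a_pos)
  · intro f s t hx hs hA
    have h1 := hΦ.contMDiffAt_of_mem hξ f hx hs
    have h2 : ContMDiffAt (𝓘(ℝ, ℝ).prod (𝓡 (m + 1))) (𝓡 (m + 1)) ∞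
        (fun p : ℝ × M => Φ t p.2) (s + t, x) :=
      ContMDiffAt.comp (I' := 𝓘(ℝ, ℝ).prod (𝓡 (m + 1))) (f := fun p : ℝ × M => (t, p.2))
        (g := fun p : ℝ × M => Φ p.1 p.2) (s + t, x) hA
        (contMDiffAt_const.prodMk contMDiffAt_snd)
    have h3 : ContMDiffAt (𝓘(ℝ, ℝ).prod (𝓡 (m + 1))) (𝓘(ℝ, ℝ).prod (𝓡 (m + 1))) ∞
        (fun p : ℝ × M => (p.1 - t, Φ t p.2)) (s + t, x) :=
      (contMDiffAt_fst.sub contMDiffAt_const).prodMk h2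
    have h4 := ContMDiffAt.comp_of_eq (f := fun p : ℝ × M => (p.1 - t, Φ t p.2)) h1 h3 (by simp)
    refine h4.congr_of_eventuallyEq (Eventually.of_forall fun p => ?_)
    simp [← hΦ.add hξ]

theorem IsFlow.contMDiff_apply (t : ℝ) : ContMDiff (𝓡 (m + 1)) (𝓡 (m + 1)) ∞ (Φ t) :=
  (hΦ.contMDiff hξ hreg).comp (contMDiff_const.prodMk contMDiff_id)

theorem IsFlow.continuous : Continuous fun p : ℝ × M => Φ p.1 p.2 :=
  (hΦ.contMDiff hξ hreg).continuous

end Flow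

section ChartPoint

variable {m : ℕ} {M : Type*} [TopologicalSpace M] [ChartedSpace (Euc m) M]
  {e : OpenPartialHomeomorph M (Euc m)}

theorem form1_eq_pullForm1 (he : e ∈ IsManifold.maximalAtlas (𝓡 m) ∞ M) {x : M}
    (hx : x ∈ e.source) (η : Form1 m M) (w : TangentSpace (𝓡 m) x) :
    η x w = pullForm1 e η (e x) (dchart e x w) := by
  obtain ⟨v, hv, rfl⟩ : ∃ u ∈ e.target, e.symm u = x := ⟨_, e.map_source hx, e.left_inv hx⟩
  rw [e.right_inv hv, pullForm1_apply, dsymm_dchart he hv]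

theorem form2_eq_pullForm2 (he : e ∈ IsManifold.maximalAtlas (𝓡 m) ∞ M) {x : M}
    (hx : x ∈ e.source) (σ : Form2 m M) (w w' : TangentSpace (𝓡 m) x) :
    σ x w w' = pullForm2 e σ (e x) (dchart e x w) (dchart e x w') := by
  obtain ⟨v, hv, rfl⟩ : ∃ u ∈ e.target, e.symm u = x := ⟨_, e.map_source hx, e.left_inv hx⟩
  rw [e.right_inv hv, pullForm2_apply, dsymm_dchart he hv, dsymm_dchart he hv]

theorem dchart_endo_eq (he : e ∈ IsManifold.maximalAtlas (𝓡 m) ∞ M) {x : M}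
    (hx : x ∈ e.source) (φ : EndoField m M) (w : TangentSpace (𝓡 m) x) :
    dchart e x (φ x w) = pullEndo e φ (e x) (dchart e x w) := by
  obtain ⟨v, hv, rfl⟩ : ∃ u ∈ e.target, e.symm u = x := ⟨_, e.map_source hx, e.left_inv hx⟩
  rw [e.right_inv hv, pullEndo_apply, dsymm_dchart he hv]

theorem dchart_injective (he : e ∈ IsManifold.maximalAtlas (𝓡 m) ∞ M) {x : M}
    (hx : x ∈ e.source) : Function.Injective (dchart e x) := by
  obtain ⟨v, hv, rfl⟩ : ∃ u ∈ e.target, e.symm u = x := ⟨_, e.map_source hx, e.left_inv hx⟩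
  intro w w' h
  rw [← dsymm_dchart he hv w, h, dsymm_dchart he hv w']

theorem dchart_surjective (he : e ∈ IsManifold.maximalAtlas (𝓡 m) ∞ M) {x : M}
    (hx : x ∈ e.source) : Function.Surjective (dchart e x) := by
  obtain ⟨v, hv, rfl⟩ : ∃ u ∈ e.target, e.symm u = x := ⟨_, e.map_source hx, e.left_inv hx⟩
  exact fun y => ⟨dsymm e v y, dchart_dsymm he hv y⟩

end ChartPoint

/-! ### Invariance under the flow, and local constancy of the period -/

section Invariance

variable {m : ℕ} {M : Type*} [TopologicalSpace M] [T2Space M] [ChartedSpace (Euc (m + 1)) M]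
  [IsManifold (𝓡 (m + 1)) ∞ M] {ξ : VField (m + 1) M} {Φ : ℝ → M → M} (hΦ : IsFlow ξ Φ)
  (hξ : SmoothVField ξ) (hreg : IsRegularField ξ)

include hΦ hξ hreg

/-- A translation has the identity as its derivative. -/
theorem IsFlow.dchart_mfderiv (f : FlowBox ξ) {x : M} (hx : x ∈ f.e.source) {t : ℝ}
    (ht : |f.e x 0 + t| < f.a) (w : TangentSpace (𝓡 (m + 1)) x) :
    dchart f.e (Φ t x) (mfderiv (𝓡 (m + 1)) (𝓡 (m + 1)) (Φ t) x w) = dchart f.e x w := by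
  have hd := mdifferentiable_of_mem_maximalAtlas f.mem
  have h1 : HasMFDerivAt (𝓡 (m + 1)) (𝓡 (m + 1)) (fun y => f.e (Φ t y)) x
      ((mfderiv (𝓡 (m + 1)) (𝓡 (m + 1)) f.e (Φ t x)).comp
        (mfderiv (𝓡 (m + 1)) (𝓡 (m + 1)) (Φ t) x)) :=
    HasMFDerivAt.comp x (hd.mdifferentiableAt (hΦ.mem_source hξ f hx ht)).hasMFDerivAt
      ((hΦ.contMDiff_apply hξ hreg t x).mdifferentiableAt (by simp)).hasMFDerivAt
  have h2 : HasMFDerivAt (𝓡 (m + 1)) (𝓡 (m + 1)) (fun y => f.e y + t • e₀ m) x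
      (mfderiv (𝓡 (m + 1)) (𝓡 (m + 1)) f.e x) := by
    have h3 : HasMFDerivAt (𝓡 (m + 1)) (𝓡 (m + 1)) (fun v : Euc (m + 1) => v + t • e₀ m) (f.e x)
        (ContinuousLinearMap.id ℝ (Euc (m + 1))) :=
      ((hasFDerivAt_id (𝕜 := ℝ) (f.e x)).add_const (t • e₀ m)).hasMFDerivAt
    exact HasMFDerivAt.comp x h3 (hd.mdifferentiableAt hx).hasMFDerivAt
  have h4 : (fun y => f.e (Φ t y)) =ᶠ[𝓝 x] fun y => f.e y + t • e₀ m := by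
    have hc : ContinuousAt (fun y : M => ((t, y) : ℝ × M)) x := by fun_prop
    filter_upwards [hc.eventually (f.isOpen_times.mem_nhds ⟨hx, ht⟩)] with y hy
      using hΦ.chart_apply hξ f hy.1 hy.2
  have h5 := hasMFDerivAt_unique h1 (h2.congr_of_eventuallyEq h4)
  exact DFunLike.congr_fun h5 w

theorem IsFlow.form1_invariant {η : Form1 (m + 1) M}
    (hη : ∀ (f : FlowBox ξ), ∀ v ∈ f.e.target, ∀ t : ℝ, |v 0 + t| < f.a →
      pullForm1 f.e η (v + t • e₀ m) = pullForm1 f.e η v) (t : ℝ) (x : M)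
    (w : TangentSpace (𝓡 (m + 1)) x) :
    η (Φ t x) (mfderiv (𝓡 (m + 1)) (𝓡 (m + 1)) (Φ t) x w) = η x w := by
  refine hΦ.induction_orbit hreg (A := fun t x => ∀ w : TangentSpace (𝓡 (m + 1)) x,
    η (Φ t x) (mfderiv (𝓡 (m + 1)) (𝓡 (m + 1)) (Φ t) x w) = η x w) x ?_ ?_ t w
  · intro w
    obtain ⟨f, hx, hx0⟩ := hreg.exists_flowBox x
    have h0 : |f.e x 0 + 0| < f.a := by simpa [hx0] using f.a_pos
    rw [form1_eq_pullForm1 f.mem (hΦ.mem_source hξ f hx h0), hΦ.dchart_mfderiv hξ hreg f hx h0,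
      hΦ.zero, ← form1_eq_pullForm1 f.mem hx]
  · intro f s t hx hs hA w
    have h1 : HasMFDerivAt (𝓡 (m + 1)) (𝓡 (m + 1)) (fun y => Φ s (Φ t y)) x
      ((mfderiv (𝓡 (m + 1)) (𝓡 (m + 1)) (Φ s) (Φ t x)).comp
        (mfderiv (𝓡 (m + 1)) (𝓡 (m + 1)) (Φ t) x)) :=
      HasMFDerivAt.comp x
        ((hΦ.contMDiff_apply hξ hreg s _).mdifferentiableAt (by simp)).hasMFDerivAt
        ((hΦ.contMDiff_apply hξ hreg t x).mdifferentiableAt (by simp)).hasMFDerivAt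
    have h2 : Φ (s + t) = fun y => Φ s (Φ t y) := funext fun y => hΦ.add hξ s t y
    rw [h2, h1.mfderiv]
    change η (Φ s (Φ t x)) (mfderiv (𝓡 (m + 1)) (𝓡 (m + 1)) (Φ s) (Φ t x)
      (mfderiv (𝓡 (m + 1)) (𝓡 (m + 1)) (Φ t) x w)) = _
    rw [form1_eq_pullForm1 f.mem (hΦ.mem_source hξ f hx hs), hΦ.dchart_mfderiv hξ hreg f hx hs,
      hΦ.chart_apply hξ f hx hs, hη f _ (f.e.map_source hx) s hs,
      ← form1_eq_pullForm1 f.mem hx, hA]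

/-- A time at which a point returns is a period for all nearby points. -/
theorem IsFlow.eventually_period {η : Form1 (m + 1) M}
    (hη : ∀ (f : FlowBox ξ), ∀ v ∈ f.e.target, ∀ t : ℝ, |v 0 + t| < f.a →
      pullForm1 f.e η (v + t • e₀ m) = pullForm1 f.e η v)
    (hηξ : ∀ x, η x (ξ x) = 1) {p : M} {T : ℝ} (hT : Φ T p = p) : ∀ᶠ y in 𝓝 p, Φ T y = y := by
  obtain ⟨f, hp, hp0⟩ := hreg.exists_flowBox p
  have hps : f.e.symm 0 = p := by rw [← hp0, f.e.left_inv hp]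
  have h0 : (0 : Euc (m + 1)) ∈ f.e.target := hp0 ▸ f.e.map_source hp
  have hcont : Continuous (Φ T) := (hΦ.contMDiff_apply hξ hreg T).continuous
  have hN : ∀ᶠ v in 𝓝 (0 : Euc (m + 1)), v ∈ f.e.target ∧ Φ T (f.e.symm v) ∈ f.e.source := by
    refine Filter.Eventually.and (f.e.open_target.mem_nhds h0) ?_
    have hc : ContinuousAt (fun v => Φ T (f.e.symm v)) 0 :=
      hcont.continuousAt.comp (f.e.continuousAt_symm h0)
    refine hc.eventually (f.e.open_source.mem_nhds ?_)
    change Φ T (f.e.symm 0) ∈ _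
    rwa [hps, hT]
  obtain ⟨r, hr, hball⟩ := Metric.eventually_nhds_iff_ball.1 hN
  let A : Euc (m + 1) → Euc (m + 1) := fun v => f.e (Φ T (f.e.symm v))
  -- The time shift of the return map in the box: by regularity the transverse coordinates do not
  -- change.
  let s : Euc (m + 1) → ℝ := fun v => A v 0 - v 0
  have hA : ∀ v ∈ Metric.ball (0 : Euc (m + 1)) r, A v = v + s v • e₀ m := by
    intro v hv
    obtain ⟨h1, h2⟩ := hball v hv
    have h3 := eq_add_smul_of_tailL_eq (f.slice _ (f.e.map_target h1) _ h2
      ((hΦ.sameOrbit_iff hξ).2 ⟨T, rfl⟩))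
    rwa [f.e.right_inv h1] at h3
  have hdA : ∀ v ∈ Metric.ball (0 : Euc (m + 1)) r, HasFDerivAt A
      (((dchart f.e (Φ T (f.e.symm v))).comp
        (mfderiv (𝓡 (m + 1)) (𝓡 (m + 1)) (Φ T) (f.e.symm v))).comp (dsymm f.e v)) v := by
    intro v hv
    obtain ⟨h1, h2⟩ := hball v hv
    have hd := mdifferentiable_of_mem_maximalAtlas f.mem
    have g1 := HasMFDerivAt.comp v
      ((hΦ.contMDiff_apply hξ hreg T (f.e.symm v)).mdifferentiableAt (by simp)).hasMFDerivAt
      (hd.mdifferentiableAt_symm h1).hasMFDerivAt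
    have g2 := HasMFDerivAt.comp v (hd.mdifferentiableAt h2).hasMFDerivAt g1
    exact g2.hasFDerivAt
  have hds : ∀ v ∈ Metric.ball (0 : Euc (m + 1)) r, HasFDerivAt s (0 : Euc (m + 1) →L[ℝ] ℝ) v := by
    intro v hv
    obtain ⟨h1, h2⟩ := hball v hv
    let L : Euc (m + 1) →L[ℝ] ℝ := EuclideanSpace.proj 0
    have hs1 : HasFDerivAt s (L.comp (((dchart f.e (Φ T (f.e.symm v))).comp
        (mfderiv (𝓡 (m + 1)) (𝓡 (m + 1)) (Φ T) (f.e.symm v))).comp (dsymm f.e v)) - L) v :=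
      (L.hasFDerivAt.comp v (hdA v hv)).sub L.hasFDerivAt
    set D := L.comp (((dchart f.e (Φ T (f.e.symm v))).comp
        (mfderiv (𝓡 (m + 1)) (𝓡 (m + 1)) (Φ T) (f.e.symm v))).comp (dsymm f.e v)) - L with hD
    have hA2 : HasFDerivAt A (ContinuousLinearMap.id ℝ _ + D.smulRight (e₀ m)) v := by
      refine ((hasFDerivAt_id v).add (hs1.smul_const (e₀ m))).congr_of_eventuallyEq ?_
      filter_upwards [Metric.isOpen_ball.mem_nhds hv] with w hw using hA w hw
    have huniq := (hdA v hv).unique hA2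
    -- The derivative of the return map sends `z` to `z + D z • e₀ m`. The flow preserves `η`, and
    -- `η` is 1 on `e₀ m`, so `η(z) + D z = η(z)`.
    suffices h : D = 0 by rwa [h] at hs1
    ext z
    have h3 := hΦ.form1_invariant hξ hreg hη T (f.e.symm v) (dsymm f.e v z)
    rw [form1_eq_pullForm1 f.mem h2] at h3
    have h4 : dchart f.e (Φ T (f.e.symm v)) (mfderiv (𝓡 (m + 1)) (𝓡 (m + 1)) (Φ T) (f.e.symm v)
        (dsymm f.e v z)) = z + D z • e₀ m := DFunLike.congr_fun huniq z
    have h5 : f.e (Φ T (f.e.symm v)) = v + s v • e₀ m := hA v hv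
    have h6 : |v 0 + s v| < f.a := by
      have := f.abs_zero_lt (f.e.map_source h2)
      rw [h5] at this
      simpa using this
    rw [h4, h5, hη f v h1 _ h6, map_add, map_smul, pullForm1_apply _ _ (e₀ m), f.dsymm_e₀ h1, hηξ,
      pullForm1_apply] at h3
    simpa using h3
  have hs0 : s 0 = 0 := by
    change f.e (Φ T (f.e.symm 0)) 0 - (0 : Euc (m + 1)) 0 = 0
    rw [hps, hT, hp0, sub_self]
  have hsz : ∀ v ∈ Metric.ball (0 : Euc (m + 1)) r, s v = 0 := by
    intro v hv
    rw [← hs0]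
    exact Metric.isOpen_ball.is_const_of_fderiv_eq_zero (𝕜 := ℝ)
      (convex_ball (0 : Euc (m + 1)) r).isPreconnected
      (fun w hw => (hds w hw).differentiableAt.differentiableWithinAt)
      (fun w hw => (hds w hw).fderiv) hv (Metric.mem_ball_self hr)
  have hfin : ∀ᶠ y in 𝓝 p, y ∈ f.e.source ∧ f.e y ∈ Metric.ball (0 : Euc (m + 1)) r := by
    refine Filter.Eventually.and (f.e.open_source.mem_nhds hp) ?_
    refine (f.e.continuousAt hp).eventually (Metric.isOpen_ball.mem_nhds ?_)
    rw [hp0]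
    exact Metric.mem_ball_self hr
  filter_upwards [hfin] with y hy
  have h1 := hA _ hy.2
  rw [hsz _ hy.2, zero_smul, add_zero] at h1
  have h2 := (hball _ hy.2).2
  change f.e (Φ T (f.e.symm (f.e y))) = f.e y at h1
  rw [f.e.left_inv hy.1] at h1 h2
  exact f.e.injOn h2 hy.1 h1

end Invariance

/-- `T` is the smallest positive period of the orbit of `x`. -/
structure IsMinPeriod {M : Type*} (Φ : ℝ → M → M) (x : M) (T : ℝ) : Prop where
  pos : 0 < T
  period : Φ T x = x
  minimal : ∀ t, 0 < t → t < T → Φ t x ≠ x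

theorem IsMinPeriod.unique {M : Type*} {Φ : ℝ → M → M} {x : M} {T T' : ℝ}
    (h : IsMinPeriod Φ x T) (h' : IsMinPeriod Φ x T') : T = T' := by
  rcases lt_trichotomy T T' with h1 | h1 | h1
  · exact absurd h.period (h'.minimal T h.pos h1)
  · exact h1
  · exact absurd h'.period (h.minimal T' h'.pos h1)

section Periods

variable {m : ℕ} {M : Type*} [TopologicalSpace M] [T2Space M] [ChartedSpace (Euc (m + 1)) M]
  [IsManifold (𝓡 (m + 1)) ∞ M] {ξ : VField (m + 1) M} {Φ : ℝ → M → M} (hΦ : IsFlow ξ Φ)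
  (hξ : SmoothVField ξ) (hreg : IsRegularField ξ)

include hΦ hξ

theorem IsFlow.period_int_mul {x : M} {T : ℝ} (hT : Φ T x = x) (k : ℤ) : Φ (k * T) x = x := by
  have hnat : ∀ n : ℕ, Φ (n * T) x = x := by
    intro n
    induction n with
    | zero => simp [hΦ.zero]
    | succ n ih =>
      have : ((n + 1 : ℕ) : ℝ) * T = T + n * T := by push_cast; ring
      rw [this, hΦ.add hξ, ih, hT]
  obtain ⟨n, rfl | rfl⟩ := k.eq_nat_or_neg
  · exact_mod_cast hnat n
  · have h := hΦ.neg_apply hξ (n * T) x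
    rw [hnat n] at h
    simpa using h

theorem IsFlow.minPeriod_dvd {x : M} {T t : ℝ} (hT : IsMinPeriod Φ x T) (ht : Φ t x = x) :
    ∃ k : ℤ, t = k * T := by
  refine ⟨⌊t / T⌋, ?_⟩
  have h1 : Φ (t - ⌊t / T⌋ * T) x = x := by
    have h2 := hΦ.period_int_mul hξ hT.period (-⌊t / T⌋)
    push_cast at h2
    rw [sub_eq_neg_add, ← neg_mul, hΦ.add hξ, ht, h2]
  have h2 : 0 ≤ t - ⌊t / T⌋ * T := by
    have := (le_div_iff₀ hT.pos).1 (Int.floor_le (t / T))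
    linarith
  have h3 : t - ⌊t / T⌋ * T < T := by
    have := (div_lt_iff₀ hT.pos).1 (Int.lt_floor_add_one (t / T))
    linarith
  rcases h2.eq_or_lt with h4 | h4
  · linarith
  · exact absurd h1 (hT.minimal _ h4 h3)

theorem IsFlow.isMinPeriod_apply {x : M} {T : ℝ} (hT : IsMinPeriod Φ x T) (t : ℝ) :
    IsMinPeriod Φ (Φ t x) T := by
  refine ⟨hT.pos, ?_, fun s hs hsT h => hT.minimal s hs hsT ?_⟩
  · rw [← hΦ.add hξ, add_comm, hΦ.add hξ, hT.period]
  · have h2 := congrArg (Φ (-t)) h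
    rw [hΦ.neg_apply hξ, ← hΦ.add hξ, ← hΦ.add hξ] at h2
    rwa [show -t + s + t = s by ring] at h2

include hreg

/-- As long as a point stays in a box, the flow changes its first coordinate, so it cannot return.
-/
theorem IsFlow.eventually_no_small_period (p : M) :
    ∃ δ > 0, ∀ᶠ y in 𝓝 p, ∀ t, 0 < t → t ≤ δ → Φ t y ≠ y := by
  obtain ⟨f, hp, hp0⟩ := hreg.exists_flowBox p
  refine ⟨f.a / 2, half_pos f.a_pos, ?_⟩
  have hcont : ContinuousAt (fun y => |f.e y 0|) p :=
    ((EuclideanSpace.proj (𝕜 := ℝ) (0 : Fin (m + 1))).continuous.continuousAt.comp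
      (f.e.continuousAt hp)).abs
  have h2 : ∀ᶠ y in 𝓝 p, |f.e y 0| < f.a / 2 := by
    refine hcont.eventually_lt_const ?_
    change |f.e p 0| < f.a / 2
    rw [hp0]
    simpa using f.a_pos
  filter_upwards [f.e.open_source.mem_nhds hp, h2] with y hy1 hy2 t ht0 ht h
  have h3 : |f.e y 0 + t| < f.a := by
    rw [abs_lt] at hy2 ⊢
    constructor <;> linarith
  have h4 := hΦ.chart_apply hξ f hy1 h3
  rw [h] at h4
  have h5 := congrArg (fun v : Euc (m + 1) => v 0) h4
  simp at h5
  exact ht0.ne' h5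

omit hreg in
theorem IsFlow.exists_return (hreg : IsRegularField ξ) {x : M} (hcpt : IsCompact (orbit ξ x)) :
    ∃ T > 0, Φ T x = x := by
  -- The orbit is covered in a bounded time interval, since each of finitely many boxes is crossed
  -- during a bounded set of times. Membership in the orbit is repeated as a premise because the
  -- compactness induction also runs over whole boxes, which contain other points.
  have key : ∃ R : ℝ, ∀ y ∈ orbit ξ x, ∃ t, |t| ≤ R ∧ (y ∈ orbit ξ x → Φ t x = y) := by
    refine hcpt.induction_on (p := fun K => ∃ R : ℝ, ∀ y ∈ K, ∃ t, |t| ≤ R ∧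
      (y ∈ orbit ξ x → Φ t x = y)) ⟨0, by simp⟩ ?_ ?_ ?_
    · rintro s t hst ⟨R, h⟩
      exact ⟨R, fun y hy => h y (hst hy)⟩
    · rintro s t ⟨R, h⟩ ⟨R', h'⟩
      refine ⟨max R R', ?_⟩
      rintro y (hy | hy)
      · obtain ⟨u, hu, hu'⟩ := h y hy
        exact ⟨u, hu.trans (le_max_left _ _), hu'⟩
      · obtain ⟨u, hu, hu'⟩ := h' y hy
        exact ⟨u, hu.trans (le_max_right _ _), hu'⟩
    · intro q hq
      obtain ⟨f, hqs, hq0⟩ := hreg.exists_flowBox q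
      obtain ⟨u, rfl⟩ := (hΦ.sameOrbit_iff hξ).1 hq
      refine ⟨f.e.source, mem_nhdsWithin_of_mem_nhds (f.e.open_source.mem_nhds hqs),
        |u| + f.a, fun y hy => ⟨f.e y 0 + u, ?_, fun hyo => ?_⟩⟩
      · have := abs_add_le (f.e y 0) u
        have := f.abs_zero_lt (f.e.map_source hy)
        linarith
      · obtain ⟨t, rfl⟩ := (hΦ.sameOrbit_iff hξ).1 hyo
        have h := hΦ.eq_of_sameOrbit hξ f hqs hy ((hΦ.sameOrbit_iff hξ).2 ⟨t - u, by
          rw [← hΦ.add hξ, sub_add_cancel]⟩)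
        rw [hq0] at h
        rw [hΦ.add hξ]
        simpa using h
  obtain ⟨R, hR⟩ := key
  -- This point is also reached at a time of absolute value at most `R`; the difference of the two
  -- times is a positive period.
  have hmem : Φ (R + 1) x ∈ orbit ξ x := (hΦ.sameOrbit_iff hξ).2 ⟨_, rfl⟩
  obtain ⟨t, ht, ht'⟩ := hR _ hmem
  refine ⟨R + 1 - t, by linarith [le_abs_self t], ?_⟩
  have h := congrArg (Φ (-t)) (ht' hmem)
  rw [hΦ.neg_apply hξ, ← hΦ.add hξ] at h
  rw [sub_eq_neg_add]
  exact h.symm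

theorem IsFlow.exists_isMinPeriod {x : M} (hcpt : IsCompact (orbit ξ x)) :
    ∃ T, IsMinPeriod Φ x T := by
  obtain ⟨δ, hδ, h⟩ := hΦ.eventually_no_small_period hξ hreg x
  have hsmall := h.self_of_nhds
  obtain ⟨T₁, hT₁, hT₁'⟩ := hΦ.exists_return hξ hreg hcpt
  let D : Set ℝ := {t | Φ t x = x} ∩ Ici δ
  have hD : IsClosed D :=
    (isClosed_eq (hΦ.continuous_curve x) continuous_const).inter isClosed_Ici
  have hne : D.Nonempty := ⟨T₁, hT₁', not_lt.1 fun hlt => hsmall T₁ hT₁ hlt.le hT₁'⟩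
  have hbdd : BddBelow D := ⟨δ, fun t ht => ht.2⟩
  have hmem := hD.csInf_mem hne hbdd
  refine ⟨sInf D, lt_of_lt_of_le hδ hmem.2, hmem.1, fun t ht0 ht h => ?_⟩
  have htD : t ∈ D := ⟨h, not_lt.1 fun hlt => hsmall t ht0 hlt.le h⟩
  exact absurd (csInf_le hbdd htD) (not_le.2 ht)

/-- `T` stays a period nearby, so the minimal period divides it. A proper divisor would be at most
`T / 2`; periods up to `δ` are excluded by the flow box, and those in `[δ, T / 2]` by continuity and
compactness of this interval. -/
theorem IsFlow.eventually_isMinPeriod (hcpt : ∀ x, IsCompact (orbit ξ x)) {η : Form1 (m + 1) M}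
    (hη : ∀ (f : FlowBox ξ), ∀ v ∈ f.e.target, ∀ t : ℝ, |v 0 + t| < f.a →
      pullForm1 f.e η (v + t • e₀ m) = pullForm1 f.e η v)
    (hηξ : ∀ x, η x (ξ x) = 1) {p : M} {T : ℝ} (hT : IsMinPeriod Φ p T) :
    ∀ᶠ y in 𝓝 p, IsMinPeriod Φ y T := by
  obtain ⟨δ, hδ, h1⟩ := hΦ.eventually_no_small_period hξ hreg p
  have h2 := hΦ.eventually_period hξ hreg hη hηξ hT.period
  have h3 : ∀ᶠ y in 𝓝 p, ∀ t ∈ Icc δ (T / 2), Φ t y ≠ y := by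
    refine isCompact_Icc.eventually_forall_of_forall_eventually fun t ht => ?_
    have hc : Continuous fun z : M × ℝ => Φ z.2 z.1 :=
      (hΦ.continuous hξ hreg).comp continuous_swap
    exact (ContinuousAt.ne_iff_eventually_ne (hc.continuousAt (x := (p, t))) continuousAt_fst).1
      (hT.minimal t (hδ.trans_le ht.1) (by linarith [ht.2, hT.pos]))
  filter_upwards [h1, h2, h3] with y hy1 hy2 hy3
  obtain ⟨T', hT'⟩ := hΦ.exists_isMinPeriod hξ hreg (hcpt y)
  obtain ⟨k, hk⟩ := hΦ.minPeriod_dvd hξ hT' hy2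
  have hk0 : 0 < k := by
    have : (0 : ℝ) < k := by
      by_contra hneg
      have := mul_nonpos_of_nonpos_of_nonneg (not_lt.1 hneg) hT'.pos.le
      linarith [hT.pos]
    exact_mod_cast this
  rcases (show k = 1 ∨ 2 ≤ k by lia) with rfl | hk2
  · rw [Int.cast_one, one_mul] at hk
    rwa [hk]
  · exfalso
    have hk2' : (2 : ℝ) ≤ k := by exact_mod_cast hk2
    have h4 : T' ≤ T / 2 := by nlinarith [hT'.pos]
    by_cases h5 : T' ≤ δ
    · exact hy1 T' hT'.pos h5 hT'.period
    · exact hy3 T' ⟨(not_le.1 h5).le, h4⟩ hT'.period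

end Periods

/-! ### The circle action -/

section CircleAction

theorem contMDiffAt_arg_one :
    ContMDiffAt (𝓡 1) 𝓘(ℝ, ℝ) ∞ (fun z : Circle => Complex.arg (z : ℂ)) 1 := by
  have h1 : ContDiffAt ℝ ∞ Complex.log ((1 : Circle) : ℂ) :=
    (Complex.contDiffAt_log (by simp)).restrict_scalars ℝ
  have h2 : ContDiffAt ℝ ∞ (fun z : ℂ => (Complex.log z).im) ((1 : Circle) : ℂ) :=
    Complex.imCLM.contDiff.contDiffAt.comp _ h1
  have h3 : ContMDiff (𝓡 1) 𝓘(ℝ, ℂ) ∞ (fun z : Circle => (z : ℂ)) :=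
    haveI : Fact (Module.finrank ℝ ℂ = 1 + 1) := finrank_real_complex_fact'
    contMDiff_coe_sphere
  have h4 := ContMDiffAt.comp (1 : Circle) h2.contMDiffAt h3.contMDiffAt
  exact h4.congr_of_eventuallyEq (Eventually.of_forall fun z => (Complex.log_im _).symm)

/-- The action of the circle by the flow `Φ`, where `2π c` is the period function. -/
abbrev circleAction {M : Type*} (Φ : ℝ → M → M) (c : M → ℝ) (hzero : ∀ x, Φ 0 x = x)
    (hadd : ∀ s t x, Φ (s + t) x = Φ s (Φ t x)) (hc : ∀ t x, c (Φ t x) = c x)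
    (hper : ∀ (k : ℤ) x, Φ (k * (c x * (2 * Real.pi))) x = x) : MulAction Circle M where
  smul z x := Φ (c x * Complex.arg (z : ℂ)) x
  one_smul x := by
    change Φ (c x * Complex.arg ((1 : Circle) : ℂ)) x = x
    simp [hzero]
  mul_smul z w x := by
    change Φ (c x * Complex.arg ((z * w : Circle) : ℂ)) x =
      Φ (c (Φ (c x * Complex.arg (w : ℂ)) x) * Complex.arg (z : ℂ))
        (Φ (c x * Complex.arg (w : ℂ)) x)
    rw [hc, ← hadd]
    -- Arguments add only up to a multiple of `2π`, which after scaling by `c x` is a multiple of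
    -- the period.
    obtain ⟨k, hk⟩ := Circle.exp_eq_exp.1 (show Circle.exp (Complex.arg ((z * w : Circle) : ℂ)) =
      Circle.exp (Complex.arg (z : ℂ) + Complex.arg (w : ℂ)) by
        rw [Circle.exp_add, Circle.exp_arg, Circle.exp_arg, Circle.exp_arg])
    rw [hk, ← mul_add, mul_add (c x) _ (k * (2 * Real.pi)), hadd,
      show c x * (k * (2 * Real.pi)) = k * (c x * (2 * Real.pi)) by ring, hper]

theorem circleAction_exp {M : Type*} (Φ : ℝ → M → M) (c : M → ℝ) (hzero : ∀ x, Φ 0 x = x)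
    (hadd : ∀ s t x, Φ (s + t) x = Φ s (Φ t x)) (hc : ∀ t x, c (Φ t x) = c x)
    (hper : ∀ (k : ℤ) x, Φ (k * (c x * (2 * Real.pi))) x = x) (t : ℝ) (x : M) :
    letI := circleAction Φ c hzero hadd hc hper
    Circle.exp t • x = Φ (c x * t) x := by
  change Φ (c x * Complex.arg (Circle.exp t : ℂ)) x = _
  obtain ⟨k, hk⟩ := Circle.exp_eq_exp.1 (Circle.exp_arg (Circle.exp t))
  rw [hk, mul_add, hadd, show c x * (k * (2 * Real.pi)) = k * (c x * (2 * Real.pi)) by ring, hper]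

end CircleAction

/-- The circle acts through the flow `Φ` of `ξ`, where the locally constant function `c` is the
minimal period divided by `2π`. -/
structure IsFlowAction {m : ℕ} {M : Type*} [TopologicalSpace M] [ChartedSpace (Euc m) M]
    [MulAction Circle M] (ξ : VField m M) (Φ : ℝ → M → M) (c : M → ℝ) : Prop where
  flow : IsFlow ξ Φ
  exp_smul : ∀ t x, Circle.exp t • x = Φ (c x * t) x
  isMinPeriod : ∀ x, IsMinPeriod Φ x (c x * (2 * Real.pi))
  apply_flow : ∀ t x, c (Φ t x) = c x
  eventually_eq : ∀ x, ∀ᶠ y in 𝓝 x, c y = c x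

section Action

variable {m : ℕ} {M : Type*} [TopologicalSpace M] [T2Space M] [ChartedSpace (Euc (m + 1)) M]
  [IsManifold (𝓡 (m + 1)) ∞ M] {ξ : VField (m + 1) M}

theorem exists_isFlowAction (hξ : SmoothVField ξ) (hreg : IsRegularField ξ)
    (hcpt : ∀ x, IsCompact (orbit ξ x)) {η : Form1 (m + 1) M}
    (hη : ∀ (f : FlowBox ξ), ∀ v ∈ f.e.target, ∀ t : ℝ, |v 0 + t| < f.a →
      pullForm1 f.e η (v + t • e₀ m) = pullForm1 f.e η v)
    (hηξ : ∀ x, η x (ξ x) = 1) :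
    ∃ (Φ : ℝ → M → M) (c : M → ℝ) (_ : MulAction Circle M), IsFlowAction ξ Φ c := by
  obtain ⟨Φ, hΦ⟩ := exists_isFlow hξ hreg hcpt
  choose T hT using fun x => hΦ.exists_isMinPeriod hξ hreg (hcpt x)
  let c : M → ℝ := fun x => T x / (2 * Real.pi)
  have hcT : ∀ x, c x * (2 * Real.pi) = T x := fun x => div_mul_cancel₀ _ (by positivity)
  have hc : ∀ t x, c (Φ t x) = c x := fun t x => by
    simp only [c, (hT (Φ t x)).unique (hΦ.isMinPeriod_apply hξ (hT x) t)]
  have hper : ∀ (k : ℤ) x, Φ (k * (c x * (2 * Real.pi))) x = x := fun k x => by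
    rw [hcT]
    exact hΦ.period_int_mul hξ (hT x).period k
  refine ⟨Φ, c, circleAction Φ c hΦ.zero (hΦ.add hξ) hc hper, ?_⟩
  let := circleAction Φ c hΦ.zero (hΦ.add hξ) hc hper
  refine ⟨hΦ, circleAction_exp Φ c hΦ.zero (hΦ.add hξ) hc hper,
    fun x => by rw [hcT]; exact hT x, hc, fun x => ?_⟩
  filter_upwards [hΦ.eventually_isMinPeriod hξ hreg hcpt hη hηξ (hT x)] with y hy
  simp only [c, (hT y).unique hy]

variable [MulAction Circle M] {Φ : ℝ → M → M} {c : M → ℝ} (h : IsFlowAction ξ Φ c)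

include h

omit [T2Space M] [IsManifold (𝓡 (m + 1)) ∞ M] in
theorem IsFlowAction.pos (x : M) : 0 < c x :=
  pos_of_mul_pos_left (h.isMinPeriod x).pos (by positivity)

omit [T2Space M] [IsManifold (𝓡 (m + 1)) ∞ M] in
theorem IsFlowAction.isLocallyConstant : IsLocallyConstant c :=
  (IsLocallyConstant.iff_eventually_eq c).2 h.eventually_eq

omit [T2Space M] [IsManifold (𝓡 (m + 1)) ∞ M] in
theorem IsFlowAction.smul_eq (z : Circle) (x : M) : z • x = Φ (c x * Complex.arg (z : ℂ)) x := by
  conv_lhs => rw [← Circle.exp_arg z]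
  exact h.exp_smul _ x

omit [T2Space M] [IsManifold (𝓡 (m + 1)) ∞ M] in
theorem IsFlowAction.flow_eq_smul (t : ℝ) (x : M) : Φ t x = Circle.exp (t / c x) • x := by
  rw [h.exp_smul, mul_div_cancel₀ _ (h.pos x).ne']

omit [T2Space M] [IsManifold (𝓡 (m + 1)) ∞ M] in
theorem IsFlowAction.generates : Generates (fun x => c x • ξ x) := by
  intro x t
  have h1 := (h.flow.curve x).comp_mul (c x) t
  have h2 : (fun t : ℝ => Circle.exp t • x) = (fun t => Φ t x) ∘ (· * c x) := by
    funext t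
    simp [h.exp_smul, mul_comm]
  rw [h2]
  refine h1.congr_mfderiv ?_
  simp only [Function.comp_apply, h.apply_flow, Pi.smul_apply]
  rfl

variable (hξ : SmoothVField ξ)

include hξ

theorem IsFlowAction.sameOrbit_iff {x y : M} : SameOrbit ξ x y ↔ ∃ z : Circle, z • x = y := by
  rw [h.flow.sameOrbit_iff hξ]
  constructor
  · rintro ⟨t, rfl⟩
    exact ⟨_, (h.flow_eq_smul t x).symm⟩
  · rintro ⟨z, rfl⟩
    exact ⟨_, (h.smul_eq z x).symm⟩

variable (hreg : IsRegularField ξ)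

include hreg

theorem IsFlowAction.isSmoothFreeAction : IsSmoothFreeAction (m + 1) M := by
  constructor
  · rintro ⟨z₀, x₀⟩
    -- The argument jumps at `-1`, so `z` is written as `z₀ * (z₀⁻¹ * z)` and only the argument near
    -- `1` is used.
    have h1 : ContMDiffAt ((𝓡 1).prod (𝓡 (m + 1))) 𝓘(ℝ, ℝ) ∞
        (fun p : Circle × M => Complex.arg ((z₀⁻¹ * p.1 : Circle) : ℂ)) (z₀, x₀) := by
      have h2 : ContMDiffAt ((𝓡 1).prod (𝓡 (m + 1))) (𝓡 1) ∞
          (fun p : Circle × M => z₀⁻¹ * p.1) (z₀, x₀) :=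
        contMDiffAt_const.mul contMDiffAt_fst
      exact ContMDiffAt.comp_of_eq contMDiffAt_arg_one h2 (by simp)
    have h2 : ContMDiffAt ((𝓡 1).prod (𝓡 (m + 1))) (𝓡 (m + 1)) ∞ (fun p : Circle × M =>
        Φ (c x₀ * (Complex.arg (z₀ : ℂ) + Complex.arg ((z₀⁻¹ * p.1 : Circle) : ℂ))) p.2)
        (z₀, x₀) :=
      ContMDiffAt.comp (I' := 𝓘(ℝ, ℝ).prod (𝓡 (m + 1))) (z₀, x₀)
        (h.flow.contMDiff hξ hreg).contMDiffAt
        ((contMDiffAt_const.mul (contMDiffAt_const.add h1)).prodMk contMDiffAt_snd)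
    refine h2.congr_of_eventuallyEq ?_
    have h3 : ∀ᶠ p : Circle × M in 𝓝 (z₀, x₀), c p.2 = c x₀ :=
      (continuousAt_snd (p := (z₀, x₀)) : Tendsto Prod.snd (𝓝 (z₀, x₀)) (𝓝 x₀)).eventually
        (h.eventually_eq x₀)
    filter_upwards [h3] with p hp
    rw [← hp, ← h.exp_smul, Circle.exp_add, Circle.exp_arg, Circle.exp_arg, mul_inv_cancel_left]
  · intro z x hzx
    rw [h.smul_eq] at hzx
    obtain ⟨k, hk⟩ := h.flow.minPeriod_dvd hξ (h.isMinPeriod x) hzx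
    have h1 : Complex.arg (z : ℂ) = k * (2 * Real.pi) := by
      have := (h.pos x).ne'
      apply mul_left_cancel₀ this
      rw [hk]; ring
    rw [← Circle.exp_arg z, h1, Circle.exp_int_mul_two_pi]

end Action

/-! ### The orbit space as a manifold -/

/-- The transverse coordinates of an orbit in a flow box. -/
def FlowBox.quotCoord {m : ℕ} {M : Type*} [TopologicalSpace M] [ChartedSpace (Euc (m + 1)) M]
    {ξ : VField (m + 1) M} (f : FlowBox ξ) (b : OrbitSpace ξ) : Euc m := by
  classical
  -- The slice condition makes the choice of the point irrelevant; 0 is a junk value for orbits that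
  -- miss the box.
  exact if h : ∃ x ∈ f.e.source, orbitProj ξ x = b then tailL m (f.e h.choose) else 0

section Projection

variable {m : ℕ} {M : Type*} [TopologicalSpace M] [T2Space M] [ChartedSpace (Euc (m + 1)) M]
  [IsManifold (𝓡 (m + 1)) ∞ M] {ξ : VField (m + 1) M} {Φ : ℝ → M → M} (hΦ : IsFlow ξ Φ)
  (hξ : SmoothVField ξ)

include hΦ hξ

theorem IsFlow.orbitProj_eq_iff {x y : M} : orbitProj ξ x = orbitProj ξ y ↔ SameOrbit ξ x y := by
  have heq : Equivalence (SameOrbit ξ) := by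
    refine ⟨fun x => ?_, fun {x y} h => ?_, fun {x y z} h h' => ?_⟩
    · exact (hΦ.sameOrbit_iff hξ).2 ⟨0, hΦ.zero x⟩
    · obtain ⟨t, rfl⟩ := (hΦ.sameOrbit_iff hξ).1 h
      exact (hΦ.sameOrbit_iff hξ).2 ⟨-t, hΦ.neg_apply hξ t x⟩
    · obtain ⟨t, rfl⟩ := (hΦ.sameOrbit_iff hξ).1 h
      obtain ⟨s, rfl⟩ := (hΦ.sameOrbit_iff hξ).1 h'
      exact (hΦ.sameOrbit_iff hξ).2 ⟨s + t, hΦ.add hξ s t x⟩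
  rw [orbitProj, Quot.eq, heq.eqvGen_iff]

theorem IsFlow.orbitProj_apply (t : ℝ) (x : M) : orbitProj ξ (Φ t x) = orbitProj ξ x :=
  ((hΦ.orbitProj_eq_iff hξ).2 ((hΦ.sameOrbit_iff hξ).2 ⟨t, rfl⟩)).symm

theorem IsFlow.symm_zeroCons_tailL (f : FlowBox ξ) {x : M} (hx : x ∈ f.e.source) :
    f.e.symm (zeroCons m (tailL m (f.e x))) = Φ (-(f.e x 0)) x := by
  rw [hΦ.apply_of_mem hξ f hx (by simpa using f.a_pos), zeroCons_tailL, neg_smul, sub_eq_add_neg]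

variable (hreg : IsRegularField ξ)

include hreg

/-- The saturation of an open set is the union of its preimages under the flow maps. -/
theorem IsFlow.isOpenQuotientMap : IsOpenQuotientMap (orbitProj ξ) := by
  refine ⟨Quot.mk_surjective, continuous_quot_mk, fun U hU => ?_⟩
  have h : orbitProj ξ ⁻¹' (orbitProj ξ '' U) = ⋃ t, Φ t ⁻¹' U := by
    ext x
    simp only [mem_preimage, mem_image, mem_iUnion]
    constructor
    · rintro ⟨y, hy, hyx⟩
      obtain ⟨t, rfl⟩ := (hΦ.sameOrbit_iff hξ).1 ((hΦ.orbitProj_eq_iff hξ).1 hyx.symm)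
      exact ⟨t, hy⟩
    · rintro ⟨t, ht⟩
      exact ⟨_, ht, hΦ.orbitProj_apply hξ t x⟩
  refine isQuotientMap_quot_mk.isOpen_preimage.1 ?_
  change IsOpen (orbitProj ξ ⁻¹' (orbitProj ξ '' U))
  rw [h]
  exact isOpen_iUnion fun t => hU.preimage (hΦ.contMDiff_apply hξ hreg t).continuous

omit hreg in
theorem IsFlow.quotCoord_proj (f : FlowBox ξ) {x : M} (hx : x ∈ f.e.source) :
    f.quotCoord (orbitProj ξ x) = tailL m (f.e x) := by
  have h : ∃ y ∈ f.e.source, orbitProj ξ y = orbitProj ξ x := ⟨x, hx, rfl⟩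
  rw [FlowBox.quotCoord, dif_pos h]
  exact f.slice _ h.choose_spec.1 _ hx ((hΦ.orbitProj_eq_iff hξ).1 h.choose_spec.2)

/-- The chart of the orbit space induced by a flow box. -/
def IsFlow.quotChart (f : FlowBox ξ) : OpenPartialHomeomorph (OrbitSpace ξ) (Euc m) where
  toFun := f.quotCoord
  invFun w := orbitProj ξ (f.e.symm (zeroCons m w))
  source := orbitProj ξ '' f.e.source
  target := {w | ∀ i, |w i| < f.a}
  map_source' := by
    rintro _ ⟨x, hx, rfl⟩ i
    rw [hΦ.quotCoord_proj hξ f hx]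
    exact f.mem_target.1 (f.e.map_source hx) i.succ
  map_target' w hw := ⟨_, f.e.map_target (f.zeroCons_mem hw), rfl⟩
  left_inv' := by
    rintro _ ⟨x, hx, rfl⟩
    rw [hΦ.quotCoord_proj hξ f hx, hΦ.symm_zeroCons_tailL hξ f hx, hΦ.orbitProj_apply hξ]
  right_inv' w hw := by
    have h := f.zeroCons_mem hw
    rw [hΦ.quotCoord_proj hξ f (f.e.map_target h), f.e.right_inv h, tailL_zeroCons]
  open_source := (hΦ.isOpenQuotientMap hξ hreg).isOpenMap _ f.e.open_source
  open_target := by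
    rw [Set.ofPred_forall]
    exact isOpen_iInter_of_finite fun i =>
      isOpen_lt (EuclideanSpace.proj (𝕜 := ℝ) i).continuous.abs continuous_const
  continuousOn_toFun := by
    rintro _ ⟨x, hx, rfl⟩
    refine ContinuousAt.continuousWithinAt ?_
    refine (hΦ.isOpenQuotientMap hξ hreg).continuousAt_comp_iff.1 ?_
    refine ((tailL m).continuous.continuousAt.comp (f.e.continuousAt hx)).congr ?_
    filter_upwards [f.e.open_source.mem_nhds hx] with y hy using (hΦ.quotCoord_proj hξ f hy).symm
  continuousOn_invFun :=
    continuous_quot_mk.comp_continuousOn (f.e.continuousOn_symm.comp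
      (zeroCons m).continuous.continuousOn fun _ hw => f.zeroCons_mem hw)

end Projection

/-- The manifold structure on the space of orbits of `ξ` for which the maps `q f` are charts,
where the chart `q f` consists of the transverse coordinates of the flow box `f`. -/
structure IsOrbitAtlas {m : ℕ} {M : Type*} [TopologicalSpace M] [ChartedSpace (Euc (m + 1)) M]
    {ξ : VField (m + 1) M} [ChartedSpace (Euc m) (OrbitSpace ξ)]
    (q : FlowBox ξ → OpenPartialHomeomorph (OrbitSpace ξ) (Euc m)) : Prop where
  mem : ∀ f, q f ∈ IsManifold.maximalAtlas (𝓡 m) ∞ (OrbitSpace ξ)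
  source_eq : ∀ f, (q f).source = orbitProj ξ '' f.e.source
  target_eq : ∀ f, (q f).target = {w | ∀ i, |w i| < f.a}
  symm_apply : ∀ f w, (q f).symm w = orbitProj ξ (f.e.symm (zeroCons m w))
  apply_proj : ∀ f : FlowBox ξ, ∀ x ∈ f.e.source, q f (orbitProj ξ x) = tailL m (f.e x)
  chartAt_eq : ∀ b : OrbitSpace ξ, ∃ f, chartAt (Euc m) b = q f

section Quotient

variable {m : ℕ} {M : Type*} [TopologicalSpace M] [T2Space M] [ChartedSpace (Euc (m + 1)) M]
  [IsManifold (𝓡 (m + 1)) ∞ M] {ξ : VField (m + 1) M} {Φ : ℝ → M → M} (hΦ : IsFlow ξ Φ)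
  (hξ : SmoothVField ξ) (hreg : IsRegularField ξ)

include hΦ hξ hreg

/-- A coordinate change embeds the hyperplane of one box, flows for a fixed time into the other box
and projects. A time that works at one point works nearby, and the flow does not change the orbit.
-/
theorem IsFlow.contDiffOn_quotChart (f f' : FlowBox ξ) :
    ContDiffOn ℝ ∞ ((hΦ.quotChart hξ hreg f).symm ≫ₕ hΦ.quotChart hξ hreg f')
      ((hΦ.quotChart hξ hreg f).symm ≫ₕ hΦ.quotChart hξ hreg f').source := by
  rintro w ⟨hw, x', hx', hxw⟩
  have hv := f.zeroCons_mem hw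
  change orbitProj ξ x' = orbitProj ξ (f.e.symm (zeroCons m w)) at hxw
  obtain ⟨t, rfl⟩ := (hΦ.sameOrbit_iff hξ).1 ((hΦ.orbitProj_eq_iff hξ).1 hxw.symm)
  have h1 : ContMDiffAt (𝓡 m) (𝓡 (m + 1)) ∞ (fun u => Φ t (f.e.symm (zeroCons m u))) w := by
    refine ContMDiffAt.comp w (hΦ.contMDiff_apply hξ hreg t _) ?_
    exact ContMDiffAt.comp (I' := 𝓡 (m + 1)) w (contMDiffAt_symm_of_mem_maximalAtlas f.mem hv)
      (zeroCons m).contDiff.contMDiff.contMDiffAt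
  have h2 : ContMDiffAt (𝓡 m) (𝓡 m) ∞
      (fun u => tailL m (f'.e (Φ t (f.e.symm (zeroCons m u))))) w :=
    ContMDiffAt.comp (I' := 𝓡 (m + 1)) w (tailL m).contDiff.contMDiff.contMDiffAt
      (ContMDiffAt.comp w (contMDiffAt_of_mem_maximalAtlas f'.mem hx') h1)
  refine (h2.contDiffAt.congr_of_eventuallyEq ?_).contDiffWithinAt
  filter_upwards [h1.continuousAt.eventually (f'.e.open_source.mem_nhds hx')] with u hu
  change f'.quotCoord (orbitProj ξ (f.e.symm (zeroCons m u))) = _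
  rw [← hΦ.orbitProj_apply hξ t, hΦ.quotCoord_proj hξ f' hu]

theorem IsFlow.exists_isOrbitAtlas : ∃ (_ : ChartedSpace (Euc m) (OrbitSpace ξ))
    (_ : IsManifold (𝓡 m) ∞ (OrbitSpace ξ))
    (q : FlowBox ξ → OpenPartialHomeomorph (OrbitSpace ξ) (Euc m)), IsOrbitAtlas q := by
  choose F hF _ using hreg.exists_flowBox
  let q := hΦ.quotChart hξ hreg
  let C : ChartedSpace (Euc m) (OrbitSpace ξ) :=
    { atlas := range q
      chartAt := fun b => q (F b.out)
      mem_chart_source := fun b => ⟨b.out, hF _, b.out_eq⟩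
      chart_mem_atlas := fun b => ⟨_, rfl⟩ }
  have hC : IsManifold (𝓡 m) ∞ (OrbitSpace ξ) := by
    refine isManifold_of_contDiffOn _ _ _ ?_
    rintro _ _ ⟨f, rfl⟩ ⟨f', rfl⟩
    have h := hΦ.contDiffOn_quotChart hξ hreg f f'
    simpa using h
  exact ⟨C, hC, q, fun f => IsManifold.subset_maximalAtlas ⟨f, rfl⟩, fun f => rfl, fun f => rfl,
    fun f w => rfl, fun f x hx => hΦ.quotCoord_proj hξ f hx, fun b => ⟨_, rfl⟩⟩

theorem IsFlow.secondCountableTopology [SecondCountableTopology M] :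
    SecondCountableTopology (OrbitSpace ξ) :=
  (hΦ.isOpenQuotientMap hξ hreg).isQuotientMap.secondCountableTopology
    (hΦ.isOpenQuotientMap hξ hreg).isOpenMap

end Quotient

/-- The orbit relation is the projection, along the compact circle, of the closed graph of the
action; hence it is closed, which suffices for an open quotient map. -/
theorem IsFlowAction.t2Space {m : ℕ} {M : Type*} [TopologicalSpace M] [T2Space M]
    [ChartedSpace (Euc (m + 1)) M] [IsManifold (𝓡 (m + 1)) ∞ M] {ξ : VField (m + 1) M}
    [MulAction Circle M] {Φ : ℝ → M → M} {c : M → ℝ} (h : IsFlowAction ξ Φ c)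
    (hξ : SmoothVField ξ) (hreg : IsRegularField ξ) : T2Space (OrbitSpace ξ) := by
  rw [t2Space_iff_of_isOpenQuotientMap (h.flow.isOpenQuotientMap hξ hreg)]
  have h1 : {q : M × M | orbitProj ξ q.1 = orbitProj ξ q.2} =
      Prod.snd '' {p : Circle × (M × M) | p.1 • p.2.1 = p.2.2} := by
    ext ⟨x, y⟩
    simp [h.flow.orbitProj_eq_iff hξ, h.sameOrbit_iff hξ]
  rw [h1]
  refine isClosedMap_snd_of_compactSpace _ (isClosed_eq ?_ (continuous_snd.comp continuous_snd))
  exact (h.isSmoothFreeAction hξ hreg).smooth.continuous.comp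
    (continuous_fst.prodMk (continuous_fst.comp continuous_snd))

theorem dchart_isInvertible {m : ℕ} {M : Type*} [TopologicalSpace M] [ChartedSpace (Euc m) M]
    {e : OpenPartialHomeomorph M (Euc m)} (he : e ∈ IsManifold.maximalAtlas (𝓡 m) ∞ M) {x : M}
    (hx : x ∈ e.source) : (dchart e x).IsInvertible :=
  ⟨(mdifferentiable_of_mem_maximalAtlas he).mfderiv hx, rfl⟩

/-! ### Descent of basic tensors to the orbit space -/

section Basic

variable {m : ℕ} {M : Type*} [TopologicalSpace M] [ChartedSpace (Euc (m + 1)) M]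
  {ξ : VField (m + 1) M}

set_option synthInstance.maxHeartbeats 200000 in
theorem IsBasicForm.pullForm2_add {β : Form2 (m + 1) M} (hβ : IsBasicForm ξ β) (f : FlowBox ξ)
    {v : Euc (m + 1)} (hv : v ∈ f.e.target) {t : ℝ} (ht : |v 0 + t| < f.a) :
    pullForm2 f.e β (v + t • e₀ m) = pullForm2 f.e β v :=
  f.eq_of_fderiv_e₀ (G := Euc (m + 1) →L[ℝ] Euc (m + 1) →L[ℝ] ℝ) (F := pullForm2 f.e β)
    (fun w hw => (hβ.contDiffAt f w hw).differentiableAt (by simp)) (hβ.fderiv_e₀ f) hv ht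

theorem IsBasicEndo.pullEndo_add {φ : EndoField (m + 1) M} (hφ : IsBasicEndo ξ φ) (f : FlowBox ξ)
    {v : Euc (m + 1)} (hv : v ∈ f.e.target) {t : ℝ} (ht : |v 0 + t| < f.a) :
    pullEndo f.e φ (v + t • e₀ m) = pullEndo f.e φ v :=
  f.eq_of_fderiv_e₀ (G := Euc (m + 1) →L[ℝ] Euc (m + 1)) (F := pullEndo f.e φ)
    (fun w hw => (hφ.contDiffAt f w hw).differentiableAt (by simp)) (hφ.fderiv_e₀ f) hv ht

theorem IsBasicForm.pullForm2_zeroCons_tailL {β : Form2 (m + 1) M} (hβ : IsBasicForm ξ β)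
    (f : FlowBox ξ) {v : Euc (m + 1)} (hv : v ∈ f.e.target) (y z : Euc (m + 1)) :
    pullForm2 f.e β v (zeroCons m (tailL m y)) (zeroCons m (tailL m z)) =
      pullForm2 f.e β v y z := by
  have h1 : ∀ y, pullForm2 f.e β v (e₀ m) y = 0 := fun y => by
    rw [pullForm2_apply, f.dsymm_e₀ hv, hβ.left]
  have h2 : ∀ y, pullForm2 f.e β v y (e₀ m) = 0 := fun y => by
    rw [pullForm2_apply, f.dsymm_e₀ hv, hβ.right]
  simp [zeroCons_tailL, h1, h2]

theorem IsBasicEndo.pullEndo_e₀ {φ : EndoField (m + 1) M} (hφ : IsBasicEndo ξ φ)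
    (f : FlowBox ξ) {v : Euc (m + 1)} (hv : v ∈ f.e.target) : pullEndo f.e φ v (e₀ m) = 0 := by
  rw [pullEndo_apply, f.dsymm_e₀ hv, hφ.apply_ξ, map_zero]

theorem IsBasicEndo.pullEndo_zeroCons_tailL {φ : EndoField (m + 1) M} (hφ : IsBasicEndo ξ φ)
    (f : FlowBox ξ) {v : Euc (m + 1)} (hv : v ∈ f.e.target) (y : Euc (m + 1)) :
    pullEndo f.e φ v (zeroCons m (tailL m y)) = pullEndo f.e φ v y := by
  rw [zeroCons_tailL, map_sub, map_smul, hφ.pullEndo_e₀ f hv, smul_zero, sub_zero]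

end Basic

section Descent

variable {m : ℕ} {M : Type*} [TopologicalSpace M] [ChartedSpace (Euc (m + 1)) M]
  {ξ : VField (m + 1) M}

/-- The derivative of the projection onto the space of orbits. -/
abbrev dproj (ξ : VField (m + 1) M) [ChartedSpace (Euc m) (OrbitSpace ξ)] (x : M) :
    TangentSpace (𝓡 (m + 1)) x →L[ℝ] TangentSpace (𝓡 m) (orbitProj ξ x) :=
  mfderiv (𝓡 (m + 1)) (𝓡 m) (orbitProj ξ) x

variable [ChartedSpace (Euc m) (OrbitSpace ξ)]
  {q : FlowBox ξ → OpenPartialHomeomorph (OrbitSpace ξ) (Euc m)} (hq : IsOrbitAtlas q)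

include hq

theorem IsOrbitAtlas.proj_mem_source (f : FlowBox ξ) {x : M} (hx : x ∈ f.e.source) :
    orbitProj ξ x ∈ (q f).source := by
  rw [hq.source_eq]
  exact ⟨x, hx, rfl⟩

theorem IsOrbitAtlas.tailL_mem_target (f : FlowBox ξ) {v : Euc (m + 1)} (hv : v ∈ f.e.target) :
    tailL m v ∈ (q f).target := by
  rw [hq.target_eq]
  exact fun i => f.mem_target.1 hv i.succ

theorem IsOrbitAtlas.zeroCons_mem_target (f : FlowBox ξ) {w : Euc m} (hw : w ∈ (q f).target) :
    zeroCons m w ∈ f.e.target := by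
  rw [hq.target_eq] at hw
  exact f.zeroCons_mem hw

theorem IsOrbitAtlas.symm_tailL (f : FlowBox ξ) {x : M} (hx : x ∈ f.e.source) :
    (q f).symm (tailL m (f.e x)) = orbitProj ξ x := by
  rw [← hq.apply_proj f x hx, (q f).left_inv (hq.proj_mem_source f hx)]

theorem IsOrbitAtlas.contMDiff_proj (hreg : IsRegularField ξ) :
    ContMDiff (𝓡 (m + 1)) (𝓡 m) ∞ (orbitProj ξ) := by
  intro x
  obtain ⟨f, hx, -⟩ := hreg.exists_flowBox x
  have h1 : ContMDiffAt (𝓡 (m + 1)) (𝓡 m) ∞ (fun y => (q f).symm (tailL m (f.e y))) x := by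
    refine ContMDiffAt.comp (I' := 𝓡 m) x (contMDiffAt_symm_of_mem_maximalAtlas (hq.mem f)
      (hq.tailL_mem_target f (f.e.map_source hx))) ?_
    exact ContMDiffAt.comp (I' := 𝓡 (m + 1)) x (tailL m).contDiff.contMDiff.contMDiffAt
      (contMDiffAt_of_mem_maximalAtlas f.mem hx)
  refine h1.congr_of_eventuallyEq ?_
  filter_upwards [f.e.open_source.mem_nhds hx] with y hy using (hq.symm_tailL f hy).symm

variable (hreg : IsRegularField ξ)

include hreg

/-- In a box and its quotient chart the projection is the linear map `tailL m`, which is its own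
derivative. -/
theorem IsOrbitAtlas.dchart_dproj (f : FlowBox ξ) {x : M} (hx : x ∈ f.e.source)
    (v : TangentSpace (𝓡 (m + 1)) x) :
    dchart (q f) (orbitProj ξ x) (dproj ξ x v) = tailL m (dchart f.e x v) := by
  have h1 : HasMFDerivAt (𝓡 (m + 1)) (𝓡 m) (fun y => q f (orbitProj ξ y)) x
      ((mfderiv (𝓡 m) (𝓡 m) (q f) (orbitProj ξ x)).comp (dproj ξ x)) :=
    HasMFDerivAt.comp x ((mdifferentiable_of_mem_maximalAtlas (hq.mem f)).mdifferentiableAt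
      (hq.proj_mem_source f hx)).hasMFDerivAt
      ((hq.contMDiff_proj hreg x).mdifferentiableAt (by simp)).hasMFDerivAt
  have h2 : HasMFDerivAt (𝓡 (m + 1)) (𝓡 m) (fun y => tailL m (f.e y)) x
      ((tailL m).comp (mfderiv (𝓡 (m + 1)) (𝓡 (m + 1)) f.e x)) :=
    HasMFDerivAt.comp (I' := 𝓡 (m + 1)) x (tailL m).hasMFDerivAt
      ((mdifferentiable_of_mem_maximalAtlas f.mem).mdifferentiableAt hx).hasMFDerivAt
  have h3 := hasMFDerivAt_unique h1 (h2.congr_of_eventuallyEq (by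
    filter_upwards [f.e.open_source.mem_nhds hx] with y hy using hq.apply_proj f y hy))
  exact DFunLike.congr_fun h3 v

theorem IsOrbitAtlas.dproj_surjective (x : M) : Function.Surjective (dproj ξ x) := by
  obtain ⟨f, hx, -⟩ := hreg.exists_flowBox x
  intro u
  obtain ⟨v, hv⟩ := dchart_surjective f.mem hx (zeroCons m (dchart (q f) (orbitProj ξ x) u))
  refine ⟨v, dchart_injective (hq.mem f) (hq.proj_mem_source f hx) ?_⟩
  rw [hq.dchart_dproj hreg f hx, hv, tailL_zeroCons]

theorem IsOrbitAtlas.pullForm2_tailL (σ : Form2 m (OrbitSpace ξ)) (f : FlowBox ξ)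
    {v : Euc (m + 1)} (hv : v ∈ f.e.target) (y z : Euc (m + 1)) :
    pullForm2 (q f) σ (tailL m v) (tailL m y) (tailL m z) =
      σ (orbitProj ξ (f.e.symm v)) (dproj ξ (f.e.symm v) (dsymm f.e v y))
        (dproj ξ (f.e.symm v) (dsymm f.e v z)) := by
  have hx := f.e.map_target hv
  rw [form2_eq_pullForm2 (hq.mem f) (hq.proj_mem_source f hx), hq.dchart_dproj hreg f hx,
    hq.dchart_dproj hreg f hx, hq.apply_proj f _ hx, f.e.right_inv hv, dchart_dsymm f.mem hv,
    dchart_dsymm f.mem hv]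

theorem IsOrbitAtlas.pullEndo_tailL (J : EndoField m (OrbitSpace ξ)) (f : FlowBox ξ)
    {v : Euc (m + 1)} (hv : v ∈ f.e.target) (y : Euc (m + 1)) :
    pullEndo (q f) J (tailL m v) (tailL m y) =
      dchart (q f) (orbitProj ξ (f.e.symm v))
        (J (orbitProj ξ (f.e.symm v)) (dproj ξ (f.e.symm v) (dsymm f.e v y))) := by
  have hx := f.e.map_target hv
  rw [dchart_endo_eq (hq.mem f) (hq.proj_mem_source f hx), hq.dchart_dproj hreg f hx,
    hq.apply_proj f _ hx, f.e.right_inv hv, dchart_dsymm f.mem hv]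

end Descent

/-- In flow boxes, the `2`-form `β` is the pullback of the `2`-form `σ` on the space of orbits. -/
def FormDescends {m : ℕ} {M : Type*} [TopologicalSpace M] [ChartedSpace (Euc (m + 1)) M]
    {ξ : VField (m + 1) M} [ChartedSpace (Euc m) (OrbitSpace ξ)]
    (q : FlowBox ξ → OpenPartialHomeomorph (OrbitSpace ξ) (Euc m)) (β : Form2 (m + 1) M)
    (σ : Form2 m (OrbitSpace ξ)) : Prop :=
  ∀ f : FlowBox ξ, ∀ v ∈ f.e.target, ∀ y z, pullForm2 f.e β v y z =
    pullForm2 (q f) σ (tailL m v) (tailL m y) (tailL m z)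

/-- In flow boxes, the field of endomorphisms `φ` projects to the field of endomorphisms `J` on
the space of orbits. -/
def EndoDescends {m : ℕ} {M : Type*} [TopologicalSpace M] [ChartedSpace (Euc (m + 1)) M]
    {ξ : VField (m + 1) M} [ChartedSpace (Euc m) (OrbitSpace ξ)]
    (q : FlowBox ξ → OpenPartialHomeomorph (OrbitSpace ξ) (Euc m)) (φ : EndoField (m + 1) M)
    (J : EndoField m (OrbitSpace ξ)) : Prop :=
  ∀ f : FlowBox ξ, ∀ v ∈ f.e.target, ∀ y, tailL m (pullEndo f.e φ v y) =
    pullEndo (q f) J (tailL m v) (tailL m y)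

section Existence

variable {m : ℕ} {M : Type*} [TopologicalSpace M] [T2Space M] [ChartedSpace (Euc (m + 1)) M]
  [IsManifold (𝓡 (m + 1)) ∞ M] {ξ : VField (m + 1) M} {Φ : ℝ → M → M} (hΦ : IsFlow ξ Φ)
  (hξ : SmoothVField ξ) (hreg : IsRegularField ξ) [ChartedSpace (Euc m) (OrbitSpace ξ)]
  {q : FlowBox ξ → OpenPartialHomeomorph (OrbitSpace ξ) (Euc m)} (hq : IsOrbitAtlas q)

omit [T2Space M] [IsManifold (𝓡 (m + 1)) ∞ M] in
include hreg hq in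
theorem exists_centered_flowBox (b : OrbitSpace ξ) : ∃ f : FlowBox ξ,
    (0 : Euc (m + 1)) ∈ f.e.target ∧ orbitProj ξ (f.e.symm 0) = b ∧ (q f).symm 0 = b := by
  obtain ⟨x, rfl⟩ := Quot.mk_surjective b
  obtain ⟨f, hx, hx0⟩ := hreg.exists_flowBox x
  have h0 : f.e.symm 0 = x := by rw [← hx0, f.e.left_inv hx]
  exact ⟨f, hx0 ▸ f.e.map_source hx, by rw [h0]; rfl, by
    rw [hq.symm_apply, map_zero, h0]
    rfl⟩

omit [ChartedSpace (Euc m) (OrbitSpace ξ)] in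
include hΦ hξ hreg in
/-- A property of points in flow boxes which depends only on the transverse coordinates holds
everywhere if it holds at one point of each orbit. -/
theorem IsFlow.forall_of_transverse {P : FlowBox ξ → Euc (m + 1) → Prop} {R : M → Prop}
    (hR : ∀ f : FlowBox ξ, ∀ v ∈ f.e.target, R (f.e.symm v) ↔ P f v)
    (hP : ∀ f : FlowBox ξ, ∀ v ∈ f.e.target, ∀ t : ℝ, |v 0 + t| < f.a → P f v →
      P f (v + t • e₀ m)) (h : ∀ b : OrbitSpace ξ, ∃ x, orbitProj ξ x = b ∧ R x) (x : M) : R x := by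
  obtain ⟨x₀, hx₀, h0⟩ := h (orbitProj ξ x)
  obtain ⟨t, rfl⟩ := (hΦ.sameOrbit_iff hξ).1 ((hΦ.orbitProj_eq_iff hξ).1 hx₀)
  refine hΦ.induction_orbit hreg (A := fun t x => R (Φ t x)) x₀ (by rwa [hΦ.zero]) ?_ t
  intro f s t hx hs hA
  have hv := f.e.map_source hx
  rw [← f.e.left_inv hx, hR f _ hv] at hA
  rw [hΦ.add hξ, hΦ.apply_of_mem hξ f hx hs, hR f _ (f.add_smul_mem hv hs)]
  exact hP f _ hv s hs hA

include hΦ hξ hreg hq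

/-- Over each orbit the form is defined by the coefficients at the centre of one chosen box. The
pullback equation then holds at that point and spreads along the orbit, because these coefficients
do not depend on the first coordinate. -/
theorem IsBasicForm.exists_descends {β : Form2 (m + 1) M} (hβ : IsBasicForm ξ β) :
    ∃ σ, FormDescends q β σ := by
  choose F hF0 hFb hFq using exists_centered_flowBox hreg hq
  let L : ∀ b : OrbitSpace ξ, TangentSpace (𝓡 m) b →L[ℝ] Euc (m + 1) := fun b =>
    (zeroCons m).comp (dchart (q (F b)) b)
  let σ : Form2 m (OrbitSpace ξ) := fun b =>
    ((ContinuousLinearMap.precomp ℝ (L b)).comp (pullForm2 (F b).e β 0)).comp (L b)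
  -- The centre of the box projects to `b` only up to a propositional equality; allowing a second
  -- base point avoids transport between tangent spaces.
  have hσ : ∀ b b' : OrbitSpace ξ, b' = b → ∀ u u' : TangentSpace (𝓡 m) b', σ b' u u' =
      pullForm2 (F b).e β 0 (zeroCons m (dchart (q (F b)) b' u))
        (zeroCons m (dchart (q (F b)) b' u')) := by
    rintro b _ rfl u u'
    rfl
  have hR : ∀ f : FlowBox ξ, ∀ v ∈ f.e.target, (∀ y z, β (f.e.symm v) y z =
      σ (orbitProj ξ (f.e.symm v)) (dproj ξ _ y) (dproj ξ _ z)) ↔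
      ∀ y z, pullForm2 f.e β v y z =
        pullForm2 (q f) σ (tailL m v) (tailL m y) (tailL m z) := by
    intro f v hv
    constructor
    · intro h y z
      rw [hq.pullForm2_tailL hreg σ f hv, pullForm2_apply, h]
    · intro h y z
      rw [← dsymm_dchart f.mem hv y, ← dsymm_dchart f.mem hv z, ← pullForm2_apply, h,
        hq.pullForm2_tailL hreg σ f hv]
  have key := hΦ.forall_of_transverse hξ hreg (R := fun x => ∀ y z, β x y z =
    σ (orbitProj ξ x) (dproj ξ x y) (dproj ξ x z)) hR ?_ ?_
  · exact ⟨σ, fun f v hv => (hR f v hv).1 (key _)⟩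
  · intro f v hv t ht h y z
    rw [hβ.pullForm2_add f hv ht, h, map_add, map_smul, tailL_e₀, smul_zero, add_zero]
  · refine fun b => ⟨_, hFb b, (hR _ _ (hF0 b)).2 fun y z => ?_⟩
    have h0 := hq.tailL_mem_target _ (hF0 b)
    rw [pullForm2_apply _ (tailL m 0), hσ b _ (by rw [map_zero, hFq]),
      dchart_dsymm (hq.mem _) h0, dchart_dsymm (hq.mem _) h0,
      hβ.pullForm2_zeroCons_tailL _ (hF0 b)]

theorem IsBasicEndo.exists_descends {φ : EndoField (m + 1) M} (hφ : IsBasicEndo ξ φ) :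
    ∃ J, EndoDescends q φ J := by
  choose F hF0 hFb hFq using exists_centered_flowBox hreg hq
  let J : EndoField m (OrbitSpace ξ) := fun b =>
    (dchart (q (F b)) b).inverse.comp ((tailL m).comp ((pullEndo (F b).e φ 0).comp
      ((zeroCons m).comp (dchart (q (F b)) b))))
  have hJ : ∀ b b' : OrbitSpace ξ, b' = b → ∀ u : TangentSpace (𝓡 m) b',
      dchart (q (F b)) b' (J b' u) =
        tailL m (pullEndo (F b).e φ 0 (zeroCons m (dchart (q (F b)) b' u))) := by
    rintro _ b rfl u
    have hb : b ∈ (q (F b)).source := by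
      have h := (q (F b)).map_target (hq.tailL_mem_target _ (hF0 b))
      rwa [map_zero, hFq] at h
    exact (dchart_isInvertible (hq.mem _) hb).self_apply_inverse _
  have hR : ∀ f : FlowBox ξ, ∀ v ∈ f.e.target, (∀ y, dproj ξ _ (φ (f.e.symm v) y) =
      J (orbitProj ξ (f.e.symm v)) (dproj ξ _ y)) ↔
      ∀ y, tailL m (pullEndo f.e φ v y) = pullEndo (q f) J (tailL m v) (tailL m y) := by
    intro f v hv
    have hx := f.e.map_target hv
    constructor
    · intro h y
      rw [hq.pullEndo_tailL hreg J f hv, ← h, hq.dchart_dproj hreg f hx, pullEndo_apply]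
    · intro h y
      refine dchart_injective (hq.mem f) (hq.proj_mem_source f hx) ?_
      rw [hq.dchart_dproj hreg f hx, ← dsymm_dchart f.mem hv y, ← pullEndo_apply, h,
        hq.pullEndo_tailL hreg J f hv]
  have key := hΦ.forall_of_transverse hξ hreg (R := fun x => ∀ y, dproj ξ x (φ x y) =
    J (orbitProj ξ x) (dproj ξ x y)) hR ?_ ?_
  · exact ⟨J, fun f v hv => (hR f v hv).1 (key _)⟩
  · intro f v hv t ht h y
    rw [hφ.pullEndo_add f hv ht, h, map_add, map_smul, tailL_e₀, smul_zero, add_zero]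
  · refine fun b => ⟨_, hFb b, (hR _ _ (hF0 b)).2 fun y => ?_⟩
    have h0 := hq.tailL_mem_target _ (hF0 b)
    rw [pullEndo_apply _ (tailL m 0), hJ b _ (by rw [map_zero, hFq]),
      dchart_dsymm (hq.mem _) h0, hφ.pullEndo_zeroCons_tailL _ (hF0 b)]

end Existence

section Forms

variable {m : ℕ} {M : Type*} [TopologicalSpace M] [ChartedSpace (Euc (m + 1)) M]
  {ξ : VField (m + 1) M} [ChartedSpace (Euc m) (OrbitSpace ξ)]
  {q : FlowBox ξ → OpenPartialHomeomorph (OrbitSpace ξ) (Euc m)} (hq : IsOrbitAtlas q)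

section Form

variable {β : Form2 (m + 1) M} {σ : Form2 m (OrbitSpace ξ)} (hσ : FormDescends q β σ)

include hq hσ

theorem FormDescends.apply_dproj (hreg : IsRegularField ξ) (x : M)
    (v w : TangentSpace (𝓡 (m + 1)) x) :
    σ (orbitProj ξ x) (dproj ξ x v) (dproj ξ x w) = β x v w := by
  obtain ⟨f, hx, -⟩ := hreg.exists_flowBox x
  rw [form2_eq_pullForm2 f.mem hx, hσ f _ (f.e.map_source hx),
    form2_eq_pullForm2 (hq.mem f) (hq.proj_mem_source f hx), hq.dchart_dproj hreg f hx,
    hq.dchart_dproj hreg f hx, hq.apply_proj f x hx]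

theorem FormDescends.pullForm2_eq (f : FlowBox ξ) {w : Euc m} (hw : w ∈ (q f).target)
    (y z : Euc m) : pullForm2 (q f) σ w y z =
      pullForm2 f.e β (zeroCons m w) (zeroCons m y) (zeroCons m z) := by
  simp [hσ f _ (hq.zeroCons_mem_target f hw)]

set_option synthInstance.maxHeartbeats 200000 in
theorem FormDescends.contDiffAt (hβ : IsBasicForm ξ β) (f : FlowBox ξ) {w : Euc m}
    (hw : w ∈ (q f).target) : ContDiffAt ℝ ∞ (pullForm2 (q f) σ) w := by
  refine contDiffAt_of_forall_apply fun y => contDiffAt_of_forall_apply fun z => ?_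
  have h1 : ContDiffAt ℝ ∞ (fun u => pullForm2 f.e β (zeroCons m u)) w :=
    (hβ.contDiffAt f _ (hq.zeroCons_mem_target f hw)).comp w (zeroCons m).contDiff.contDiffAt
  refine ((h1.clm_apply (contDiffAt_const (c := zeroCons m y))).clm_apply
    (contDiffAt_const (c := zeroCons m z))).congr_of_eventuallyEq ?_
  filter_upwards [(q f).open_target.mem_nhds hw] with u hu using hσ.pullForm2_eq hq f hu y z

set_option synthInstance.maxHeartbeats 200000 in
-- Downstairs the form is the restriction of `β` to the hyperplane, and the exterior derivative
-- commutes with this pullback.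
theorem FormDescends.flatD2_eq (hβ : IsBasicForm ξ β) (f : FlowBox ξ) {w : Euc m}
    (hw : w ∈ (q f).target) (x y z : Euc m) : flatD2 (pullForm2 (q f) σ) w x y z =
      flatD2 (pullForm2 f.e β) (zeroCons m w) (zeroCons m x) (zeroCons m y) (zeroCons m z) := by
  have hd := (hσ.contDiffAt hq hβ f hw).differentiableAt (by simp)
  have hd' := (hβ.contDiffAt f _ (hq.zeroCons_mem_target f hw)).differentiableAt (by simp)
  have key : ∀ x y z, fderiv ℝ (pullForm2 (q f) σ) w x y z =
      fderiv ℝ (pullForm2 f.e β) (zeroCons m w) (zeroCons m x) (zeroCons m y)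
        (zeroCons m z) := by
    intro x y z
    have h1 : HasFDerivAt (fun u => pullForm2 f.e β (zeroCons m u))
        ((fderiv ℝ (pullForm2 f.e β) (zeroCons m w)).comp (zeroCons m)) w :=
      hd'.hasFDerivAt.comp w (zeroCons m).hasFDerivAt
    have h2 : (fun u => pullForm2 (q f) σ u y z) =ᶠ[𝓝 w] fun u =>
        pullForm2 f.e β (zeroCons m u) (zeroCons m y) (zeroCons m z) := by
      filter_upwards [(q f).open_target.mem_nhds hw] with u hu using hσ.pullForm2_eq hq f hu y z
    have hy := h1.differentiableAt.clm_apply (differentiableAt_const (zeroCons m y))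
    rw [← fderiv_apply_const hd, ← fderiv_apply_const (hd.clm_apply (differentiableAt_const y)),
      h2.fderiv_eq, fderiv_apply_const hy, fderiv_apply_const h1.differentiableAt, h1.fderiv]
    rfl
  simp only [flatD2, key]

variable [IsManifold (𝓡 m) ∞ (OrbitSpace ξ)]

theorem FormDescends.smooth (hβ : IsBasicForm ξ β) : SmoothForm2 σ := by
  refine smoothForm2_of_contDiffAt fun b => ?_
  obtain ⟨f, hf⟩ := hq.chartAt_eq b
  have h := mem_chart_target (Euc m) b
  rw [hf] at h ⊢
  exact hσ.contDiffAt hq hβ f h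

theorem FormDescends.isClosed2 (hreg : IsRegularField ξ) (hβ : IsBasicForm ξ β)
    (hskew : ∀ b v w, σ b v w = -σ b w v)
    (hd : ∀ f : FlowBox ξ, ∀ v ∈ f.e.target, ∀ x y z, flatD2 (pullForm2 f.e β) v x y z = 0) :
    IsClosed2 (fun b v w => σ b v w) := by
  intro X Y Z hX hY hZ b
  obtain ⟨f, hf0, -, rfl⟩ := exists_centered_flowBox hreg hq b
  have h0 := hq.tailL_mem_target f hf0
  rw [map_zero] at h0
  rw [d2_eq (hq.mem f) h0 ((hσ.contDiffAt hq hβ f h0).differentiableAt (by simp)) hskew hX hY hZ,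
    hσ.flatD2_eq hq hβ f h0]
  exact hd f _ (hq.zeroCons_mem_target f h0) _ _ _

end Form

section Endo

variable {φ : EndoField (m + 1) M} {J : EndoField m (OrbitSpace ξ)} (hJ : EndoDescends q φ J)

include hq hJ

theorem EndoDescends.dproj_apply (hreg : IsRegularField ξ) (x : M)
    (v : TangentSpace (𝓡 (m + 1)) x) :
    dproj ξ x (φ x v) = J (orbitProj ξ x) (dproj ξ x v) := by
  obtain ⟨f, hx, -⟩ := hreg.exists_flowBox x
  refine dchart_injective (hq.mem f) (hq.proj_mem_source f hx) ?_
  rw [hq.dchart_dproj hreg f hx, dchart_endo_eq f.mem hx, hJ f _ (f.e.map_source hx),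
    dchart_endo_eq (hq.mem f) (hq.proj_mem_source f hx), hq.dchart_dproj hreg f hx,
    hq.apply_proj f x hx]

theorem EndoDescends.pullEndo_eq (f : FlowBox ξ) {w : Euc m} (hw : w ∈ (q f).target)
    (y : Euc m) :
    pullEndo (q f) J w y = tailL m (pullEndo f.e φ (zeroCons m w) (zeroCons m y)) := by
  simp [hJ f _ (hq.zeroCons_mem_target f hw)]

theorem EndoDescends.contDiffAt (hφ : IsBasicEndo ξ φ) (f : FlowBox ξ) {w : Euc m}
    (hw : w ∈ (q f).target) : ContDiffAt ℝ ∞ (pullEndo (q f) J) w := by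
  refine contDiffAt_of_forall_apply fun y => ?_
  have h1 : ContDiffAt ℝ ∞ (fun u => pullEndo f.e φ (zeroCons m u)) w :=
    (hφ.contDiffAt f _ (hq.zeroCons_mem_target f hw)).comp w (zeroCons m).contDiff.contDiffAt
  refine ((tailL m).contDiff.contDiffAt.comp w
    (h1.clm_apply (contDiffAt_const (c := zeroCons m y)))).congr_of_eventuallyEq ?_
  filter_upwards [(q f).open_target.mem_nhds hw] with u hu using hJ.pullEndo_eq hq f hu y

set_option synthInstance.maxHeartbeats 200000 in
theorem EndoDescends.flatNij_eq (hφ : IsBasicEndo ξ φ) (f : FlowBox ξ) {w : Euc m}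
    (hw : w ∈ (q f).target) (x y : Euc m) : flatNij (pullEndo (q f) J) w x y =
      tailL m (flatNij (pullEndo f.e φ) (zeroCons m w) (zeroCons m x) (zeroCons m y)) := by
  have hv := hq.zeroCons_mem_target f hw
  have hd := (hJ.contDiffAt hq hφ f hw).differentiableAt (by simp)
  have hd' := (hφ.contDiffAt f _ hv).differentiableAt (by simp)
  have key : ∀ x y, fderiv ℝ (pullEndo (q f) J) w x y =
      tailL m (fderiv ℝ (pullEndo f.e φ) (zeroCons m w) (zeroCons m x) (zeroCons m y)) := by
    intro x y
    have h1 : HasFDerivAt (fun u => pullEndo f.e φ (zeroCons m u))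
        ((fderiv ℝ (pullEndo f.e φ) (zeroCons m w)).comp (zeroCons m)) w :=
      hd'.hasFDerivAt.comp w (zeroCons m).hasFDerivAt
    have h2 : (fun u => pullEndo (q f) J u y) =ᶠ[𝓝 w] fun u =>
        tailL m (pullEndo f.e φ (zeroCons m u) (zeroCons m y)) := by
      filter_upwards [(q f).open_target.mem_nhds hw] with u hu using hJ.pullEndo_eq hq f hu y
    have h3 := h1.differentiableAt.clm_apply (differentiableAt_const (zeroCons m y))
    have h4 := (tailL m).hasFDerivAt.comp w h3.hasFDerivAt
    rw [← fderiv_apply_const hd, h2.fderiv_eq]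
    refine (DFunLike.congr_fun h4.fderiv x).trans ?_
    have h5 := fderiv_apply_const h1.differentiableAt x (zeroCons m y)
    rw [h1.fderiv] at h5
    exact congrArg (tailL m) h5
  -- The `e₀ m`-component of `φ v`, lost by projecting, does not matter as a direction of
  -- differentiation because `φ` is invariant along it.
  have hz : ∀ v, fderiv ℝ (pullEndo f.e φ) (zeroCons m w) (zeroCons m (tailL m v)) =
      fderiv ℝ (pullEndo f.e φ) (zeroCons m w) v := by
    intro v
    ext1 u
    have h1 : fderiv ℝ (pullEndo f.e φ) (zeroCons m w) (e₀ m) u = 0 :=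
      DFunLike.congr_fun (hφ.fderiv_e₀ f _ hv) u
    rw [zeroCons_tailL, map_sub, map_smul, sub_apply, smul_apply, h1,
      smul_zero, sub_zero]
  simp only [flatNij, key, hJ.pullEndo_eq hq f hw, hz, hφ.pullEndo_zeroCons_tailL f hv, map_add,
    map_sub]

variable [IsManifold (𝓡 m) ∞ (OrbitSpace ξ)]

theorem EndoDescends.smooth (hφ : IsBasicEndo ξ φ) : SmoothEndo J := by
  refine smoothEndo_of_contDiffAt fun b => ?_
  obtain ⟨f, hf⟩ := hq.chartAt_eq b
  have h := mem_chart_target (Euc m) b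
  rw [hf] at h ⊢
  exact hJ.contDiffAt hq hφ f h

theorem EndoDescends.integrable (hreg : IsRegularField ξ) (hφ : IsBasicEndo ξ φ)
    (hN : ∀ f : FlowBox ξ, ∀ v ∈ f.e.target, ∀ x y, tailL m (flatNij (pullEndo f.e φ) v x y) = 0)
    {X Y : VField m (OrbitSpace ξ)} (hX : SmoothVField X) (hY : SmoothVField Y)
    (b : OrbitSpace ξ) : nijenhuis J X Y b = 0 := by
  obtain ⟨f, hf0, -, rfl⟩ := exists_centered_flowBox hreg hq b
  have h0 := hq.tailL_mem_target f hf0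
  rw [map_zero] at h0
  have hsm := hJ.smooth hq hφ
  have h1 := pullField_nijenhuis (hq.mem f) h0
    ((hJ.contDiffAt hq hφ f h0).differentiableAt (by simp)) hX hY (hsm.app hX) (hsm.app hY)
  rw [hJ.flatNij_eq hq hφ f h0, hN f _ (hq.zeroCons_mem_target f h0)] at h1
  refine dchart_injective (hq.mem f) ((q f).map_target h0) ?_
  rw [map_zero]
  exact h1

end Endo

end Forms

/-! ### The principal circle bundle and the connection form -/

/-- The section of the projection onto the space of orbits over a flow box. -/
def FlowBox.sec {m : ℕ} {M : Type*} [TopologicalSpace M] [ChartedSpace (Euc (m + 1)) M]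
    {ξ : VField (m + 1) M} (q : FlowBox ξ → OpenPartialHomeomorph (OrbitSpace ξ) (Euc m))
    (f : FlowBox ξ) (b : OrbitSpace ξ) : M :=
  f.e.symm (zeroCons m (q f b))

section Bundle

variable {m : ℕ} {M : Type*} [TopologicalSpace M] [T2Space M] [ChartedSpace (Euc (m + 1)) M]
  [IsManifold (𝓡 (m + 1)) ∞ M] {ξ : VField (m + 1) M} [MulAction Circle M] {Φ : ℝ → M → M}
  {c : M → ℝ} (h : IsFlowAction ξ Φ c) (hξ : SmoothVField ξ) (hreg : IsRegularField ξ)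
  [ChartedSpace (Euc m) (OrbitSpace ξ)]
  {q : FlowBox ξ → OpenPartialHomeomorph (OrbitSpace ξ) (Euc m)} (hq : IsOrbitAtlas q)

omit [T2Space M] [IsManifold (𝓡 (m + 1)) ∞ M] [MulAction Circle M] in
include hq in
theorem IsOrbitAtlas.proj_sec (f : FlowBox ξ) {b : OrbitSpace ξ} (hb : b ∈ (q f).source) :
    orbitProj ξ (f.sec q b) = b := by
  rw [FlowBox.sec, ← hq.symm_apply, (q f).left_inv hb]

omit [T2Space M] [IsManifold (𝓡 (m + 1)) ∞ M] [MulAction Circle M] in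
include hq in
theorem IsOrbitAtlas.sec_mem_source (f : FlowBox ξ) {b : OrbitSpace ξ} (hb : b ∈ (q f).source) :
    f.sec q b ∈ f.e.source :=
  f.e.map_target (hq.zeroCons_mem_target f ((q f).map_source hb))

omit [T2Space M] [IsManifold (𝓡 (m + 1)) ∞ M] [MulAction Circle M] in
include hq in
theorem IsOrbitAtlas.contMDiffOn_sec (f : FlowBox ξ) :
    ContMDiffOn (𝓡 m) (𝓡 (m + 1)) ∞ (f.sec q) (q f).source := by
  intro b hb
  refine ContMDiffAt.contMDiffWithinAt ?_
  refine ContMDiffAt.comp (I' := 𝓡 (m + 1)) b (contMDiffAt_symm_of_mem_maximalAtlas f.mem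
    (hq.zeroCons_mem_target f ((q f).map_source hb))) ?_
  exact ContMDiffAt.comp (I' := 𝓡 m) b (zeroCons m).contDiff.contMDiff.contMDiffAt
    (contMDiffAt_of_mem_maximalAtlas (hq.mem f) hb)

omit [MulAction Circle M] in
include hq hξ in
theorem IsFlow.sec_proj (hΦ : IsFlow ξ Φ) (f : FlowBox ξ) {x : M} (hx : x ∈ f.e.source) :
    f.sec q (orbitProj ξ x) = Φ (-(f.e x 0)) x := by
  rw [FlowBox.sec, hq.apply_proj f x hx, hΦ.symm_zeroCons_tailL hξ f hx]

omit [T2Space M] [IsManifold (𝓡 (m + 1)) ∞ M] [ChartedSpace (Euc m) (OrbitSpace ξ)] in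
include h in
theorem IsFlowAction.apply_smul (z : Circle) (x : M) : c (z • x) = c x := by
  rw [h.smul_eq, h.apply_flow]

include h hξ

omit [ChartedSpace (Euc m) (OrbitSpace ξ)] in
theorem IsFlowAction.orbitProj_eq_iff {x y : M} :
    orbitProj ξ x = orbitProj ξ y ↔ ∃ z : Circle, z • x = y := by
  rw [h.flow.orbitProj_eq_iff hξ, h.sameOrbit_iff hξ]

omit [ChartedSpace (Euc m) (OrbitSpace ξ)] in
theorem IsFlowAction.orbitProj_smul (z : Circle) (x : M) :
    orbitProj ξ (z • x) = orbitProj ξ x :=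
  ((h.orbitProj_eq_iff hξ).2 ⟨z, rfl⟩).symm

include hq in
theorem IsFlowAction.exists_smul_sec (f : FlowBox ξ) {x : M}
    (hx : orbitProj ξ x ∈ (q f).source) : ∃ z : Circle, z • f.sec q (orbitProj ξ x) = x :=
  (h.orbitProj_eq_iff hξ).1 (hq.proj_sec f hx)

include hq in
theorem IsFlowAction.exp_smul_sec (f : FlowBox ξ) {x : M} (hx : x ∈ f.e.source) :
    Circle.exp (f.e x 0 / c x) • f.sec q (orbitProj ξ x) = x := by
  rw [h.flow.sec_proj hξ hq f hx, h.exp_smul, h.apply_flow, mul_div_cancel₀ _ (h.pos x).ne',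
    ← h.flow.add hξ, add_neg_cancel, h.flow.zero]

include hreg hq

theorem IsFlowAction.isPrincipalCircleBundle :
    IsPrincipalCircleBundle (m := m + 1) (d := m) (orbitProj ξ) := by
  have hact := h.isSmoothFreeAction hξ hreg
  have hπ := hq.contMDiff_proj hreg
  refine ⟨hπ, Quot.mk_surjective, hact, fun x y => h.orbitProj_eq_iff hξ, fun b => ?_⟩
  obtain ⟨f, hf0, -, hfb⟩ := exists_centered_flowBox hreg hq b
  have hb : b ∈ (q f).source := by
    have h1 := (q f).map_target (hq.tailL_mem_target f hf0)
    rwa [map_zero, hfb] at h1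
  let U := (q f).source
  -- The fibre coordinate: the circle element that carries the section to `x`, unique over the chart
  -- domain by freeness.
  let ζ : M → Circle := fun x => by
    classical
    exact if hx : ∃ z : Circle, z • f.sec q (orbitProj ξ x) = x then hx.choose else 1
  have hζ : ∀ x, orbitProj ξ x ∈ U → ζ x • f.sec q (orbitProj ξ x) = x := by
    intro x hx
    have h1 := h.exists_smul_sec hξ hq f hx
    have h2 : ζ x = h1.choose := dif_pos h1
    rw [h2]
    exact h1.choose_spec
  have huniq : ∀ (x : M) (z w : Circle), z • x = w • x → z = w := by
    intro x z w hzw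
    have h1 : (w⁻¹ * z) • x = x := by rw [mul_smul, hzw, inv_smul_smul]
    exact (inv_mul_eq_one.1 (hact.free _ _ h1)).symm
  have hζeq : ∀ (x : M) (z : Circle), orbitProj ξ x ∈ U →
      z • f.sec q (orbitProj ξ x) = x → ζ x = z :=
    fun x z hx hz => huniq _ _ _ ((hζ x hx).trans hz.symm)
  have hsmul : ∀ z : Circle, ContMDiff (𝓡 (m + 1)) (𝓡 (m + 1)) ∞ (fun x : M => z • x) := fun z =>
    hact.smooth.comp (contMDiff_const.prodMk contMDiff_id)
  -- Acting by `z₀⁻¹` moves a neighbourhood of `x₀` into the box. There the flow time from the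
  -- section is the first coordinate, and dividing by the locally constant `c` gives the angle.
  have hζs : ∀ x, orbitProj ξ x ∈ U → ContMDiffAt (𝓡 (m + 1)) (𝓡 1) ∞ ζ x := by
    intro x₀ hx₀
    set z₀ := ζ x₀ with hz₀
    have hy₀ : z₀⁻¹ • x₀ = f.sec q (orbitProj ξ x₀) := by
      rw [inv_smul_eq_iff, hζ x₀ hx₀]
    have hys : z₀⁻¹ • x₀ ∈ f.e.source := hy₀ ▸ hq.sec_mem_source f hx₀
    have h1 : ContMDiffAt (𝓡 (m + 1)) (𝓡 (m + 1)) ∞ (fun x => f.e (z₀⁻¹ • x)) x₀ :=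
      ContMDiffAt.comp x₀ (contMDiffAt_of_mem_maximalAtlas f.mem hys) (hsmul z₀⁻¹ x₀)
    have h2 : ContMDiffAt (𝓡 (m + 1)) 𝓘(ℝ, ℝ) ∞ (fun x => (c x₀)⁻¹ * f.e (z₀⁻¹ • x) 0) x₀ :=
      contMDiffAt_const.mul (ContMDiffAt.comp (I' := 𝓡 (m + 1)) x₀
        (EuclideanSpace.proj (𝕜 := ℝ) (0 : Fin (m + 1))).contDiff.contMDiff.contMDiffAt h1)
    have h3 : ContMDiffAt (𝓡 (m + 1)) (𝓡 1) ∞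
        (fun x => z₀ * Circle.exp ((c x₀)⁻¹ * f.e (z₀⁻¹ • x) 0)) x₀ :=
      contMDiffAt_const.mul (ContMDiffAt.comp (I' := 𝓘(ℝ, ℝ)) x₀ contMDiff_circleExp.contMDiffAt h2)
    refine h3.congr_of_eventuallyEq ?_
    filter_upwards [(hsmul z₀⁻¹).continuous.continuousAt.eventually
      (f.e.open_source.mem_nhds hys), h.eventually_eq x₀] with x hx hcx
    have hxU : orbitProj ξ x ∈ U := by
      rw [← h.orbitProj_smul hξ z₀⁻¹ x]
      exact hq.proj_mem_source f hx
    refine hζeq x _ hxU ?_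
    have h4 := h.exp_smul_sec hξ hq f hx
    rw [h.orbitProj_smul hξ, h.apply_smul, hcx] at h4
    rw [mul_smul, inv_mul_eq_div, h4, smul_inv_smul]
  have hinv : ContMDiffOn ((𝓡 m).prod (𝓡 1)) (𝓡 (m + 1)) ∞
      (fun p : OrbitSpace ξ × Circle => p.2 • f.sec q p.1) (U ×ˢ univ) := by
    refine hact.smooth.comp_contMDiffOn (contMDiffOn_snd.prodMk ?_)
    exact (hq.contMDiffOn_sec f).comp contMDiffOn_fst fun p hp => hp.1
  have hfwd : ContMDiffOn (𝓡 (m + 1)) ((𝓡 m).prod (𝓡 1)) ∞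
      (fun x => (orbitProj ξ x, ζ x)) (orbitProj ξ ⁻¹' U) := fun x hx =>
    ((hπ x).prodMk (hζs x hx)).contMDiffWithinAt
  have hproj : ∀ b ∈ U, ∀ z : Circle, orbitProj ξ (z • f.sec q b) = b := fun b hb z => by
    rw [h.orbitProj_smul hξ, hq.proj_sec f hb]
  refine ⟨U,
    { toFun := fun x => (orbitProj ξ x, ζ x)
      invFun := fun p => p.2 • f.sec q p.1
      source := orbitProj ξ ⁻¹' U
      target := U ×ˢ univ
      map_source' := fun x hx => ⟨hx, mem_univ _⟩
      map_target' := fun p hp => ?_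
      left_inv' := fun x hx => hζ x hx
      right_inv' := fun p hp => ?_
      open_source := (q f).open_source.preimage hπ.continuous
      open_target := (q f).open_source.prod isOpen_univ
      continuousOn_toFun := hfwd.continuousOn
      continuousOn_invFun := hinv.continuousOn },
    (q f).open_source, hb, rfl, rfl, hfwd, hinv, fun x hx => ⟨rfl, fun z => ?_⟩⟩
  · change orbitProj ξ (p.2 • f.sec q p.1) ∈ U
    rw [hproj _ hp.1]
    exact hp.1
  · refine Prod.ext (hproj _ hp.1 _) (hζeq _ _ ?_ ?_)
    · rw [hproj _ hp.1]
      exact hp.1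
    · rw [hproj _ hp.1]
  · have h1 : orbitProj ξ (z • x) = orbitProj ξ x := h.orbitProj_smul hξ z x
    refine Prod.ext h1 (hζeq _ _ (h1 ▸ hx) ?_)
    change (z * ζ x) • f.sec q (orbitProj ξ (z • x)) = z • x
    rw [h1, mul_smul, hζ x hx]

omit hq [ChartedSpace (Euc m) (OrbitSpace ξ)] in
theorem IsFlowAction.isConnectionForm {η : Form1 (m + 1) M} (hηs : SmoothForm1 η)
    (hη : ∀ (f : FlowBox ξ), ∀ v ∈ f.e.target, ∀ t : ℝ, |v 0 + t| < f.a →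
      pullForm1 f.e η (v + t • e₀ m) = pullForm1 f.e η v)
    (hηξ : ∀ x, η x (ξ x) = 1) : IsConnectionForm c η := by
  refine ⟨hηs, h.isLocallyConstant, fun x => (h.pos x).ne', fun x => ?_, fun z x v => ?_⟩
  · have h1 := (h.generates x 0).mfderiv
    have h2 : mfderiv 𝓘(ℝ, ℝ) (𝓡 (m + 1)) (fun t : ℝ => Circle.exp t • x) 0 (1 : ℝ) =
        c (Circle.exp 0 • x) • ξ (Circle.exp 0 • x) := by
      rw [h1]
      exact one_smul ℝ _
    rw [h2, map_smul, hηξ, h.apply_smul, smul_eq_mul, mul_one]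
  -- As `c` is locally constant, acting by `z` is near `x` the flow at one fixed time, which
  -- preserves `η`.
  · have h1 : (fun y : M => z • y) =ᶠ[𝓝 x] Φ (c x * Complex.arg (z : ℂ)) := by
      filter_upwards [h.eventually_eq x] with y hy
      rw [h.smul_eq, hy]
    have h2 := h.flow.form1_invariant hξ hreg hη (c x * Complex.arg (z : ℂ)) x v
    have h3 : z • x = Φ (c x * Complex.arg (z : ℂ)) x := h.smul_eq z x
    refine Eq.trans ?_ h2
    have h4 : (mfderiv (𝓡 (m + 1)) (𝓡 (m + 1)) (fun y : M => z • y) x :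
        Euc (m + 1) →L[ℝ] Euc (m + 1)) =
      mfderiv (𝓡 (m + 1)) (𝓡 (m + 1)) (Φ (c x * Complex.arg (z : ℂ))) x := h1.mfderiv_eq
    -- Tangent spaces are replaced by the model space so that the base point can be rewritten.
    let η' : M → Euc (m + 1) →L[ℝ] ℝ := η
    change η' (z • x) ((mfderiv (𝓡 (m + 1)) (𝓡 (m + 1)) (fun y : M => z • y) x :
      Euc (m + 1) →L[ℝ] Euc (m + 1)) v) = η' (Φ (c x * Complex.arg (z : ℂ)) x) _
    rw [h4, h3]

end Bundle

/-! ### The Kähler structure and the curvature form on the base -/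

namespace AlmostContactMetric

variable {m : ℕ} {M : Type*} [TopologicalSpace M] [T2Space M] [ChartedSpace (Euc (m + 1)) M]
  [IsManifold (𝓡 (m + 1)) ∞ M] {S : AlmostContactMetric (m + 1) M}

section Quotient

variable [ChartedSpace (Euc m) (OrbitSpace S.ξ)]
  {q : FlowBox S.ξ → OpenPartialHomeomorph (OrbitSpace S.ξ) (Euc m)} (hq : IsOrbitAtlas q)
  (hreg : IsRegularField S.ξ)

include hq hreg

omit [T2Space M] in
theorem dproj_ξ (x : M) : dproj S.ξ x (S.ξ x) = 0 := by
  obtain ⟨f, hx, -⟩ := hreg.exists_flowBox x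
  refine dchart_injective (hq.mem f) (hq.proj_mem_source f hx) ?_
  rw [hq.dchart_dproj hreg f hx, f.dchart_ξ x hx, tailL_e₀, map_zero]

omit [T2Space M] in
/-- Tangent vectors of the space of orbits lift to horizontal vectors. -/
theorem exists_horizontal_lift (x : M) (u : TangentSpace (𝓡 m) (orbitProj S.ξ x)) :
    ∃ v, S.η x v = 0 ∧ dproj S.ξ x v = u := by
  obtain ⟨v, rfl⟩ := hq.dproj_surjective hreg x u
  refine ⟨v - S.η x v • S.ξ x, ?_, ?_⟩
  · rw [map_sub, map_smul, S.η_ξ, smul_eq_mul, mul_one, sub_self]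
  · rw [map_sub, map_smul, dproj_ξ hq hreg, smul_zero, sub_zero]

variable [IsManifold (𝓡 m) ∞ (OrbitSpace S.ξ)]

/-- The metric on the space of orbits for which the projection is a Riemannian submersion. -/
theorem exists_quotient_metric (hS : S.IsAntiQuasiSasakian) {κ : Form2 m (OrbitSpace S.ξ)}
    (hκ : FormDescends q S.transverse κ) : ∃ k : Metric m (OrbitSpace S.ξ), k.inner = κ := by
  have hx : ∀ (x : M) v w, S.η x v = 0 → κ (orbitProj S.ξ x) (dproj S.ξ x v) (dproj S.ξ x w) =
      S.g.inner x v w := by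
    intro x v w hv
    rw [hκ.apply_dproj hq hreg, transverse_apply, hv, zero_mul, sub_zero]
  refine ⟨⟨κ, fun b u w => ?_, fun b u hu => ?_, fun b => ?_,
    hκ.smooth hq hS.isBasicForm_transverse⟩, rfl⟩
  · obtain ⟨x, rfl⟩ := Quot.mk_surjective b
    obtain ⟨v, hv, rfl⟩ := exists_horizontal_lift hq hreg x u
    obtain ⟨w, hw, rfl⟩ := exists_horizontal_lift hq hreg x w
    exact (hx x v w hv).trans ((S.g.symm x v w).trans (hx x w v hw).symm)
  · obtain ⟨x, rfl⟩ := Quot.mk_surjective b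
    obtain ⟨v, hv, rfl⟩ := exists_horizontal_lift hq hreg x u
    refine lt_of_lt_of_eq (S.g.pos x v ?_) (hx x v v hv).symm
    rintro rfl
    exact hu (map_zero _)
  · obtain ⟨x, rfl⟩ := Quot.mk_surjective b
    -- By horizontal lifts, the unit ball of the quotient metric lies in the image of the unit ball
    -- of `g` under the derivative of the projection.
    refine ((S.g.isVonNBounded x).image (dproj S.ξ x)).subset ?_
    intro u hu
    obtain ⟨v, hv, rfl⟩ := exists_horizontal_lift hq hreg x u
    exact ⟨v, lt_of_eq_of_lt (hx x v v hv).symm hu, rfl⟩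

/-- The Kähler structure induced on the space of orbits. -/
theorem exists_quotient_kahler (hS : S.IsAntiQuasiSasakian)
    {κ τ : Form2 m (OrbitSpace S.ξ)} {J : EndoField m (OrbitSpace S.ξ)}
    (hκ : FormDescends q S.transverse κ) (hτ : FormDescends q S.fund τ)
    (hJ : EndoDescends q S.φ J) :
    ∃ K : KahlerStructure m (OrbitSpace S.ξ), K.J = J ∧ K.k.inner = κ := by
  obtain ⟨k, hk⟩ := exists_quotient_metric hq hreg hS hκ
  have hlift := exists_horizontal_lift hq hreg
  have hJa := hJ.dproj_apply hq hreg
  have hκa := hκ.apply_dproj hq hreg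
  have hτa := hτ.apply_dproj hq hreg
  have hτeq : ∀ b v w, τ b v w = k.inner b v (J b w) := by
    intro b v w
    obtain ⟨x, rfl⟩ := Quot.mk_surjective b
    obtain ⟨v, hv, rfl⟩ := hlift x v
    obtain ⟨w, hw, rfl⟩ := hlift x w
    rw [hk]
    change τ (orbitProj S.ξ x) (dproj S.ξ x v) (dproj S.ξ x w) =
      κ (orbitProj S.ξ x) (dproj S.ξ x v) (J (orbitProj S.ξ x) (dproj S.ξ x w))
    rw [← hJa, hκa, hτa, transverse_apply, hv, zero_mul, sub_zero, fund_apply]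
  have hτskew : ∀ b v w, τ b v w = -τ b w v := by
    intro b v w
    obtain ⟨x, rfl⟩ := Quot.mk_surjective b
    obtain ⟨v, -, rfl⟩ := hlift x v
    obtain ⟨w, -, rfl⟩ := hlift x w
    exact (hτa x v w).trans ((fund_skew x v w).trans (congrArg Neg.neg (hτa x w v).symm))
  refine ⟨⟨J, k, hJ.smooth hq hS.isBasicEndo_φ, fun b v => ?_, fun b v w => ?_,
    fun X Y hX hY b => ?_, ?_⟩, rfl, hk⟩
  · obtain ⟨x, rfl⟩ := Quot.mk_surjective b
    obtain ⟨v, hv, rfl⟩ := hlift x v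
    change J (orbitProj S.ξ x) (J (orbitProj S.ξ x) (dproj S.ξ x v)) = -dproj S.ξ x v
    rw [← hJa, ← hJa, S.φ_sq, hv, zero_smul, add_zero, map_neg]
  · obtain ⟨x, rfl⟩ := Quot.mk_surjective b
    obtain ⟨v, hv, rfl⟩ := hlift x v
    obtain ⟨w, hw, rfl⟩ := hlift x w
    rw [hk]
    change κ (orbitProj S.ξ x) (J (orbitProj S.ξ x) (dproj S.ξ x v))
      (J (orbitProj S.ξ x) (dproj S.ξ x w)) =
        κ (orbitProj S.ξ x) (dproj S.ξ x v) (dproj S.ξ x w)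
    rw [← hJa, ← hJa, hκa, hκa, transverse_apply, transverse_apply, S.compatible, S.η_φ, zero_mul,
      sub_zero]
  -- The torsion of `φ` is a multiple of `ξ`, hence killed by the projection.
  · refine hJ.integrable hq hreg hS.isBasicEndo_φ (fun f v hv x y => ?_) hX hY b
    rw [hS.flatNij_eq f hv, map_smul, tailL_e₀, smul_zero]
  · have h1 : fundamentalForm k J = fun b v w => τ b v w := by
      funext b v w
      exact (hτeq b v w).symm
    rw [h1]
    exact hτ.isClosed2 hq hreg hS.isBasicForm_fund hτskew fun f v hv => hS.flatD2_fund f hv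

/-- The `2`-form induced by the exterior derivative of the contact form. -/
theorem isClosedForm20_of_descends (hS : S.IsAntiQuasiSasakian)
    {σ : Form2 m (OrbitSpace S.ξ)} {J : EndoField m (OrbitSpace S.ξ)}
    (hσ : FormDescends q (dForm S.η) σ) (hJ : EndoDescends q S.φ J) : IsClosedForm20 J σ := by
  have hlift := exists_horizontal_lift hq hreg
  have hJa := hJ.dproj_apply hq hreg
  have hσa := hσ.apply_dproj hq hreg
  have hb := hS.isBasicForm_dForm hreg
  have hskew : ∀ b v w, σ b v w = -σ b w v := by
    intro b v w
    obtain ⟨x, rfl⟩ := Quot.mk_surjective b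
    obtain ⟨v, -, rfl⟩ := hlift x v
    obtain ⟨w, -, rfl⟩ := hlift x w
    exact (hσa x v w).trans ((dForm_skew S.η x v w).trans (congrArg Neg.neg (hσa x w v).symm))
  refine ⟨hσ.smooth hq hb, hskew, ?_, fun b v w => ?_⟩
  · refine hσ.isClosed2 hq hreg hb hskew fun f v hv x y z => ?_
    refine flatD2_flatD1 (contDiffAt_η f hv)
      ((hb.contDiffAt f v hv).differentiableAt (by simp)) ?_ x y z
    filter_upwards [f.e.open_target.mem_nhds hv] with w hw x y
    rw [S.smooth_η.pullForm2_dForm f.mem hw, flatD1L_apply]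
  · obtain ⟨x, rfl⟩ := Quot.mk_surjective b
    obtain ⟨v, -, rfl⟩ := hlift x v
    obtain ⟨w, -, rfl⟩ := hlift x w
    change σ (orbitProj S.ξ x) (J (orbitProj S.ξ x) (dproj S.ξ x v))
      (J (orbitProj S.ξ x) (dproj S.ξ x w)) =
        -σ (orbitProj S.ξ x) (dproj S.ξ x v) (dproj S.ξ x w)
    rw [← hJa, ← hJa, hσa, hσa, hS.dForm_φ hreg]

end Quotient

theorem IsAntiQuasiSasakian.pullForm1_add (hS : S.IsAntiQuasiSasakian) (f : FlowBox S.ξ)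
    {v : Euc (m + 1)} (hv : v ∈ f.e.target) {t : ℝ} (ht : |v 0 + t| < f.a) :
    pullForm1 f.e S.η (v + t • e₀ m) = pullForm1 f.e S.η v :=
  f.eq_of_fderiv_e₀ (F := pullForm1 f.e S.η)
    (fun w hw => (contDiffAt_η f hw).differentiableAt (by simp))
    (fun w hw => (hS.flat f hw).1) hv ht

omit [T2Space M] in
/-- The horizontal part of a smooth vector field is smooth. -/
theorem smooth_horizontal {X : VField (m + 1) M} (hX : SmoothVField X) :
    SmoothVField (fun y => X y - S.η y (X y) • S.ξ y) :=
  ContMDiff.sub_section hX ((S.smooth_η.apply hX).smul_section S.smooth_ξ)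

/-- Since `ξ` annihilates `dη`, passing to horizontal parts changes nothing. -/
theorem IsAntiQuasiSasakian.curvature_eq (hS : S.IsAntiQuasiSasakian)
    (hreg : IsRegularField S.ξ) {X Y : VField (m + 1) M} (hX : SmoothVField X)
    (hY : SmoothVField Y) (x : M) : curvature S.η S.ξ X Y x = d1 S.η X Y x := by
  have hb := hS.isBasicForm_dForm hreg
  rw [curvature, S.smooth_η.d1_eq_dForm (smooth_horizontal hX) (smooth_horizontal hY),
    S.smooth_η.d1_eq_dForm hX hY]
  simp [hb.left, hb.right]

end AlmostContactMetric

end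

end AQS

theorem mainTheorem5 (n : ℕ) {M : Type*} [TopologicalSpace M] [T2Space M]
    [SecondCountableTopology M] [ChartedSpace (EuclideanSpace ℝ (Fin (2 * n + 1))) M]
    [IsManifold (𝓡 (2 * n + 1)) ∞ M]
    (S : AQS.AlmostContactMetric (2 * n + 1) M) (hS : S.IsAntiQuasiSasakian)
    (hreg : AQS.IsRegularField S.ξ) (hcpt : ∀ x, IsCompact (AQS.orbit S.ξ x)) :
    ∃ (c : M → ℝ) (_ : MulAction Circle M)
      (_ : ChartedSpace (EuclideanSpace ℝ (Fin (2 * n))) (AQS.OrbitSpace S.ξ))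
      (_ : IsManifold (𝓡 (2 * n)) ∞ (AQS.OrbitSpace S.ξ))
      (K : AQS.KahlerStructure (2 * n) (AQS.OrbitSpace S.ξ))
      (σ : AQS.Form2 (2 * n) (AQS.OrbitSpace S.ξ)),
      -- after scaling by a positive (locally) constant, `ξ` generates a free circle action
      IsLocallyConstant c ∧ (∀ x, 0 < c x) ∧
      AQS.IsSmoothFreeAction (2 * n + 1) M ∧
      AQS.Generates (fun x => c x • S.ξ x) ∧
      -- `M` is a principal circle bundle over the manifold `M/ξ`
      T2Space (AQS.OrbitSpace S.ξ) ∧ SecondCountableTopology (AQS.OrbitSpace S.ξ) ∧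
      AQS.IsPrincipalCircleBundle (m := 2 * n + 1) (d := 2 * n) (AQS.orbitProj S.ξ) ∧
      -- the Kähler structure of `M/ξ` is the one induced by `(φ, g)`
      (∀ (x : M) (v : TangentSpace (𝓡 (2 * n + 1)) x),
        mfderiv (𝓡 (2 * n + 1)) (𝓡 (2 * n)) (AQS.orbitProj S.ξ) x (S.φ x v) =
          K.J (AQS.orbitProj S.ξ x)
            (mfderiv (𝓡 (2 * n + 1)) (𝓡 (2 * n)) (AQS.orbitProj S.ξ) x v)) ∧
      (∀ (x : M) (v w : TangentSpace (𝓡 (2 * n + 1)) x), S.η x v = 0 → S.η x w = 0 →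
        K.k.inner (AQS.orbitProj S.ξ x)
            (mfderiv (𝓡 (2 * n + 1)) (𝓡 (2 * n)) (AQS.orbitProj S.ξ) x v)
            (mfderiv (𝓡 (2 * n + 1)) (𝓡 (2 * n)) (AQS.orbitProj S.ξ) x w) =
          S.g.inner x v w) ∧
      -- `σ` is a closed 2-form of type `(2,0)`
      AQS.IsClosedForm20 K.J σ ∧
      -- `η` is a connection form with curvature `dη = π^* σ`
      AQS.IsConnectionForm c S.η ∧
      ∀ X Y : AQS.VField (2 * n + 1) M, AQS.SmoothVField X → AQS.SmoothVField Y → ∀ x,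
        AQS.curvature S.η S.ξ X Y x = AQS.d1 S.η X Y x ∧
        AQS.d1 S.η X Y x = σ (AQS.orbitProj S.ξ x)
          (mfderiv (𝓡 (2 * n + 1)) (𝓡 (2 * n)) (AQS.orbitProj S.ξ) x (X x))
          (mfderiv (𝓡 (2 * n + 1)) (𝓡 (2 * n)) (AQS.orbitProj S.ξ) x (Y x)) := by
  have hη := fun (f : AQS.FlowBox S.ξ) v hv (t : ℝ) ht => hS.pullForm1_add f (v := v) hv (t := t) ht
  obtain ⟨Φ, c, hact, h⟩ := AQS.exists_isFlowAction S.smooth_ξ hreg hcpt hη S.η_ξ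
  obtain ⟨hC, hM, q, hq⟩ := h.flow.exists_isOrbitAtlas S.smooth_ξ hreg
  have hξ := S.smooth_ξ
  obtain ⟨κ, hκ⟩ := hS.isBasicForm_transverse.exists_descends h.flow hξ hreg hq
  obtain ⟨τ, hτ⟩ := hS.isBasicForm_fund.exists_descends h.flow hξ hreg hq
  obtain ⟨σ, hσ⟩ := (hS.isBasicForm_dForm hreg).exists_descends h.flow hξ hreg hq
  obtain ⟨J, hJ⟩ := hS.isBasicEndo_φ.exists_descends h.flow hξ hreg hq
  obtain ⟨K, rfl, hK⟩ := AQS.AlmostContactMetric.exists_quotient_kahler hq hreg hS hκ hτ hJ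
  refine ⟨c, hact, hC, hM, K, σ, h.isLocallyConstant, h.pos, h.isSmoothFreeAction hξ hreg,
    h.generates, h.t2Space hξ hreg, h.flow.secondCountableTopology hξ hreg,
    h.isPrincipalCircleBundle hξ hreg hq, hJ.dproj_apply hq hreg, fun x v w hv hw => ?_,
    AQS.AlmostContactMetric.isClosedForm20_of_descends hq hreg hS hσ hJ,
    h.isConnectionForm hξ hreg S.smooth_η hη S.η_ξ, fun X Y hX hY x => ⟨?_, ?_⟩⟩
  · rw [hK]
    refine (hκ.apply_dproj hq hreg x v w).trans ?_
    rw [AQS.AlmostContactMetric.transverse_apply, hv, zero_mul, sub_zero]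
  · exact hS.curvature_eq hreg hX hY x
  · rw [S.smooth_η.d1_eq_dForm hX hY]
    exact (hσ.apply_dproj hq hreg x (X x) (Y x)).symm
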